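/- **Conventions.** Manifolds are smooth, Hausdorff, second countable and of a fixed finite dimension $d$. A *smooth étale groupoid* $\mathsf G$ is a groupoid whose objects and arrows form manifolds $\mathsf G_0,\mathsf G_1$ and whose structure maps (source $s$, target $t$, unit, inverse, multiplication) are local diffeomorphisms; it is an *orbifold groupoid* if moreover $(s,t):\mathsf G_1\to\mathsf G_0\times\mathsf G_0$ is proper. A *$\mathsf G$-sheaf* is a sheaf of abelian groups on $\mathsf G_0$ with a continuous right action of $\mathsf G_1$ ($\mathcal F_x\to\mathcal F_y$, $a\mapsto ag$, for $g:x\to y$); $\Gamma_{inv}(\mathsf G,\mathcal F)$ is the group of its invariant global sections. For a bounded below complex $\mathcal F^\bullet$ of $\mathsf G$-sheaves and $p\in\mathbb Z$, the hypercohomology $\mathbb H^p(\mathsf G,\mathcal F^\bullet)$ is the $p$-th cohomology group of $\Gamma_{inv}(\mathsf G,\mathcal T^\bullet)$, where $\mathcal F^\bullet\to\mathcal T^\bullet$ is a quasi-isomorphism to a bounded below complex of injective $\mathsf G$-sheaves; $H^p(\mathsf G,\mathcal F)$ is the hypercohomology of $\mathcal F$ placed in degree $0$ (so it is $0$ for $p<0$).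 Let $\mathcal A^k$ be the $\mathsf G$-sheaf of smooth complex-valued differential $k$-forms on $\mathsf G_0$ (arrows act by pullback), $\underline{\mathbb C}^\times$ the $\mathsf G$-sheaf of smooth $\mathbb C^\times$-valued functions, $\mathbb C^\times$ and $\mathbb Z$ the constant $\mathsf G$-sheaves (locally constant functions), and $\mathbb Z(n)=(2\pi\sqrt{-1})^n\mathbb Z\subset\mathbb C$. For an integer $n\ge 1$ consider the complexes of $\mathsf G$-sheaves, both starting in degree $0$, $$\mathbb Z(n)_D^\infty:\quad \mathbb Z(n)\hookrightarrow\mathcal A^0\xrightarrow{d}\mathcal A^1\xrightarrow{d}\cdots\xrightarrow{d}\mathcal A^{n-1},\qquad \mathbb C^\times(n):\quad \underline{\mathbb C}^\times\xrightarrow{d\log}\mathcal A^1\xrightarrow{d}\cdots\xrightarrow{d}\mathcal A^{n-1}.$$ **Proposition.** Let $\mathsf G$ be a smooth étale groupoid and $n\ge1$. 1. For every $p\in\mathbb Z$ there is an isomorphism $\mathbb H^p(\mathsf G,\mathbb Z(n)_D^\infty)\cong\mathbb H^{p-1}(\mathsf G,\mathbb C^\times(n))$. 2. If $\mathsf G$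 is an orbifold groupoid (that is, proper), then for every $p>n$ the projection $\mathbb C^\times(n)\to\underline{\mathbb C}^\times$ to the term of degree $0$ induces an isomorphism $\mathbb H^{p-1}(\mathsf G,\mathbb C^\times(n))\cong H^{p-1}(\mathsf G,\underline{\mathbb C}^\times)$, and $H^{p-1}(\mathsf G,\underline{\mathbb C}^\times)\cong H^p(\mathsf G,\mathbb Z)$. 3. For every $p<n$ the inclusion of the locally constant functions $\mathbb C^\times\to\mathbb C^\times(n)$ (into the term of degree $0$) induces an isomorphism $H^{p-1}(\mathsf G,\mathbb C^\times)\cong\mathbb H^{p-1}(\mathsf G,\mathbb C^\times(n))$. -/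

import Mathlib

open CategoryTheory TopologicalSpace Topology Filter
open scoped Manifold ContDiff

universe u

namespace DeligneGroupoid

section Forms
set_option linter.unusedSectionVars false
variable {d : ℕ}

/-- The fibre of the bundle of complex-valued `k`-forms on a `d`-manifold (tangent spaces of a
manifold modelled on `ℝ^d` are identified with `ℝ^d`, as everywhere in Mathlib). -/
abbrev FormFiber (d k : ℕ) : Type := EuclideanSpace ℝ (Fin d) [⋀^Fin k]→L[ℝ] ℂ

variable {M : Type*} [TopologicalSpace M] [ChartedSpace (EuclideanSpace ℝ (Fin d)) M]
variable {N : Type*} [TopologicalSpace N] [ChartedSpace (EuclideanSpace ℝ (Fin d)) N]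

/-- The differential at `x` of a map between `d`-manifolds, as an endomorphism of `ℝ^d`. -/
noncomputable def tangentMapAt (d : ℕ) {M N : Type*} [TopologicalSpace M]
    [ChartedSpace (EuclideanSpace ℝ (Fin d)) M] [TopologicalSpace N]
    [ChartedSpace (EuclideanSpace ℝ (Fin d)) N] (f : M → N) (x : M) :
    EuclideanSpace ℝ (Fin d) →L[ℝ] EuclideanSpace ℝ (Fin d) :=
  mfderiv (𝓡 d) (𝓡 d) f x

/-- Pullback of a differential form along a map. -/
noncomputable def pullForm {k : ℕ} (f : M → N) (α : N → FormFiber d k) : M → FormFiber d k :=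
  fun x => (α (f x)).compContinuousLinearMap (tangentMapAt d f x)

/-- The form `α` in the preferred chart at `x₀`. -/
noncomputable def localForm {k : ℕ} (α : M → FormFiber d k) (x₀ : M) :
    EuclideanSpace ℝ (Fin d) → FormFiber d k :=
  pullForm (extChartAt (𝓡 d) x₀).symm α

/-- The form `α` is smooth at `x₀`. -/
def SmoothFormAt {k : ℕ} (α : M → FormFiber d k) (x₀ : M) : Prop :=
  ContDiffAt ℝ ∞ (localForm α x₀) (extChartAt (𝓡 d) x₀ x₀)

/-- The exterior derivative of a form on a manifold, computed at each point in the preferred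
chart. -/
noncomputable def dForm {k : ℕ} (α : M → FormFiber d k) : M → FormFiber d (k + 1) := fun x =>
  (extDeriv (localForm α x) (extChartAt (𝓡 d) x x)).compContinuousLinearMap
    (tangentMapAt d (extChartAt (𝓡 d) x) x)

theorem contDiffAt_compCLM {k : ℕ} {E : Type*} [NormedAddCommGroup E] [NormedSpace ℝ E] {x : E}
    {α : E → FormFiber d k}
    {A : E → EuclideanSpace ℝ (Fin d) →L[ℝ] EuclideanSpace ℝ (Fin d)}
    (hα : ContDiffAt ℝ ∞ α x) (hA : ContDiffAt ℝ ∞ A x) :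
    ContDiffAt ℝ ∞ (fun y => (α y).compContinuousLinearMap (A y)) x := by
  let V := EuclideanSpace ℝ (Fin d)
  let ι : (V [⋀^Fin k]→L[ℝ] ℂ) →L[ℝ] ContinuousMultilinearMap ℝ (fun _ : Fin k => V) ℂ :=
    ContinuousAlternatingMap.toContinuousMultilinearMapCLM ℝ
  have hι : LinearMap.ker ι.toLinearMap = ⊥ := by
    rw [LinearMap.ker_eq_bot]
    intro a b h
    exact ContinuousAlternatingMap.toContinuousMultilinearMap_injective h
  obtain ⟨π, hπ⟩ := LinearMap.exists_leftInverse_of_injective _ hι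
  have hfin : FiniteDimensional ℝ (ContinuousMultilinearMap ℝ (fun _ : Fin k => V) ℂ) :=
    FiniteDimensional.of_injective
      (ContinuousMultilinearMap.toMultilinearMapLinear (R' := ℝ) (A := ℝ)
        (M₁ := fun _ : Fin k => V) (M₂ := ℂ))
      ContinuousMultilinearMap.toMultilinearMap_injective
  let πc := LinearMap.toContinuousLinearMap π
  have h1 : (fun y => (α y).compContinuousLinearMap (A y)) = fun y =>
      πc (ContinuousMultilinearMap.compContinuousLinearMapContinuousMultilinear ℝ
        (fun _ : Fin k => V) (fun _ : Fin k => V) ℂ (fun _ => A y) (ι (α y))) := by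
    funext y
    exact (LinearMap.congr_fun hπ ((α y).compContinuousLinearMap (A y))).symm
  rw [h1]
  refine πc.contDiff.contDiffAt.comp x (ContDiffAt.clm_apply ?_ (ι.contDiff.contDiffAt.comp x hα))
  refine ContDiffAt.comp x (g := (ContinuousMultilinearMap.compContinuousLinearMapContinuousMultilinear ℝ
        (fun _ : Fin k => V) (fun _ : Fin k => V) ℂ)) ?_ (contDiffAt_pi.2 fun _ => hA)
  exact (ContinuousMultilinearMap.contDiff _).contDiffAt

variable [IsManifold (𝓡 d) ∞ M] [IsManifold (𝓡 d) ∞ N]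

theorem tangentMapAt_comp {P : Type*} [TopologicalSpace P]
    [ChartedSpace (EuclideanSpace ℝ (Fin d)) P] {f : M → N} {g : N → P} {x : M}
    (hg : MDifferentiableAt (𝓡 d) (𝓡 d) g (f x)) (hf : MDifferentiableAt (𝓡 d) (𝓡 d) f x) :
    tangentMapAt d (g ∘ f) x = (tangentMapAt d g (f x)).comp (tangentMapAt d f x) :=
  mfderiv_comp x hg hf

theorem tangentMapAt_congr {f g : M → N} {x : M} (h : f =ᶠ[𝓝 x] g) :
    tangentMapAt d f x = tangentMapAt d g x := by
  unfold tangentMapAt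
  exact h.mfderiv_eq

theorem pullForm_comp_eq {P : Type*} [TopologicalSpace P]
    [ChartedSpace (EuclideanSpace ℝ (Fin d)) P] {k : ℕ} {f : M → N} {g : N → P} {x : M}
    (α : P → FormFiber d k)
    (hg : MDifferentiableAt (𝓡 d) (𝓡 d) g (f x)) (hf : MDifferentiableAt (𝓡 d) (𝓡 d) f x) :
    pullForm (g ∘ f) α x = pullForm f (pullForm g α) x := by
  simp only [pullForm, tangentMapAt_comp hg hf]
  rfl

theorem pullForm_congr_at {k : ℕ} {f g : M → N} {x : M} (α : N → FormFiber d k)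
    (h : f =ᶠ[𝓝 x] g) : pullForm f α x = pullForm g α x := by
  simp only [pullForm, tangentMapAt_congr h, h.self_of_nhds]

theorem eventually_mdiff {f : M → N} {x : M} (hf : ContMDiffAt (𝓡 d) (𝓡 d) ∞ f x) :
    ∀ᶠ y in 𝓝 x, MDifferentiableAt (𝓡 d) (𝓡 d) f y := by
  have h1 : ContMDiffAt (𝓡 d) (𝓡 d) 1 f x := hf.of_le (by simp)
  have := (contMDiffAt_iff_contMDiffAt_nhds (by simp)).1 h1
  filter_upwards [this] with y hy using hy.mdifferentiableAt (by simp)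

theorem eventually_smooth_symm (x₀ : M) :
    ∀ᶠ v in 𝓝 (extChartAt (𝓡 d) x₀ x₀),
      ContMDiffAt (𝓡 d) (𝓡 d) ∞ (extChartAt (𝓡 d) x₀).symm v := by
  filter_upwards [extChartAt_target_mem_nhds (I := 𝓡 d) x₀] with v hv
  exact (contMDiffOn_extChartAt_symm x₀).contMDiffAt
    ((isOpen_extChartAt_target (I := 𝓡 d) x₀).mem_nhds hv)

/-- Local form of a pullback. -/
theorem localForm_pullForm {k : ℕ} {f : M → N} {x : M} (α : N → FormFiber d k)
    (hf : ContMDiffAt (𝓡 d) (𝓡 d) ∞ f x) :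
    localForm (pullForm f α) x =ᶠ[𝓝 (extChartAt (𝓡 d) x x)]
      fun v => (localForm α (f x)
        ((extChartAt (𝓡 d) (f x) ∘ f ∘ (extChartAt (𝓡 d) x).symm) v)).compContinuousLinearMap
        (fderiv ℝ (extChartAt (𝓡 d) (f x) ∘ f ∘ (extChartAt (𝓡 d) x).symm) v) := by
  have hxx : (extChartAt (𝓡 d) x).symm (extChartAt (𝓡 d) x x) = x := extChartAt_to_inv x
  have hcont : ContinuousAt (extChartAt (𝓡 d) x).symm (extChartAt (𝓡 d) x x) :=
    continuousAt_extChartAt_symm x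
  have hsrc : ∀ᶠ y in 𝓝 x, f y ∈ (extChartAt (𝓡 d) (f x)).source :=
    hf.continuousAt (extChartAt_source_mem_nhds (I := 𝓡 d) (f x))
  have t1 : Tendsto (extChartAt (𝓡 d) x).symm (𝓝 (extChartAt (𝓡 d) x x)) (𝓝 x) := by
    have := hcont.tendsto; rwa [hxx] at this
  filter_upwards [(t1.eventually (hsrc.and (eventually_mdiff hf))).eventually_nhds,
    (eventually_smooth_symm x)] with v hv h2
  have hv0 := hv.self_of_nhds
  set e := extChartAt (𝓡 d) x
  set φ := extChartAt (𝓡 d) (f x)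
  have hse : MDifferentiableAt (𝓡 d) (𝓡 d) e.symm v := h2.mdifferentiableAt (by simp)
  have hfm := hv0.2
  have hφ : MDifferentiableAt (𝓡 d) (𝓡 d) φ (f (e.symm v)) := by
    apply mdifferentiableAt_extChartAt
    simpa [φ] using hv0.1
  have hφs : MDifferentiableAt (𝓡 d) (𝓡 d) φ.symm (φ (f (e.symm v))) := by
    have := (contMDiffOn_extChartAt_symm (I := 𝓡 d) (n := ∞) (f x)).contMDiffAt
      ((isOpen_extChartAt_target (I := 𝓡 d) (f x)).mem_nhds (φ.map_source hv0.1))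
    exact this.mdifferentiableAt (by simp)
  have hF : MDifferentiableAt (𝓡 d) (𝓡 d) (φ ∘ f ∘ e.symm) v :=
    MDifferentiableAt.comp v hφ (MDifferentiableAt.comp v hfm hse)
  have e1 : pullForm e.symm (pullForm f α) v = pullForm (f ∘ e.symm) α v :=
    (pullForm_comp_eq α hfm hse).symm
  have e2 : pullForm (f ∘ e.symm) α v = pullForm (φ.symm ∘ (φ ∘ f ∘ e.symm)) α v := by
    apply pullForm_congr_at
    filter_upwards [hv] with w hw
    exact (φ.left_inv hw.1).symm
  have e3 := pullForm_comp_eq (f := φ ∘ f ∘ e.symm) (g := φ.symm) α hφs hF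
  show pullForm e.symm (pullForm f α) v = _
  rw [e1, e2, e3]
  simp only [pullForm, tangentMapAt, mfderiv_eq_fderiv]
  rfl

theorem minSmoothness_two_le : minSmoothness ℝ 2 ≤ (∞ : WithTop ℕ∞) := by
  rw [minSmoothness_of_isRCLikeNormedField]
  exact WithTop.coe_le_coe.2 le_top

theorem contDiffAt_writtenIn {f : M → N} {x : M} (hf : ContMDiffAt (𝓡 d) (𝓡 d) ∞ f x) :
    ContDiffAt ℝ ∞ (extChartAt (𝓡 d) (f x) ∘ f ∘ (extChartAt (𝓡 d) x).symm)
      (extChartAt (𝓡 d) x x) := by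
  have := (contMDiffAt_iff.1 hf).2
  simpa [ContDiffAt] using this

theorem SmoothFormAt.pull {k : ℕ} {f : M → N} {x : M} {α : N → FormFiber d k}
    (hα : SmoothFormAt α (f x)) (hf : ContMDiffAt (𝓡 d) (𝓡 d) ∞ f x) :
    SmoothFormAt (pullForm f α) x := by
  refine ContDiffAt.congr_of_eventuallyEq ?_ (localForm_pullForm α hf)
  have hF := contDiffAt_writtenIn hf
  have hval : (extChartAt (𝓡 d) (f x) ∘ f ∘ (extChartAt (𝓡 d) x).symm) (extChartAt (𝓡 d) x x)
      = extChartAt (𝓡 d) (f x) (f x) := by simp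
  refine contDiffAt_compCLM (ContDiffAt.comp _ ?_ hF) (hF.fderiv_right (m := ∞) (by simp))
  rw [hval]
  exact hα

theorem dForm_pull {k : ℕ} {f : M → N} {x : M} {α : N → FormFiber d k}
    (hα : SmoothFormAt α (f x)) (hf : ContMDiffAt (𝓡 d) (𝓡 d) ∞ f x) :
    dForm (pullForm f α) x = pullForm f (dForm α) x := by
  have hF := contDiffAt_writtenIn hf
  have hxx : (extChartAt (𝓡 d) x).symm (extChartAt (𝓡 d) x x) = x := extChartAt_to_inv x
  have hval : (extChartAt (𝓡 d) (f x) ∘ f ∘ (extChartAt (𝓡 d) x).symm) (extChartAt (𝓡 d) x x)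
      = extChartAt (𝓡 d) (f x) (f x) := by simp
  have hα' : ContDiffAt ℝ ∞ (localForm α (f x)) ((extChartAt (𝓡 d) (f x) ∘ f ∘
      (extChartAt (𝓡 d) x).symm) (extChartAt (𝓡 d) x x)) := by rw [hval]; exact hα
  have h1 : extDeriv (localForm (pullForm f α) x) (extChartAt (𝓡 d) x x) = _ :=
    (localForm_pullForm α hf).extDeriv_eq
  rw [extDeriv_pullback (r := ∞) (hα'.differentiableAt (by simp)) hF minSmoothness_two_le, hval] at h1
  simp only [dForm, pullForm, h1]
  have hmf : MDifferentiableAt (𝓡 d) (𝓡 d) f x := hf.mdifferentiableAt (by simp)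
  have hme : MDifferentiableAt (𝓡 d) (𝓡 d) (extChartAt (𝓡 d) x) x :=
    mdifferentiableAt_extChartAt (by simp)
  have hmφ : MDifferentiableAt (𝓡 d) (𝓡 d) (extChartAt (𝓡 d) (f x)) (f x) :=
    mdifferentiableAt_extChartAt (by simp)
  have hmF : MDifferentiableAt (𝓡 d) (𝓡 d) (extChartAt (𝓡 d) (f x) ∘ f ∘
      (extChartAt (𝓡 d) x).symm) (extChartAt (𝓡 d) x x) :=
    (hF.contMDiffAt).mdifferentiableAt (by simp)
  have c1 := tangentMapAt_comp (f := extChartAt (𝓡 d) x) (x := x) hmF hme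
  have c2 := tangentMapAt_comp (f := f) (x := x) hmφ hmf
  have c3 : tangentMapAt d ((extChartAt (𝓡 d) (f x) ∘ f ∘ (extChartAt (𝓡 d) x).symm) ∘
      (extChartAt (𝓡 d) x)) x = tangentMapAt d (extChartAt (𝓡 d) (f x) ∘ f) x := by
    apply tangentMapAt_congr
    filter_upwards [extChartAt_source_mem_nhds (I := 𝓡 d) x] with y hy
    simp only [Function.comp_apply, (extChartAt (𝓡 d) x).left_inv hy]
  have c4 : (fderiv ℝ (extChartAt (𝓡 d) (f x) ∘ f ∘ (extChartAt (𝓡 d) x).symm)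
      (extChartAt (𝓡 d) x x)).comp (tangentMapAt d (extChartAt (𝓡 d) x) x) =
      (tangentMapAt d (extChartAt (𝓡 d) (f x)) (f x)).comp (tangentMapAt d f x) := by
    rw [← c2, ← c3, c1]
    simp only [tangentMapAt, mfderiv_eq_fderiv]
  ext v
  simp only [ContinuousAlternatingMap.compContinuousLinearMap_apply]
  congr 1
  funext i
  exact DFunLike.congr_fun c4 (v i)

theorem localForm_vectorSpace {k : ℕ} (α : EuclideanSpace ℝ (Fin d) → FormFiber d k)
    (x : EuclideanSpace ℝ (Fin d)) : localForm α x = α := by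
  funext v
  have : tangentMapAt d (extChartAt (𝓡 d) x).symm v = ContinuousLinearMap.id ℝ _ := by
    simp only [tangentMapAt, mfderiv_eq_fderiv, extChartAt_model_space_eq_id]
    exact fderiv_id
  simp only [localForm, pullForm, this]
  simp
  rfl

theorem dForm_vectorSpace {k : ℕ} (α : EuclideanSpace ℝ (Fin d) → FormFiber d k)
    (x : EuclideanSpace ℝ (Fin d)) : dForm α x = extDeriv α x := by
  have : tangentMapAt d (extChartAt (𝓡 d) x) x = ContinuousLinearMap.id ℝ _ := by
    simp only [tangentMapAt, mfderiv_eq_fderiv, extChartAt_model_space_eq_id]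
    exact fderiv_id
  simp only [dForm, this, localForm_vectorSpace]
  rfl

theorem localForm_dForm {k : ℕ} {α : M → FormFiber d k} {x : M}
    (hα : ∀ᶠ y in 𝓝 x, SmoothFormAt α y) :
    localForm (dForm α) x =ᶠ[𝓝 (extChartAt (𝓡 d) x x)] extDeriv (localForm α x) := by
  have hcont : ContinuousAt (extChartAt (𝓡 d) x).symm (extChartAt (𝓡 d) x x) :=
    continuousAt_extChartAt_symm x
  have t1 : Tendsto (extChartAt (𝓡 d) x).symm (𝓝 (extChartAt (𝓡 d) x x)) (𝓝 x) := by
    have := hcont.tendsto; rwa [extChartAt_to_inv x] at this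
  filter_upwards [t1.eventually hα, eventually_smooth_symm x] with v hv h2
  have := dForm_pull hv h2
  rw [dForm_vectorSpace] at this
  exact this.symm

theorem contDiffAt_extDeriv {k : ℕ} {α : EuclideanSpace ℝ (Fin d) → FormFiber d k}
    {x : EuclideanSpace ℝ (Fin d)} (hα : ContDiffAt ℝ ∞ α x) : ContDiffAt ℝ ∞ (extDeriv α) x :=
  ContDiffAt.comp x (g := ContinuousAlternatingMap.alternatizeUncurryFinCLM ℝ
    (EuclideanSpace ℝ (Fin d)) ℂ (n := k)) (ContinuousLinearMap.contDiff _).contDiffAt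
    (hα.fderiv_right (m := ∞) (by simp))

theorem SmoothFormAt.dForm {k : ℕ} {α : M → FormFiber d k} {x : M}
    (hα : ∀ᶠ y in 𝓝 x, SmoothFormAt α y) : SmoothFormAt (dForm α) x :=
  (contDiffAt_extDeriv hα.self_of_nhds).congr_of_eventuallyEq (localForm_dForm hα)

theorem dForm_dForm {k : ℕ} {α : M → FormFiber d k} {x : M}
    (hα : ∀ᶠ y in 𝓝 x, SmoothFormAt α y) :
    DeligneGroupoid.dForm (DeligneGroupoid.dForm α) x = 0 := by
  have h1 := (localForm_dForm hα).extDeriv_eq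
  rw [extDeriv_extDeriv_apply (r := ∞) hα.self_of_nhds minSmoothness_two_le] at h1
  simp only [DeligneGroupoid.dForm] at h1 ⊢
  rw [h1]
  ext v
  simp

theorem localForm_congr {k : ℕ} {α η : M → FormFiber d k} {x : M} (h : α =ᶠ[𝓝 x] η) :
    localForm α x =ᶠ[𝓝 (extChartAt (𝓡 d) x x)] localForm η x := by
  have hcont : ContinuousAt (extChartAt (𝓡 d) x).symm (extChartAt (𝓡 d) x x) :=
    continuousAt_extChartAt_symm x
  have t1 : Tendsto (extChartAt (𝓡 d) x).symm (𝓝 (extChartAt (𝓡 d) x x)) (𝓝 x) := by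
    have := hcont.tendsto; rwa [extChartAt_to_inv x] at this
  filter_upwards [t1.eventually h] with v hv
  simp only [localForm, pullForm, hv]

theorem SmoothFormAt.congr {k : ℕ} {α η : M → FormFiber d k} {x : M} (h : α =ᶠ[𝓝 x] η)
    (hα : SmoothFormAt α x) : SmoothFormAt η x :=
  ContDiffAt.congr_of_eventuallyEq hα (localForm_congr h).symm

theorem dForm_congr {k : ℕ} {α η : M → FormFiber d k} {x : M} (h : α =ᶠ[𝓝 x] η) :
    DeligneGroupoid.dForm α x = DeligneGroupoid.dForm η x := by
  simp only [DeligneGroupoid.dForm, (localForm_congr h).extDeriv_eq]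

theorem localForm_add {k : ℕ} (α η : M → FormFiber d k) (x : M) :
    localForm (α + η) x = localForm α x + localForm η x := rfl

theorem localForm_neg {k : ℕ} (α : M → FormFiber d k) (x : M) :
    localForm (-α) x = -localForm α x := rfl

theorem SmoothFormAt.add {k : ℕ} {α η : M → FormFiber d k} {x : M} (hα : SmoothFormAt α x)
    (hη : SmoothFormAt η x) : SmoothFormAt (α + η) x :=
  ContDiffAt.add hα hη

theorem SmoothFormAt.neg {k : ℕ} {α : M → FormFiber d k} {x : M} (hα : SmoothFormAt α x) :
    SmoothFormAt (-α) x :=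
  ContDiffAt.neg hα

theorem SmoothFormAt.zero {k : ℕ} (x : M) : SmoothFormAt (0 : M → FormFiber d k) x := by
  have : localForm (0 : M → FormFiber d k) x = fun _ => 0 := rfl
  unfold SmoothFormAt
  rw [this]
  exact contDiffAt_const

theorem dForm_add {k : ℕ} {α η : M → FormFiber d k} {x : M} (hα : SmoothFormAt α x)
    (hη : SmoothFormAt η x) :
    DeligneGroupoid.dForm (α + η) x = DeligneGroupoid.dForm α x + DeligneGroupoid.dForm η x := by
  simp only [DeligneGroupoid.dForm, localForm_add,
    extDeriv_add (hα.differentiableAt (by simp)) (hη.differentiableAt (by simp))]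
  rfl


/-- A complex-valued function as a `0`-form. -/
noncomputable def zeroForm (f : M → ℂ) : M → FormFiber d 0 := fun x =>
  ContinuousAlternatingMap.constOfIsEmpty ℝ (EuclideanSpace ℝ (Fin d)) (Fin 0) (f x)

theorem pullForm_zeroForm (f : M → N) (u : N → ℂ) :
    pullForm f (zeroForm (d := d) u) = zeroForm (u ∘ f) := by
  funext x
  ext v
  rfl

theorem contDiffAt_comp_chart {n : WithTop ℕ∞} {u : M → ℂ} {x : M}
    (hu : ContMDiffAt (𝓡 d) 𝓘(ℝ, ℂ) n u x) (hn : n ≤ ∞ := by simp) :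
    ContDiffAt ℝ n (u ∘ (extChartAt (𝓡 d) x).symm) (extChartAt (𝓡 d) x x) := by
  have h := (eventually_smooth_symm (d := d) x).self_of_nhds
  rw [← contMDiffAt_iff_contDiffAt]
  refine ContMDiffAt.comp (g := u) _ ?_ (h.of_le hn)
  rwa [extChartAt_to_inv]

theorem smoothFormAt_zeroForm {u : M → ℂ} {x : M}
    (hu : ContMDiffAt (𝓡 d) 𝓘(ℝ, ℂ) ∞ u x) : SmoothFormAt (zeroForm (d := d) u) x := by
  have h2 := contDiffAt_comp_chart hu
  unfold SmoothFormAt localForm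
  rw [pullForm_zeroForm]
  exact (ContinuousAlternatingMap.constOfIsEmptyLIE ℝ (EuclideanSpace ℝ (Fin d)) ℂ
    (Fin 0)).contDiff.contDiffAt.comp _ h2

theorem dForm_zeroForm (u : M → ℂ) (x : M) :
    dForm (zeroForm (d := d) u) x =
      (ContinuousAlternatingMap.ofSubsingleton ℝ (EuclideanSpace ℝ (Fin d)) ℂ (0 : Fin 1)
        (fderiv ℝ (u ∘ (extChartAt (𝓡 d) x).symm) (extChartAt (𝓡 d) x x))).compContinuousLinearMap
        (tangentMapAt d (extChartAt (𝓡 d) x) x) := by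
  simp only [dForm, localForm, pullForm_zeroForm]
  congr 1
  exact extDeriv_constOfIsEmpty _ _

theorem dForm_zeroForm_const {u : M → ℂ} {x : M} (h : ∀ᶠ y in 𝓝 x, u y = u x) :
    dForm (zeroForm (d := d) u) x = 0 := by
  have h1 : zeroForm (d := d) u =ᶠ[𝓝 x] zeroForm (fun _ => u x) := by
    filter_upwards [h] with y hy
    simp only [zeroForm, hy]
  rw [dForm_congr h1, dForm_zeroForm]
  have : ((fun _ => u x) ∘ (extChartAt (𝓡 d) x).symm) = fun _ => u x := rfl
  rw [this, fderiv_fun_const]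
  ext v
  simp

/-- The logarithmic differential `d log u = u⁻¹ du`. -/
noncomputable def dlogForm (u : M → Additive ℂˣ) : M → FormFiber d 1 := fun x =>
  ((u x).toMul : ℂ)⁻¹ • dForm (zeroForm fun y => ((u y).toMul : ℂ)) x

/-- Smoothness at a point of a `ℂˣ`-valued function. -/
def SmoothUnitAt (d : ℕ) {M : Type*} [TopologicalSpace M]
    [ChartedSpace (EuclideanSpace ℝ (Fin d)) M] (u : M → Additive ℂˣ) (x : M) : Prop :=
  ContMDiffAt (𝓡 d) 𝓘(ℝ, ℂ) ∞ (fun y => ((u y).toMul : ℂ)) x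

theorem dlogForm_congr {u v : M → Additive ℂˣ} {x : M} (h : u =ᶠ[𝓝 x] v) :
    dlogForm (d := d) u x = dlogForm v x := by
  have h1 : (zeroForm (d := d) fun y => ((u y).toMul : ℂ)) =ᶠ[𝓝 x]
      zeroForm fun y => ((v y).toMul : ℂ) := by
    filter_upwards [h] with y hy
    simp only [zeroForm, hy]
  simp only [dlogForm, dForm_congr h1, h.self_of_nhds]

theorem dlogForm_pull {f : M → N} {u : N → Additive ℂˣ} {x : M}
    (hu : SmoothUnitAt d u (f x)) (hf : ContMDiffAt (𝓡 d) (𝓡 d) ∞ f x) :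
    dlogForm (d := d) (u ∘ f) x = pullForm f (dlogForm u) x := by
  have h := dForm_pull (smoothFormAt_zeroForm hu) hf
  rw [pullForm_zeroForm] at h
  have h' : dForm (zeroForm (d := d) fun y => ((u (f y)).toMul : ℂ)) x = _ := h
  simp only [dlogForm, Function.comp_apply, h']
  rfl

/-- Near each point, the logarithmic differential is the differential of a branch of `log`. -/
theorem dlogForm_eq_dForm_log {u : M → Additive ℂˣ} {x : M}
    (hu : ∀ᶠ y in 𝓝 x, SmoothUnitAt d u y) :
    ∃ w : M → ℂ, (∀ᶠ y in 𝓝 x, ContMDiffAt (𝓡 d) 𝓘(ℝ, ℂ) ∞ w y) ∧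
      dlogForm (d := d) u =ᶠ[𝓝 x] dForm (zeroForm w) := by
  set c : ℂ := ((u x).toMul : ℂ)⁻¹ with hc
  have hc0 : c ≠ 0 := inv_ne_zero (Units.ne_zero _)
  have hlog : ∀ {z : ℂ}, z ∈ Complex.slitPlane →
      ContDiffAt ℝ ∞ Complex.log z := fun hz =>
    (Complex.contDiffAt_log hz).restrict_scalars ℝ
  have key : ∀ y, SmoothUnitAt d u y → c * ((u y).toMul : ℂ) ∈ Complex.slitPlane →
      ContMDiffAt (𝓡 d) 𝓘(ℝ, ℂ) ∞ (fun y => Complex.log (c * ((u y).toMul : ℂ))) y := by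
    intro y hy hs
    have h1 : ContDiffAt ℝ ∞ (fun z => Complex.log (c * z)) ((u y).toMul : ℂ) :=
      ContDiffAt.comp (g := Complex.log) _ (hlog hs) (contDiffAt_const.mul contDiffAt_id)
    exact ContMDiffAt.comp (g := fun z => Complex.log (c * z)) y h1.contMDiffAt hy
  have hx : c * ((u x).toMul : ℂ) ∈ Complex.slitPlane := by
    rw [hc, inv_mul_cancel₀ (Units.ne_zero _)]
    exact Complex.one_mem_slitPlane
  have hsl : ∀ᶠ y in 𝓝 x, c * ((u y).toMul : ℂ) ∈ Complex.slitPlane :=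
    (continuousAt_const.mul hu.self_of_nhds.continuousAt).eventually
      (Complex.isOpen_slitPlane.mem_nhds hx)
  refine ⟨_, (hu.and hsl).mono fun y hy => key y hy.1 hy.2, ?_⟩
  filter_upwards [hu, hsl] with y hy hys
  rw [dlogForm, dForm_zeroForm, dForm_zeroForm]
  set e := extChartAt (𝓡 d) y
  have hd : DifferentiableAt ℝ ((fun y => ((u y).toMul : ℂ)) ∘ e.symm) (e y) := by
    exact (contDiffAt_comp_chart hy).differentiableAt (by simp)
  have hey : e.symm (e y) = y := extChartAt_to_inv y
  have hfd : fderiv ℝ ((fun y => Complex.log (c * ((u y).toMul : ℂ))) ∘ e.symm) (e y) =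
      ((u y).toMul : ℂ)⁻¹ • fderiv ℝ ((fun y => ((u y).toMul : ℂ)) ∘ e.symm) (e y) := by
    have h1 : c * (((fun y => ((u y).toMul : ℂ)) ∘ e.symm) (e y)) ∈ Complex.slitPlane := by
      simpa [hey] using hys
    have h2 := ((Complex.hasStrictDerivAt_log h1).hasDerivAt.hasFDerivAt.restrictScalars ℝ).comp
      (e y) (hd.hasFDerivAt.const_mul c)
    refine Eq.trans h2.fderiv ?_
    ext v
    simp only [Function.comp_apply, hey]
    simp
    field_simp
  rw [hfd]
  ext v
  simp

theorem SmoothUnitAt.dlogForm {u : M → Additive ℂˣ} {x : M}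
    (hu : ∀ᶠ y in 𝓝 x, SmoothUnitAt d u y) : SmoothFormAt (dlogForm (d := d) u) x := by
  obtain ⟨w, hw, he⟩ := dlogForm_eq_dForm_log hu
  exact (SmoothFormAt.dForm (hw.mono fun y hy => smoothFormAt_zeroForm hy)).congr he.symm

theorem dForm_dlogForm {u : M → Additive ℂˣ} {x : M}
    (hu : ∀ᶠ y in 𝓝 x, SmoothUnitAt d u y) : dForm (dlogForm (d := d) u) x = 0 := by
  obtain ⟨w, hw, he⟩ := dlogForm_eq_dForm_log hu
  rw [dForm_congr he, dForm_dForm (hw.mono fun y hy => smoothFormAt_zeroForm hy)]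

theorem SmoothUnitAt.congr {u v : M → Additive ℂˣ} {x : M} (h : u =ᶠ[𝓝 x] v)
    (hu : SmoothUnitAt d u x) : SmoothUnitAt d v x :=
  ContMDiffAt.congr_of_eventuallyEq hu (h.mono fun y hy => by simp only [hy])

theorem SmoothUnitAt.add {u v : M → Additive ℂˣ} {x : M} (hu : SmoothUnitAt d u x)
    (hv : SmoothUnitAt d v x) : SmoothUnitAt d (u + v) x := by
  have h : ContDiffAt ℝ ∞ (fun z : ℂ × ℂ => z.1 * z.2)
      (((u x).toMul : ℂ), ((v x).toMul : ℂ)) := contDiff_mul.contDiffAt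
  have h2 := ContMDiffAt.comp (g := fun z : ℂ × ℂ => z.1 * z.2) x
    h.contMDiffAt (ContMDiffAt.prodMk_space hu hv)
  exact h2

theorem SmoothUnitAt.neg {u : M → Additive ℂˣ} {x : M} (hu : SmoothUnitAt d u x) :
    SmoothUnitAt d (-u) x := by
  have h : ContDiffAt ℝ ∞ (fun z : ℂ => z⁻¹) ((u x).toMul : ℂ) :=
    contDiffAt_inv ℝ (Units.ne_zero _)
  have h2 := ContMDiffAt.comp (g := fun z : ℂ => z⁻¹) x h.contMDiffAt hu
  refine h2.congr_of_eventuallyEq (Eventually.of_forall fun y => ?_)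
  simp

theorem SmoothUnitAt.zero (x : M) : SmoothUnitAt d (0 : M → Additive ℂˣ) x :=
  contMDiffAt_const

theorem SmoothUnitAt.const {u : M → Additive ℂˣ} {x : M} (h : ∀ᶠ y in 𝓝 x, u y = u x) :
    SmoothUnitAt d u x :=
  ContMDiffAt.congr_of_eventuallyEq (f := fun _ => ((u x).toMul : ℂ)) contMDiffAt_const
    (h.mono fun y hy => by simp only [hy])

theorem SmoothUnitAt.pull {f : M → N} {u : N → Additive ℂˣ} {x : M}
    (hu : SmoothUnitAt d u (f x)) (hf : ContMDiffAt (𝓡 d) (𝓡 d) ∞ f x) :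
    SmoothUnitAt d (u ∘ f) x :=
  ContMDiffAt.comp (g := fun y => ((u y).toMul : ℂ)) x hu hf

theorem dlogForm_add {u v : M → Additive ℂˣ} {x : M} (hu : SmoothUnitAt d u x)
    (hv : SmoothUnitAt d v x) :
    dlogForm (d := d) (u + v) x = dlogForm u x + dlogForm v x := by
  have h1 := (contDiffAt_comp_chart hu).differentiableAt (by simp)
  have h2 := (contDiffAt_comp_chart hv).differentiableAt (by simp)
  have hey : (extChartAt (𝓡 d) x).symm (extChartAt (𝓡 d) x x) = x := extChartAt_to_inv x
  have h3 := (h1.hasFDerivAt.mul h2.hasFDerivAt).fderiv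
  have h4 : fderiv ℝ ((fun y => (((u + v) y).toMul : ℂ)) ∘ (extChartAt (𝓡 d) x).symm)
      (extChartAt (𝓡 d) x x) = _ := h3
  rw [dlogForm, dlogForm, dlogForm, dForm_zeroForm, dForm_zeroForm, dForm_zeroForm, h4]
  have hu0 : ((u x).toMul : ℂ) ≠ 0 := Units.ne_zero _
  have hv0 : ((v x).toMul : ℂ) ≠ 0 := Units.ne_zero _
  ext w
  simp
  field_simp
  ring

theorem dlogForm_const {u : M → Additive ℂˣ} {x : M} (h : ∀ᶠ y in 𝓝 x, u y = u x) :
    dlogForm (d := d) u x = 0 := by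
  rw [dlogForm, dForm_zeroForm_const (h.mono fun y hy => by simp only [hy])]
  ext v
  simp

end Forms


/-- A smooth étale groupoid with manifold of objects `X₀` and manifold of arrows `X₁`.
`mul g h` is the composite `x → y → z` of `g : x → y` and `h : y → z`.  As `src` is a local
diffeomorphism and `src (mul g h) = src g`, continuity of the multiplication on the fibre product
`X₁ ×_{X₀} X₁` (a manifold, étale over `X₁`) is the same as its being a local diffeomorphism. -/
structure SmoothEtaleGroupoid (d : ℕ) (X₀ X₁ : Type u)
    [TopologicalSpace X₀] [ChartedSpace (EuclideanSpace ℝ (Fin d)) X₀]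
    [TopologicalSpace X₁] [ChartedSpace (EuclideanSpace ℝ (Fin d)) X₁] where
  src : X₁ → X₀
  tgt : X₁ → X₀
  one : X₀ → X₁
  inv : X₁ → X₁
  mul : ∀ g h : X₁, tgt g = src h → X₁
  src_one : ∀ x, src (one x) = x
  tgt_one : ∀ x, tgt (one x) = x
  src_inv : ∀ g, src (inv g) = tgt g
  tgt_inv : ∀ g, tgt (inv g) = src g
  src_mul : ∀ g h e, src (mul g h e) = src g
  tgt_mul : ∀ g h e, tgt (mul g h e) = tgt h
  one_mul : ∀ g, mul (one (src g)) g (tgt_one _) = g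
  mul_one : ∀ g, mul g (one (tgt g)) (src_one _).symm = g
  mul_inv : ∀ g, mul g (inv g) (src_inv g).symm = one (src g)
  inv_mul : ∀ g, mul (inv g) g (tgt_inv g) = one (tgt g)
  mul_assoc : ∀ g h k (e₁ : tgt g = src h) (e₂ : tgt h = src k),
    mul (mul g h e₁) k ((tgt_mul _ _ _).trans e₂) =
      mul g (mul h k e₂) (e₁.trans (src_mul _ _ _).symm)
  isLocalDiffeomorph_src : IsLocalDiffeomorph (𝓡 d) (𝓡 d) ∞ src
  isLocalDiffeomorph_tgt : IsLocalDiffeomorph (𝓡 d) (𝓡 d) ∞ tgt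
  isLocalDiffeomorph_one : IsLocalDiffeomorph (𝓡 d) (𝓡 d) ∞ one
  isLocalDiffeomorph_inv : IsLocalDiffeomorph (𝓡 d) (𝓡 d) ∞ inv
  continuous_mul : Continuous fun p : {p : X₁ × X₁ // tgt p.1 = src p.2} => mul p.1.1 p.1.2 p.2

section Groupoid

variable {d : ℕ} {X₀ X₁ : Type u}
  [TopologicalSpace X₀] [ChartedSpace (EuclideanSpace ℝ (Fin d)) X₀]
  [TopologicalSpace X₁] [ChartedSpace (EuclideanSpace ℝ (Fin d)) X₁]

/-- The groupoid is proper: `(s, t) : G₁ → G₀ × G₀` is a proper map. -/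
def SmoothEtaleGroupoid.IsProper (G : SmoothEtaleGroupoid d X₀ X₁) : Prop :=
  IsProperMap fun g => (G.src g, G.tgt g)

/-- The objects of the site of a groupoid: the open subsets of the space of objects. -/
structure EtaleSite (G : SmoothEtaleGroupoid d X₀ X₁) where
  carrier : Opens X₀

namespace EtaleSite

variable {G : SmoothEtaleGroupoid d X₀ X₁}

/-- A morphism `U ⟶ V` is a continuous family of arrows `σ x : x → σ(x)·` starting at the points
`x` of `U` and ending in `V`, that is a local section of `src` over `U` with targets in `V`. -/
@[ext]
structure Hom (U V : EtaleSite G) where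
  toMap : C(U.carrier, X₁)
  src_eq : ∀ x, G.src (toMap x) = x
  tgt_mem : ∀ x, G.tgt (toMap x) ∈ V.carrier

/-- The target point of a local section. -/
abbrev Hom.target {U V : EtaleSite G} (σ : Hom U V) (x : U.carrier) : V.carrier :=
  ⟨G.tgt (σ.toMap x), σ.tgt_mem x⟩

theorem Hom.continuous_target {U V : EtaleSite G} (σ : Hom U V) : Continuous σ.target :=
  (G.isLocalDiffeomorph_tgt.contMDiff.continuous.comp σ.toMap.continuous).subtype_mk _

/-- The inclusion of open sets, given by the units. -/
def Hom.incl {U V : EtaleSite G} (h : U.carrier ≤ V.carrier) : Hom U V where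
  toMap := ⟨fun x => G.one x, G.isLocalDiffeomorph_one.contMDiff.continuous.comp
    continuous_subtype_val⟩
  src_eq x := G.src_one x
  tgt_mem x := by
    show G.tgt (G.one x) ∈ V.carrier
    rw [G.tgt_one]
    exact h x.2

/-- Composition of local sections by multiplication of arrows. -/
def Hom.comp {U V W : EtaleSite G} (σ : Hom U V) (τ : Hom V W) : Hom U W where
  toMap := ⟨fun x => G.mul (σ.toMap x) (τ.toMap (σ.target x)) (τ.src_eq (σ.target x)).symm,
    G.continuous_mul.comp (Continuous.subtype_mk (σ.toMap.continuous.prodMk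
      (τ.toMap.continuous.comp σ.continuous_target))
      fun x => (τ.src_eq (σ.target x)).symm)⟩
  src_eq x := (G.src_mul _ _ _).trans (σ.src_eq x)
  tgt_mem x := by
    refine Set.mem_of_eq_of_mem (G.tgt_mul (σ.toMap x) (τ.toMap (σ.target x))
      (τ.src_eq (σ.target x)).symm) (τ.tgt_mem _)

theorem mul_congr {g g' h h' : X₁} (e : G.tgt g = G.src h) (hg : g = g') (hh : h = h') :
    G.mul g h e = G.mul g' h' (hg ▸ hh ▸ e) := by
  subst hg hh
  rfl

instance : Category (EtaleSite G) where
  Hom := Hom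
  id U := Hom.incl le_rfl
  comp := Hom.comp
  id_comp {U V} σ := by
    ext x
    have h : (Hom.incl (le_refl U.carrier)).target x = x := Subtype.ext (G.tgt_one _)
    exact (mul_congr (G := G) _ (congrArg G.one (σ.src_eq x).symm) (congrArg σ.toMap h)).trans
      (G.one_mul _)
  comp_id {U V} σ := by
    ext x
    exact G.mul_one _
  assoc {U V W Z} σ τ ρ := by
    ext x
    have h : (Hom.comp σ τ).target x = τ.target (σ.target x) := Subtype.ext (G.tgt_mul _ _ _)
    exact (mul_congr (G := G) _ rfl (congrArg ρ.toMap h)).trans (G.mul_assoc _ _ _ _ _)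

@[ext]
theorem hom_ext {U V : EtaleSite G} {σ τ : U ⟶ V} (h : ∀ x, Hom.toMap σ x = Hom.toMap τ x) :
    σ = τ :=
  Hom.ext (ContinuousMap.ext h)

/-- The inclusion of open sets as a morphism of the site. -/
def incl {U V : EtaleSite G} (h : U.carrier ≤ V.carrier) : U ⟶ V := Hom.incl h

theorem incl_target {U V : EtaleSite G} (h : U.carrier ≤ V.carrier) (x : U.carrier) :
    Hom.target (incl h) x = ⟨x, h x.2⟩ := Subtype.ext (G.tgt_one _)

theorem comp_target {U V W : EtaleSite G} (σ : U ⟶ V) (τ : V ⟶ W) (x : U.carrier) :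
    Hom.target (σ ≫ τ) x = Hom.target τ (Hom.target σ x) := Subtype.ext (G.tgt_mul _ _ _)

theorem incl_comp_toMap {U V W : EtaleSite G} (h : U.carrier ≤ V.carrier) (σ : V ⟶ W)
    (x : U.carrier) : Hom.toMap (incl h ≫ σ) x = Hom.toMap σ ⟨x, h x.2⟩ := by
  have h' := incl_target h x
  exact (mul_congr (G := G) _ (congrArg G.one (Hom.src_eq σ ⟨x, h x.2⟩).symm)
    (congrArg (Hom.toMap σ) h')).trans (G.one_mul _)

theorem comp_incl_toMap {U V W : EtaleSite G} (σ : U ⟶ V) (h : V.carrier ≤ W.carrier)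
    (x : U.carrier) : Hom.toMap (σ ≫ incl h) x = Hom.toMap σ x :=
  G.mul_one _

/-- Restriction of a local section to the open set of points with target in `W`. -/
def preimage {U V : EtaleSite G} (σ : U ⟶ V) (W : EtaleSite G) : EtaleSite G where
  carrier := ⟨{x | ∃ h : x ∈ U.carrier, G.tgt (Hom.toMap σ ⟨x, h⟩) ∈ W.carrier}, by
    have h1 : IsOpen {x : U.carrier | G.tgt (Hom.toMap σ x) ∈ W.carrier} :=
      W.carrier.isOpen.preimage
        (G.isLocalDiffeomorph_tgt.contMDiff.continuous.comp (Hom.toMap σ).continuous)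
    have h2 := U.carrier.isOpen.isOpenMap_subtype_val _ h1
    convert! h2 using 1
    ext
    simp⟩

theorem preimage_le {U V : EtaleSite G} (σ : U ⟶ V) (W : EtaleSite G) :
    (preimage σ W).carrier ≤ U.carrier := fun _ hx => hx.1

/-- The restricted local section, with values in `W`. -/
def preimageHom {U V : EtaleSite G} (σ : U ⟶ V) (W : EtaleSite G) : preimage σ W ⟶ W where
  toMap := ⟨fun x => Hom.toMap σ ⟨x, x.2.1⟩, (Hom.toMap σ).continuous.comp
    (continuous_subtype_val.subtype_mk _)⟩
  src_eq _ := Hom.src_eq σ _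
  tgt_mem x := x.2.2

theorem preimageHom_comp_incl {U V W : EtaleSite G} (σ : U ⟶ V) (h : W.carrier ≤ V.carrier) :
    preimageHom σ W ≫ incl h = incl (preimage_le σ W) ≫ σ := by
  ext x
  rw [comp_incl_toMap, incl_comp_toMap]
  rfl

/-- The topology of the site: a sieve covers `U` if it contains the inclusions of the members of
an open cover of `U`. -/
def topology (G : SmoothEtaleGroupoid d X₀ X₁) : GrothendieckTopology (EtaleSite G) where
  sieves U := {S | ∀ x ∈ U.carrier, ∃ (W : EtaleSite G) (h : W.carrier ≤ U.carrier),
    x ∈ W.carrier ∧ S (incl h)}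
  top_mem' U x hx := ⟨U, le_rfl, hx, trivial⟩
  pullback_stable' {V U} S σ hS x hx := by
    obtain ⟨W, h, hxW, hW⟩ := hS (G.tgt (Hom.toMap σ ⟨x, hx⟩)) (Hom.tgt_mem σ _)
    refine ⟨preimage σ W, preimage_le σ W, ⟨hx, hxW⟩, ?_⟩
    show S (incl (preimage_le σ W) ≫ σ)
    rw [← preimageHom_comp_incl σ h]
    exact S.downward_closed hW _
  transitive' {U} S hS R hR x hx := by
    obtain ⟨W, h, hxW, hW⟩ := hS x hx
    obtain ⟨W', h', hxW', hW'⟩ := hR hW x hxW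
    refine ⟨W', h'.trans h, hxW', ?_⟩
    have h1 : R (incl h' ≫ incl h) := hW'
    have h2 : incl h' ≫ incl h = incl (h'.trans h) := by
      ext y
      rw [incl_comp_toMap]
      rfl
    rwa [h2] at h1

end EtaleSite

/-- The category of abelian `G`-sheaves: sheaves `F` of abelian groups on the space of objects
`G₀` on which the arrows act continuously.  As an object of the category of sheaves on the site
`EtaleSite G`, such an `F` consists of a sheaf on `G₀` (its restriction to the inclusions of open
sets) with, for every continuous family of arrows `σ` from the points of `U` to points of `V`, a
transport of sections `σ^* : F(V) → F(U)`, `(σ^* a)(x) = a(t(σ x)) · (σ x)⁻¹`, functorial in `σ`.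
On germs an arrow `g : x → y` lies in an essentially unique germ of a continuous family (`s` is a
local homeomorphism), so transport amounts to isomorphisms `F_y ≅ F_x`, inverse to the right action
`F_x → F_y`, `a ↦ a g`, and that transports of sections are sections says that the action
`F ×_{G₀} G₁ → F` on the étale space is continuous. -/
abbrev GSheaf (G : SmoothEtaleGroupoid d X₀ X₁) : Type (u + 1) :=
  Sheaf (EtaleSite.topology G) AddCommGrpCat.{u}


/-- Extension by zero of a function on an open set. -/
noncomputable def extendZero {A : Type} [Zero A] (U : Opens X₀) (f : U → A) : X₀ → A :=
  fun x => by
    classical exact if h : x ∈ U then f ⟨x, h⟩ else 0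

theorem extendZero_apply {A : Type} [Zero A] {U : Opens X₀} (f : U → A) (x : U) :
    extendZero U f x = f x := by
  simp [extendZero]

theorem extendZero_apply_mem {A : Type} [Zero A] {U : Opens X₀} (f : U → A) {x : X₀} (h : x ∈ U) :
    extendZero U f x = f ⟨x, h⟩ := extendZero_apply f ⟨x, h⟩

/-- Data defining a `G`-sheaf whose sections are the functions with values in a fixed group `A`
that satisfy a local condition, the arrows acting on the values: `act g` is the pullback of values
from the target to the source of `g`. -/
structure FunctionSheafData (G : SmoothEtaleGroupoid d X₀ X₁) (A : Type) [AddCommGroup A] where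
  act : X₁ → A →+ A
  act_one : ∀ x a, act (G.one x) a = a
  act_mul : ∀ g h e a, act (G.mul g h e) a = act g (act h a)
  /-- the local condition at a point, on the germ of a function -/
  IsSection : (X₀ → A) → X₀ → Prop
  congr : ∀ {f f' : X₀ → A} {x}, f =ᶠ[𝓝 x] f' → IsSection f x → IsSection f' x
  zero : ∀ x, IsSection 0 x
  add : ∀ {f f' x}, IsSection f x → IsSection f' x → IsSection (f + f') x
  neg : ∀ {f x}, IsSection f x → IsSection (-f) x
  pull : ∀ {U V : EtaleSite G} (σ : U ⟶ V) (x : U.carrier) (f : X₀ → A),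
    IsSection f (EtaleSite.Hom.target σ x) →
    IsSection (extendZero U.carrier fun y =>
      act (EtaleSite.Hom.toMap σ y) (f (EtaleSite.Hom.target σ y))) x

namespace FunctionSheafData

variable {G : SmoothEtaleGroupoid d X₀ X₁} {A : Type} [AddCommGroup A]
  (D : FunctionSheafData G A)

/-- The sections over an open set. -/
def sections (U : EtaleSite G) : AddSubgroup (U.carrier → A) where
  carrier := {f | ∀ x : U.carrier, D.IsSection (extendZero U.carrier f) x}
  zero_mem' x := D.congr (Eventually.of_forall fun y => by simp [extendZero]) (D.zero x)
  add_mem' {f g} hf hg x := D.congr (Eventually.of_forall fun y => by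
    by_cases h : y ∈ U.carrier <;> simp [extendZero, h]) (D.add (hf x) (hg x))
  neg_mem' {f} hf x := D.congr (Eventually.of_forall fun y => by
    by_cases h : y ∈ U.carrier <;> simp [extendZero, h]) (D.neg (hf x))

/-- Transport of sections along a local section of arrows. -/
def transport {U V : EtaleSite G} (σ : U ⟶ V) : D.sections V →+ D.sections U where
  toFun f := ⟨fun x => D.act (EtaleSite.Hom.toMap σ x) (f.1 (EtaleSite.Hom.target σ x)),
    fun x => D.congr (Eventually.of_forall fun y => by
      by_cases h : y ∈ U.carrier
      · simp only [extendZero, h, dif_pos]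
        rw [dif_pos (EtaleSite.Hom.tgt_mem σ ⟨y, h⟩)]
      · simp [extendZero, h])
      (D.pull σ x (extendZero V.carrier f.1) (f.2 _))⟩
  map_zero' := by ext x; simp
  map_add' f g := by ext x; simp

theorem transport_apply {U V : EtaleSite G} (σ : U ⟶ V) (f : D.sections V) (x : U.carrier) :
    (D.transport σ f).1 x = D.act (EtaleSite.Hom.toMap σ x) (f.1 (EtaleSite.Hom.target σ x)) :=
  rfl

/-- The underlying presheaf. -/
def presheaf : (EtaleSite G)ᵒᵖ ⥤ AddCommGrpCat.{u} where
  obj U := AddCommGrpCat.of (D.sections U.unop)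
  map σ := AddCommGrpCat.ofHom (D.transport σ.unop)
  map_id U := by
    refine AddCommGrpCat.hom_ext (AddMonoidHom.ext fun f => Subtype.ext (funext fun x => ?_))
    have h : EtaleSite.Hom.target (𝟙 U.unop) x = x := EtaleSite.incl_target le_rfl x
    exact (D.act_one _ _).trans (congrArg f.1 h)
  map_comp {U V W} σ τ := by
    refine AddCommGrpCat.hom_ext (AddMonoidHom.ext fun f => Subtype.ext (funext fun x => ?_))
    have h := EtaleSite.comp_target τ.unop σ.unop x
    exact (D.act_mul _ _ _ _).trans (congrArg (fun z => D.act _ (D.act _ (f.1 z))) h)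

theorem transport_incl {U V : EtaleSite G} (h : U.carrier ≤ V.carrier) (f : D.sections V)
    (x : U.carrier) : (D.transport (EtaleSite.incl h) f).1 x = f.1 ⟨x, h x.2⟩ :=
  (D.act_one _ _).trans (congrArg f.1 (EtaleSite.incl_target h x))

theorem isSheaf : Presheaf.IsSheaf (EtaleSite.topology G) D.presheaf := by
  rw [Presheaf.isSheaf_iff_isSheaf_forget (s := CategoryTheory.forget AddCommGrpCat.{u}),
    isSheaf_iff_isSheaf_of_type]
  intro U S hS x hx
  have hcov : ∀ y : U.carrier, ∃ (W : EtaleSite G) (h : W.carrier ≤ U.carrier),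
    y.1 ∈ W.carrier ∧ S (EtaleSite.incl h) := fun y => hS y y.2
  choose W hWU hyW hSW using hcov
  let s : ∀ (y : U.carrier), D.sections (W y) := fun y => x (EtaleSite.incl (hWU y)) (hSW y)
  let t : ∀ {V : EtaleSite G} (σ : V ⟶ U), S σ → D.sections V := fun σ hσ => x σ hσ
  -- compatibility with an arbitrary member of the sieve
  have key : ∀ {V : EtaleSite G} (σ : V ⟶ U) (hσ : S σ) (y : U.carrier) (z : V.carrier)
      (hz : (EtaleSite.Hom.target σ z).1 ∈ (W y).carrier),
      (t σ hσ).1 z = D.act (EtaleSite.Hom.toMap σ z) ((s y).1 ⟨EtaleSite.Hom.target σ z, hz⟩) := by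
    intro V σ hσ y z hz
    have e := EtaleSite.preimageHom_comp_incl σ (hWU y)
    have h1 := hx (EtaleSite.preimageHom σ (W y)) (EtaleSite.incl (EtaleSite.preimage_le σ (W y)))
      (hSW y) hσ e
    have h2 : D.transport (EtaleSite.preimageHom σ (W y)) (s y) =
        D.transport (EtaleSite.incl (EtaleSite.preimage_le σ (W y))) (t σ hσ) := h1
    have h3 := congrFun (congrArg Subtype.val h2) ⟨z, z.2, hz⟩
    rw [D.transport_incl] at h3
    exact h3.symm
  have key' : ∀ (y y' : U.carrier) (hz : y'.1 ∈ (W y).carrier),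
      (s y').1 ⟨y', hyW y'⟩ = (s y).1 ⟨y', hz⟩ := by
    intro y y' hz
    have ht : EtaleSite.Hom.target (EtaleSite.incl (hWU y')) ⟨y', hyW y'⟩ = y' :=
      EtaleSite.incl_target _ _
    refine (key (EtaleSite.incl (hWU y')) (hSW y') y ⟨y', hyW y'⟩ (by rw [ht]; exact hz)).trans ?_
    refine (D.act_one _ _).trans (congrArg (s y).1 (Subtype.ext (congrArg (fun z => z.1) ht :)))
  let g : U.carrier → A := fun y => (s y).1 ⟨y, hyW y⟩
  have hg : g ∈ D.sections U := by
    intro y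
    refine D.congr ?_ ((s y).2 ⟨y, hyW y⟩)
    filter_upwards [(W y).carrier.isOpen.mem_nhds (hyW y)] with z hz
    rw [extendZero_apply_mem _ hz, extendZero_apply_mem _ (hWU y hz)]
    exact (key' y ⟨z, hWU y hz⟩ hz).symm
  refine ⟨(⟨g, hg⟩ : D.sections U), ?_, ?_⟩
  · intro V σ hσ
    refine Subtype.ext (funext fun z => ?_)
    exact (key σ hσ (EtaleSite.Hom.target σ z) z (hyW _)).symm
  · intro g' hg'
    refine Subtype.ext (funext fun y => ?_)
    have h1 : D.transport (EtaleSite.incl (hWU y)) g' = s y := hg' (EtaleSite.incl (hWU y)) (hSW y)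
    have h2 := congrFun (congrArg Subtype.val h1) ⟨y, hyW y⟩
    exact (D.transport_incl (hWU y) g' ⟨y, hyW y⟩).symm.trans h2

/-- The `G`-sheaf defined by the data. -/
def sheaf : GSheaf G := ⟨D.presheaf, D.isSheaf⟩

variable {B : Type} [AddCommGroup B] {C : Type} [AddCommGroup C]
  {D} {D' : FunctionSheafData G B} {D'' : FunctionSheafData G C}

/-- A local operator between function sheaves (a differential operator, for example), compatible
with the action of the arrows. -/
structure Operator (D : FunctionSheafData G A) (D' : FunctionSheafData G B) where
  op : (X₀ → A) → X₀ → B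
  congr : ∀ {f f' : X₀ → A} {x}, f =ᶠ[𝓝 x] f' → op f x = op f' x
  add : ∀ {f f' x}, D.IsSection f x → D.IsSection f' x → op (f + f') x = op f x + op f' x
  isSection : ∀ {f x}, (∀ᶠ y in 𝓝 x, D.IsSection f y) → D'.IsSection (op f) x
  equivariant : ∀ {U V : EtaleSite G} (σ : U ⟶ V) (x : U.carrier) (f : X₀ → A),
    (∀ᶠ y in 𝓝 (EtaleSite.Hom.target σ x).1, D.IsSection f y) →
    op (extendZero U.carrier fun y =>
      D.act (EtaleSite.Hom.toMap σ y) (f (EtaleSite.Hom.target σ y))) x =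
    D'.act (EtaleSite.Hom.toMap σ x) (op f (EtaleSite.Hom.target σ x))

theorem eventually_isSection {U : EtaleSite G} (f : D.sections U) (x : U.carrier) :
    ∀ᶠ y in 𝓝 x.1, D.IsSection (extendZero U.carrier f.1) y := by
  filter_upwards [U.carrier.isOpen.mem_nhds x.2] with y hy using f.2 ⟨y, hy⟩

/-- A local operator applied to a section. -/
noncomputable def Operator.onSections (L : Operator D D') (U : EtaleSite G) : D.sections U →+ D'.sections U :=
  AddMonoidHom.mk' (fun f => ⟨fun x => L.op (extendZero U.carrier f.1) x, fun x => by
      refine D'.congr ?_ (L.isSection (eventually_isSection f x))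
      filter_upwards [U.carrier.isOpen.mem_nhds x.2] with y hy
      rw [extendZero_apply_mem _ hy]⟩) fun f g => by
    refine Subtype.ext (funext fun x => ?_)
    refine Eq.trans ?_ (L.add (f.2 x) (g.2 x))
    refine L.congr (Eventually.of_forall fun y => ?_)
    by_cases h : y ∈ U.carrier <;> simp [extendZero, h]

/-- The morphism of `G`-sheaves defined by a local operator. -/
noncomputable def Operator.hom (L : Operator D D') : D.sheaf ⟶ D'.sheaf where
  hom :=
    { app := fun U => AddCommGrpCat.ofHom (L.onSections U.unop)
      naturality := fun U V σ => by
        ext f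
        refine Subtype.ext (funext fun x => ?_)
        refine Eq.trans ?_ (L.equivariant σ.unop x _ (eventually_isSection f _))
        refine L.congr (Eventually.of_forall fun y => ?_)
        by_cases h : y ∈ V.unop.carrier
        · rw [extendZero_apply_mem _ h, extendZero_apply_mem _ h, extendZero_apply]
          rfl
        · simp [extendZero, h] }

theorem Operator.hom_comp_hom (L : Operator D D') (L' : Operator D' D'')
    (h : ∀ f x, (∀ᶠ y in 𝓝 x, D.IsSection f y) → L'.op (L.op f) x = 0) :
    L.hom ≫ L'.hom = 0 := by
  apply Sheaf.hom_ext
  ext U f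
  refine Subtype.ext (funext fun x => ?_)
  refine Eq.trans ?_ (h _ x.1 (eventually_isSection f x))
  refine L'.congr ?_
  filter_upwards [U.unop.carrier.isOpen.mem_nhds x.2] with y hy
  exact extendZero_apply_mem _ hy

end FunctionSheafData

section Sheaves

set_option linter.unusedSectionVars false

variable (G : SmoothEtaleGroupoid d X₀ X₁)

/-- The linear isomorphism `T_x G₀ → T_y G₀` defined by an arrow `g : x → y`: the differential of
the local diffeomorphism `t ∘ s⁻¹` near `g`. -/
noncomputable def arrowTangent (g : X₁) :
    EuclideanSpace ℝ (Fin d) →L[ℝ] EuclideanSpace ℝ (Fin d) :=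
  (tangentMapAt d G.tgt g).comp (tangentMapAt d G.src g).inverse

/-- The constant `G`-sheaf: locally constant `A`-valued functions, with trivial action. -/
def constData (A : Type) [AddCommGroup A] : FunctionSheafData G A where
  act _ := AddMonoidHom.id A
  act_one _ _ := rfl
  act_mul _ _ _ _ := rfl
  IsSection f x := ∀ᶠ y in 𝓝 x, f y = f x
  congr h hf := by
    filter_upwards [h, hf] with y h1 h2
    rw [← h1, h2, h.self_of_nhds]
  zero _ := Eventually.of_forall fun _ => rfl
  add hf hg := by
    filter_upwards [hf, hg] with y h1 h2
    simp only [Pi.add_apply, h1, h2]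
  neg hf := hf.mono fun y h1 => by simp only [Pi.neg_apply, h1]
  pull {U V} σ x f hf := by
    have h1 : ContinuousAt (fun y => (EtaleSite.Hom.target σ y).1) x :=
      (continuous_subtype_val.comp (EtaleSite.Hom.continuous_target σ)).continuousAt
    have h2 := h1.eventually hf
    rw [nhds_subtype_eq_comap, eventually_comap] at h2
    filter_upwards [h2, U.carrier.isOpen.mem_nhds x.2] with y hy hyU
    rw [extendZero_apply_mem _ hyU, extendZero_apply]
    exact hy ⟨y, hyU⟩ rfl

variable [IsManifold (𝓡 d) ∞ X₀] [IsManifold (𝓡 d) ∞ X₁]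

variable {G} in
/-- Locally, the map `y ↦ target of σ y` is a smooth map with differential given by `σ y`. -/
theorem exists_local_target {U V : EtaleSite G} (σ : U ⟶ V) (x : U.carrier) :
    ∃ τ : X₀ → X₀, ContMDiffAt (𝓡 d) (𝓡 d) ∞ τ x ∧ ∀ᶠ y in 𝓝 x.1, ∀ h : y ∈ U.carrier,
      (EtaleSite.Hom.target σ ⟨y, h⟩).1 = τ y ∧
      arrowTangent G (EtaleSite.Hom.toMap σ ⟨y, h⟩) = tangentMapAt d τ y := by
  obtain ⟨Φ, hΦ, hs⟩ := G.isLocalDiffeomorph_src (EtaleSite.Hom.toMap σ x)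
  let ψ : X₀ → X₁ := Φ.symm
  have hsx : G.src (EtaleSite.Hom.toMap σ x) = x := EtaleSite.Hom.src_eq σ x
  have hxt : x.1 ∈ Φ.target := by
    rw [← hsx, hs hΦ]
    exact Φ.map_source hΦ
  have hψ : ∀ y ∈ Φ.target, ContMDiffAt (𝓡 d) (𝓡 d) ∞ ψ y := fun y hy =>
    Φ.contMDiffOn_invFun.contMDiffAt (Φ.open_target.mem_nhds hy)
  have hτ : ∀ y ∈ Φ.target, ContMDiffAt (𝓡 d) (𝓡 d) ∞ (G.tgt ∘ ψ) y := fun y hy =>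
    (G.isLocalDiffeomorph_tgt.contMDiff (ψ y)).comp y (hψ y hy)
  refine ⟨G.tgt ∘ ψ, hτ x hxt, ?_⟩
  have h1 : ContinuousAt (EtaleSite.Hom.toMap σ) x := (EtaleSite.Hom.toMap σ).continuous.continuousAt
  have h2 := h1.eventually (Φ.open_source.mem_nhds hΦ)
  rw [nhds_subtype_eq_comap, eventually_comap] at h2
  filter_upwards [h2, Φ.open_target.mem_nhds hxt] with y hy hyt hyU
  have hmem := hy ⟨y, hyU⟩ rfl
  have hσψ : EtaleSite.Hom.toMap σ ⟨y, hyU⟩ = ψ y := by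
    have h3 : Φ.symm (Φ (EtaleSite.Hom.toMap σ ⟨y, hyU⟩)) = EtaleSite.Hom.toMap σ ⟨y, hyU⟩ :=
      Φ.left_inv hmem
    rw [← h3, ← hs hmem, EtaleSite.Hom.src_eq]
  refine ⟨congrArg G.tgt hσψ, ?_⟩
  rw [hσψ]
  have hmψ : MDifferentiableAt (𝓡 d) (𝓡 d) ψ y := (hψ y hyt).mdifferentiableAt (by simp)
  have hms : MDifferentiableAt (𝓡 d) (𝓡 d) G.src (ψ y) :=
    G.isLocalDiffeomorph_src.mdifferentiable (by simp) _
  have hmt : MDifferentiableAt (𝓡 d) (𝓡 d) G.tgt (ψ y) :=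
    G.isLocalDiffeomorph_tgt.mdifferentiable (by simp) _
  have c1 : tangentMapAt d (G.src ∘ ψ) y = ContinuousLinearMap.id ℝ _ := by
    have : G.src ∘ ψ =ᶠ[𝓝 y] id := by
      filter_upwards [Φ.open_target.mem_nhds hyt] with z hz
      have h3 : ψ z ∈ Φ.source := Φ.map_target hz
      show G.src (ψ z) = z
      rw [hs h3]
      exact Φ.right_inv hz
    rw [tangentMapAt_congr this]
    exact mfderiv_id
  rw [tangentMapAt_comp hms hmψ] at c1
  have c2 : (tangentMapAt d ψ y).comp (tangentMapAt d G.src (ψ y)) =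
      ContinuousLinearMap.id ℝ _ := by
    ext1 v
    have := mul_eq_one_comm.1 (congrArg ContinuousLinearMap.toLinearMap c1 :
      (tangentMapAt d G.src (ψ y)).toLinearMap * (tangentMapAt d ψ y).toLinearMap = 1)
    exact LinearMap.congr_fun this v
  rw [arrowTangent, ContinuousLinearMap.inverse_eq c1 c2, tangentMapAt_comp hmt hmψ]

variable {G} in
/-- Every arrow extends to a local section of arrows. -/
theorem exists_section (g : X₁) {V : EtaleSite G} (hV : G.tgt g ∈ V.carrier) :
    ∃ (U : EtaleSite G) (hU : G.src g ∈ U.carrier) (σ : U ⟶ V),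
      EtaleSite.Hom.toMap σ ⟨_, hU⟩ = g := by
  obtain ⟨Φ, hΦ, hs⟩ := G.isLocalDiffeomorph_src g
  let U : EtaleSite G := ⟨⟨Φ.target, Φ.open_target⟩⟩
  have hgt : G.src g ∈ Φ.target := by
    rw [hs hΦ]
    exact Φ.map_source hΦ
  let T : EtaleSite G := ⟨⊤⟩
  let σ : U ⟶ T :=
    { toMap := ⟨fun x => Φ.symm x.1,
        continuousOn_iff_continuous_domRestrict.1 Φ.contMDiffOn_invFun.continuousOn⟩
      src_eq := fun x => (hs (Φ.map_target x.2)).trans (Φ.right_inv x.2)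
      tgt_mem := fun _ => trivial }
  have hσ : EtaleSite.Hom.toMap σ ⟨G.src g, hgt⟩ = g := by
    show Φ.symm (G.src g) = g
    rw [hs hΦ]
    exact Φ.left_inv hΦ
  exact ⟨EtaleSite.preimage σ V, ⟨hgt, by rw [hσ]; exact hV⟩, EtaleSite.preimageHom σ V, hσ⟩

theorem arrowTangent_one (x : X₀) : arrowTangent G (G.one x) = ContinuousLinearMap.id ℝ _ := by
  let T : EtaleSite G := ⟨⊤⟩
  obtain ⟨τ, -, hτ⟩ := exists_local_target (EtaleSite.incl (le_refl T.carrier)) ⟨x, trivial⟩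
  have h1 := (hτ.self_of_nhds trivial).2
  refine h1.trans ?_
  have : τ =ᶠ[𝓝 x] id := by
    filter_upwards [hτ] with y hy
    exact (hy trivial).1.symm.trans (G.tgt_one _)
  show tangentMapAt d τ x = _
  rw [tangentMapAt_congr this]
  exact mfderiv_id

theorem arrowTangent_mul (g h : X₁) (e : G.tgt g = G.src h) :
    arrowTangent G (G.mul g h e) = (arrowTangent G h).comp (arrowTangent G g) := by
  obtain ⟨V, hV, ρ, hρ⟩ := exists_section (G := G) h (V := ⟨⊤⟩) trivial
  obtain ⟨U, hU, σ, hσ⟩ := exists_section (G := G) g (V := V) (e ▸ hV)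
  set x : U.carrier := ⟨G.src g, hU⟩ with hx
  have htx : EtaleSite.Hom.target σ x = ⟨G.src h, hV⟩ := by
    apply Subtype.ext
    show G.tgt (EtaleSite.Hom.toMap σ x) = _
    rw [hσ, e]
  obtain ⟨τ₁, h₁, hτ₁⟩ := exists_local_target σ x
  obtain ⟨τ₂, h₂, hτ₂⟩ := exists_local_target ρ ⟨G.src h, hV⟩
  obtain ⟨τ₃, h₃, hτ₃⟩ := exists_local_target (σ ≫ ρ) x
  have e1 := (hτ₁.self_of_nhds x.2).2
  have e2 := (hτ₂.self_of_nhds hV).2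
  have e3 := (hτ₃.self_of_nhds x.2).2
  have t1 : τ₁ x = G.src h := (hτ₁.self_of_nhds x.2).1.symm.trans (congrArg Subtype.val htx)
  have m3 : EtaleSite.Hom.toMap (σ ≫ ρ) x = G.mul g h e :=
    EtaleSite.mul_congr (G := G) _ hσ ((congrArg (EtaleSite.Hom.toMap ρ) htx).trans hρ)
  have key : τ₃ =ᶠ[𝓝 x.1] τ₂ ∘ τ₁ := by
    have h5 : ∀ᶠ y in 𝓝 x.1, ∀ hh : τ₁ y ∈ V.carrier,
        (EtaleSite.Hom.target ρ ⟨τ₁ y, hh⟩).1 = τ₂ (τ₁ y) := by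
      have h6 := h₁.continuousAt.tendsto
      rw [t1] at h6
      exact (h6.eventually hτ₂).mono fun y hy hh => (hy hh).1
    filter_upwards [hτ₁, hτ₃, h5, U.carrier.isOpen.mem_nhds x.2] with y y1 y3 y5 yU
    have z1 := (y1 yU).1
    have z3 := (y3 yU).1
    have hmem : τ₁ y ∈ V.carrier := by
      rw [← z1]
      exact (EtaleSite.Hom.target σ ⟨y, yU⟩).2
    have z5 := y5 hmem
    have z6 := congrArg Subtype.val (EtaleSite.comp_target σ ρ ⟨y, yU⟩)
    have z7 : EtaleSite.Hom.target σ ⟨y, yU⟩ = ⟨τ₁ y, hmem⟩ := Subtype.ext z1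
    exact z3.symm.trans (z6.trans ((congrArg (fun w => (EtaleSite.Hom.target ρ w).1) z7).trans z5))
  have e3' : arrowTangent G (EtaleSite.Hom.toMap (σ ≫ ρ) x) = tangentMapAt d τ₃ x.1 := e3
  have e1' : arrowTangent G (EtaleSite.Hom.toMap σ x) = tangentMapAt d τ₁ x.1 := e1
  have e2' : arrowTangent G (EtaleSite.Hom.toMap ρ ⟨G.src h, hV⟩) =
    tangentMapAt d τ₂ (G.src h) := e2
  have hm2 : MDifferentiableAt (𝓡 d) (𝓡 d) τ₂ (τ₁ x) := by
    rw [t1]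
    exact h₂.mdifferentiableAt (by simp)
  rw [m3] at e3'
  rw [hσ] at e1'
  rw [hρ] at e2'
  rw [e3', e1', e2', tangentMapAt_congr key,
    tangentMapAt_comp hm2 (h₁.mdifferentiableAt (by simp)), t1]

/-- The transported function agrees locally with the pullback along a smooth map. -/
theorem eventually_extendZero_pull {G : SmoothEtaleGroupoid d X₀ X₁} {A : Type} [Zero A]
    {U V : EtaleSite G} (σ : U ⟶ V) (x : U.carrier) (f : X₀ → A) :
    ∃ τ : X₀ → X₀, ContMDiffAt (𝓡 d) (𝓡 d) ∞ τ x ∧ τ x = EtaleSite.Hom.target σ x ∧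
      extendZero U.carrier (fun y => f (EtaleSite.Hom.target σ y)) =ᶠ[𝓝 x.1] f ∘ τ := by
  obtain ⟨τ, h1, h2⟩ := exists_local_target σ x
  refine ⟨τ, h1, ((h2.self_of_nhds x.2).1).symm, ?_⟩
  filter_upwards [h2, U.carrier.isOpen.mem_nhds x.2] with y hy hyU
  rw [extendZero_apply_mem _ hyU, (hy hyU).1]
  rfl

/-- The `G`-sheaf of `ℂˣ`-valued smooth functions (written additively), with trivial action. -/
noncomputable def unitsData : FunctionSheafData G (Additive ℂˣ) where
  act _ := AddMonoidHom.id _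
  act_one _ _ := rfl
  act_mul _ _ _ _ := rfl
  IsSection f x := SmoothUnitAt d f x
  congr := SmoothUnitAt.congr
  zero := SmoothUnitAt.zero
  add := SmoothUnitAt.add
  neg := SmoothUnitAt.neg
  pull σ x f hf := by
    obtain ⟨τ, h1, h2, h3⟩ := eventually_extendZero_pull σ x f
    exact SmoothUnitAt.congr h3.symm (SmoothUnitAt.pull (h2 ▸ hf) h1)

/-- The pullback of alternating forms by the tangent action of an arrow. -/
noncomputable def formAct (k : ℕ) (g : X₁) : FormFiber d k →+ FormFiber d k where
  toFun α := α.compContinuousLinearMap (arrowTangent G g)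
  map_zero' := rfl
  map_add' _ _ := rfl

theorem eventually_extendZero_form {k : ℕ} {U V : EtaleSite G} (σ : U ⟶ V) (x : U.carrier)
    (f : X₀ → FormFiber d k) :
    ∃ τ : X₀ → X₀, ContMDiffAt (𝓡 d) (𝓡 d) ∞ τ x ∧ τ x = EtaleSite.Hom.target σ x ∧
      arrowTangent G (EtaleSite.Hom.toMap σ x) = tangentMapAt d τ x ∧
      extendZero U.carrier (fun y => formAct G k (EtaleSite.Hom.toMap σ y)
        (f (EtaleSite.Hom.target σ y))) =ᶠ[𝓝 x.1] pullForm τ f := by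
  obtain ⟨τ, h1, h2⟩ := exists_local_target σ x
  refine ⟨τ, h1, ((h2.self_of_nhds x.2).1).symm, (h2.self_of_nhds x.2).2, ?_⟩
  filter_upwards [h2, U.carrier.isOpen.mem_nhds x.2] with y hy hyU
  rw [extendZero_apply_mem _ hyU, (hy hyU).1]
  show ContinuousAlternatingMap.compContinuousLinearMap _ (arrowTangent G _) = _
  rw [(hy hyU).2]
  rfl

/-- The `G`-sheaf of smooth complex-valued differential `k`-forms, arrows acting by pullback. -/
noncomputable def formData (k : ℕ) : FunctionSheafData G (FormFiber d k) where
  act := formAct G k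
  act_one x α := by
    show α.compContinuousLinearMap (arrowTangent G (G.one x)) = α
    rw [arrowTangent_one]
    rfl
  act_mul g h e α := by
    show α.compContinuousLinearMap (arrowTangent G (G.mul g h e)) = _
    rw [arrowTangent_mul]
    rfl
  IsSection f x := SmoothFormAt f x
  congr := SmoothFormAt.congr
  zero := SmoothFormAt.zero
  add := SmoothFormAt.add
  neg := SmoothFormAt.neg
  pull σ x f hf := by
    obtain ⟨τ, h1, h2, -, h3⟩ := eventually_extendZero_form G σ x f
    exact SmoothFormAt.congr h3.symm (SmoothFormAt.pull (h2 ▸ hf) h1)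

open FunctionSheafData

/-- The exterior derivative. -/
noncomputable def dOperator (k : ℕ) : Operator (formData G k) (formData G (k + 1)) where
  op := dForm
  congr := dForm_congr
  add := dForm_add
  isSection := SmoothFormAt.dForm
  equivariant σ x f hf := by
    obtain ⟨τ, h1, h2, h4, h3⟩ := eventually_extendZero_form G σ x f
    have h5 : SmoothFormAt f (τ x) := h2 ▸ hf.self_of_nhds
    refine (dForm_congr h3).trans ((dForm_pull h5 h1).trans ?_)
    show _ = ContinuousAlternatingMap.compContinuousLinearMap _ (arrowTangent G _)
    rw [h4, ← h2]
    rfl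

/-- The logarithmic differential. -/
noncomputable def dlogOperator : Operator (unitsData G) (formData G 1) where
  op := dlogForm
  congr := dlogForm_congr
  add := dlogForm_add
  isSection := SmoothUnitAt.dlogForm
  equivariant σ x f hf := by
    obtain ⟨τ, h1, h2⟩ := exists_local_target σ x
    have h0 := h2.self_of_nhds x.2
    have h5 : SmoothUnitAt d f (τ x) := h0.1 ▸ hf.self_of_nhds
    have h3 : (extendZero _ fun y => (unitsData G).act (EtaleSite.Hom.toMap σ y)
        (f (EtaleSite.Hom.target σ y))) =ᶠ[𝓝 x.1] f ∘ τ := by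
      filter_upwards [h2, Opens.isOpen _ |>.mem_nhds x.2] with y hy hyU
      rw [extendZero_apply_mem _ hyU, (hy hyU).1]
      rfl
    refine (dlogForm_congr h3).trans ((dlogForm_pull h5 h1).trans ?_)
    show _ = ContinuousAlternatingMap.compContinuousLinearMap _ (arrowTangent G _)
    have h4 : arrowTangent G (EtaleSite.Hom.toMap σ x) = tangentMapAt d τ x := h0.2
    have h6 : (EtaleSite.Hom.target σ x).1 = τ x := h0.1
    rw [h4, h6]
    rfl

/-- The inclusion of the locally constant functions with values in a subgroup of `ℂ` into the
`0`-forms. -/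
noncomputable def inclOperator (A : AddSubgroup ℂ) : Operator (constData G A) (formData G 0) where
  op f := zeroForm fun x => (f x : ℂ)
  congr h := by simp only [zeroForm, h.self_of_nhds]
  add _ _ := by ext v; simp [zeroForm]
  isSection {f x} hf := by
    refine smoothFormAt_zeroForm (ContMDiffAt.congr_of_eventuallyEq
      (f := fun _ => (f x : ℂ)) contMDiffAt_const ?_)
    exact hf.self_of_nhds.mono fun y hy => by simp only [hy]
  equivariant σ x f hf := by
    simp only [zeroForm]
    rw [extendZero_apply]
    rfl

/-- The inclusion of the locally constant into the smooth `ℂˣ`-valued functions. -/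
noncomputable def unitsInclOperator :
    Operator (constData G (Additive ℂˣ)) (unitsData G) where
  op f := f
  congr h := h.self_of_nhds
  add _ _ := rfl
  isSection hf := SmoothUnitAt.const hf.self_of_nhds
  equivariant _ _ _ _ := extendZero_apply _ _

end Sheaves

section Cohomology

set_option linter.unusedSectionVars false

variable (G : SmoothEtaleGroupoid d X₀ X₁)

/-- The whole space of objects, as an object of the site. -/
def EtaleSite.total : EtaleSite G := ⟨⊤⟩

/-- The invariant global sections of a `G`-sheaf: the global sections fixed by all arrows. -/
def invariantSubgroup (F : GSheaf G) :
    AddSubgroup (F.obj.obj (Opposite.op (EtaleSite.total G))) where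
  carrier := {a | ∀ (U : EtaleSite G) (σ : U ⟶ EtaleSite.total G),
    F.obj.map σ.op a = F.obj.map (EtaleSite.incl (V := EtaleSite.total G) (fun _ _ => trivial) :
      U ⟶ EtaleSite.total G).op a}
  zero_mem' U σ := by simp
  add_mem' ha hb U σ := by rw [map_add, map_add, ha U σ, hb U σ]
  neg_mem' ha U σ := by rw [map_neg, map_neg, ha U σ]

/-- The functor `Γ_inv` of invariant global sections. -/
def invariantSections : GSheaf G ⥤ AddCommGrpCat.{u} where
  obj F := AddCommGrpCat.of (invariantSubgroup G F)
  map {F F'} f := AddCommGrpCat.ofHom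
    (((f.hom.app (Opposite.op (EtaleSite.total G))).hom.comp (invariantSubgroup G F).subtype).codRestrict
      (invariantSubgroup G F') fun a U σ => by
        have h (τ : U ⟶ EtaleSite.total G) : F'.obj.map τ.op
            (f.hom.app (Opposite.op (EtaleSite.total G)) a.1) =
            f.hom.app (Opposite.op U) (F.obj.map τ.op a.1) :=
          (ConcreteCategory.congr_hom (f.hom.naturality τ.op) a.1).symm
        exact (h σ).trans ((congrArg _ (a.2 U σ)).trans (h _).symm))
  map_id F := by ext; rfl
  map_comp f g := by ext; rfl

instance : (invariantSections G).Additive where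
  map_add := by intros; ext; rfl

/-- Hypercohomology `ℍ^p(G, F^•)` of a bounded below complex of abelian `G`-sheaves: the `p`-th
right (hyper)derived functor of `Γ_inv`, that is the `p`-th cohomology group of `Γ_inv(G, T^•)` for
a quasi-isomorphism `F^• → T^•` to a bounded below complex of injective `G`-sheaves. -/
noncomputable def hypercohomology (p : ℤ) :
    CochainComplex.Plus (GSheaf G) ⥤ AddCommGrpCat.{u} :=
  letI := HasDerivedCategory.standard (GSheaf G)
  letI := HasDerivedCategory.standard AddCommGrpCat.{u}
  DerivedCategory.Plus.Q ⋙ (invariantSections G).rightDerivedFunctorPlus ⋙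
    DerivedCategory.Plus.homologyFunctor AddCommGrpCat.{u} p

/-- A `G`-sheaf as a complex concentrated in degree `0`. -/
noncomputable def inDegreeZero (F : GSheaf G) : CochainComplex.Plus (GSheaf G) :=
  ⟨(HomologicalComplex.single (GSheaf G) (ComplexShape.up ℤ) 0).obj F, 0, inferInstance⟩

/-- Sheaf cohomology `H^p(G, F)`. -/
noncomputable def sheafCohomology (F : GSheaf G) (p : ℤ) : AddCommGrpCat.{u} :=
  (hypercohomology G p).obj (inDegreeZero G F)

/-- The constant `G`-sheaf of a group `A`, i.e. the sheaf of locally constant `A`-valued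
functions. -/
noncomputable def constSheaf (A : Type) [AddCommGroup A] : GSheaf G := (constData G A).sheaf

/-- The subgroup `ℤ(n) = (2π√-1)^n ℤ` of `ℂ`. -/
noncomputable def twistedIntegers (n : ℕ) : AddSubgroup ℂ :=
  AddSubgroup.zmultiples ((2 * Real.pi * Complex.I) ^ n)

variable [IsManifold (𝓡 d) ∞ X₀] [IsManifold (𝓡 d) ∞ X₁]

/-- The `G`-sheaf of smooth `ℂˣ`-valued functions. -/
noncomputable def unitsSheaf : GSheaf G := (unitsData G).sheaf

/-- The `G`-sheaf `𝒜^k` of smooth complex-valued differential `k`-forms. -/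
noncomputable def formSheaf (k : ℕ) : GSheaf G := (formData G k).sheaf

/-- The exterior derivative `𝒜^k → 𝒜^{k+1}`. -/
noncomputable def dHom (k : ℕ) : formSheaf G k ⟶ formSheaf G (k + 1) := (dOperator G k).hom

/-- `d log` from the smooth `ℂˣ`-valued functions to `𝒜^1`. -/
noncomputable def dlogHom : unitsSheaf G ⟶ formSheaf G 1 := (dlogOperator G).hom

/-- The inclusion of a constant sheaf of complex numbers into `𝒜^0`. -/
noncomputable def inclHom (A : AddSubgroup ℂ) : constSheaf G A ⟶ formSheaf G 0 :=
  (inclOperator G A).hom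

/-- The inclusion of the locally constant into the smooth `ℂˣ`-valued functions. -/
noncomputable def unitsInclHom : constSheaf G (Additive ℂˣ) ⟶ unitsSheaf G :=
  (unitsInclOperator G).hom

theorem dHom_comp_dHom (k : ℕ) : dHom G k ≫ dHom G (k + 1) = 0 :=
  FunctionSheafData.Operator.hom_comp_hom _ _ fun _ _ hf => dForm_dForm hf

theorem dlogHom_comp_dHom : dlogHom G ≫ dHom G 1 = 0 :=
  FunctionSheafData.Operator.hom_comp_hom _ _ fun _ _ hf => dForm_dlogForm hf

theorem inclHom_comp_dHom (A : AddSubgroup ℂ) : inclHom G A ≫ dHom G 0 = 0 :=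
  FunctionSheafData.Operator.hom_comp_hom _ _ fun f x hf => by
    refine dForm_zeroForm_const (d := d) (u := fun x => (f x : ℂ)) ?_
    exact hf.self_of_nhds.mono fun y hy => by simp only [hy]

theorem unitsInclHom_comp_dlogHom : unitsInclHom G ≫ dlogHom G = 0 :=
  FunctionSheafData.Operator.hom_comp_hom _ _ fun _ _ hf => dlogForm_const hf.self_of_nhds

/-- The terms `ℤ(n), 𝒜^0, 𝒜^1, …`. -/
noncomputable def integersDeRhamX (n : ℕ) : ℕ → GSheaf G
  | 0 => constSheaf G (twistedIntegers n)
  | k + 1 => formSheaf G k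

/-- The differentials `i, d, d, …`, with `i` the inclusion. -/
noncomputable def integersDeRhamD (n : ℕ) :
    ∀ k, integersDeRhamX G n k ⟶ integersDeRhamX G n (k + 1)
  | 0 => inclHom G (twistedIntegers n)
  | k + 1 => dHom G k

theorem integersDeRhamD_comp (n k : ℕ) :
    integersDeRhamD G n k ≫ integersDeRhamD G n (k + 1) = 0 :=
  match k with
  | 0 => inclHom_comp_dHom G _
  | k + 1 => dHom_comp_dHom G k

/-- The untruncated complex `ℤ(n) → 𝒜^0 → 𝒜^1 → 𝒜^2 → ⋯`. -/
noncomputable def integersDeRham (n : ℕ) : CochainComplex (GSheaf G) ℕ :=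
  CochainComplex.of (integersDeRhamX G n) (integersDeRhamD G n) (integersDeRhamD_comp G n)

/-- The terms `ℂˣ, 𝒜^1, 𝒜^2, …`. -/
noncomputable def unitsDeRhamX : ℕ → GSheaf G
  | 0 => unitsSheaf G
  | k + 1 => formSheaf G (k + 1)

/-- The differentials `d log, d, d, …`. -/
noncomputable def unitsDeRhamD : ∀ k, unitsDeRhamX G k ⟶ unitsDeRhamX G (k + 1)
  | 0 => dlogHom G
  | k + 1 => dHom G (k + 1)

theorem unitsDeRhamD_comp (k : ℕ) : unitsDeRhamD G k ≫ unitsDeRhamD G (k + 1) = 0 :=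
  match k with
  | 0 => dlogHom_comp_dHom G
  | k + 1 => dHom_comp_dHom G (k + 1)

/-- The untruncated complex `ℂˣ → 𝒜^1 → 𝒜^2 → ⋯`. -/
noncomputable def unitsDeRham : CochainComplex (GSheaf G) ℕ :=
  CochainComplex.of (unitsDeRhamX G) (unitsDeRhamD G) (unitsDeRhamD_comp G)

/-- The complex in degrees `0, …, m` obtained from a complex in degrees `≥ 0` by deleting the terms
of degree `> m` (it is the zero complex for `m < 0`). -/
noncomputable def cutoff (K : CochainComplex (GSheaf G) ℕ) (m : ℤ) :
    CochainComplex.Plus (GSheaf G) :=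
  ⟨(K.extend ComplexShape.embeddingUpNat).stupidTrunc (ComplexShape.embeddingUpIntLE m),
    0, inferInstance⟩

/-- The smooth Deligne complex `ℤ(n)_D^∞ : ℤ(n) → 𝒜^0 → ⋯ → 𝒜^{n-1}`, with `ℤ(n)` in degree `0`. -/
noncomputable def deligneComplex (n : ℕ) : CochainComplex.Plus (GSheaf G) :=
  cutoff G (integersDeRham G n) n

/-- The complex `ℂˣ(n) : ℂˣ → 𝒜^1 → ⋯ → 𝒜^{n-1}`, with `ℂˣ` in degree `0`, for `n ≥ 1`. -/
noncomputable def unitsComplex (n : ℕ) : CochainComplex.Plus (GSheaf G) :=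
  cutoff G (unitsDeRham G) (n - 1)

/-- The degree `0` term of `ℂˣ(n)`. -/
noncomputable def unitsComplexXZero {n : ℕ} (hn : 1 ≤ n) :
    (unitsComplex G n).obj.X 0 ≅ unitsSheaf G :=
  HomologicalComplex.stupidTruncXIso _ (ComplexShape.embeddingUpIntLE (n - 1)) (i := n - 1)
    (by
      show ((n : ℤ) - 1) - ((n - 1 : ℕ) : ℤ) = 0
      lia) ≪≫
  HomologicalComplex.extendXIso _ ComplexShape.embeddingUpNat (i := 0) rfl

/-- The projection of `ℂˣ(n)` to its degree `0` term. -/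
noncomputable def unitsProj {n : ℕ} (hn : 1 ≤ n) :
    unitsComplex G n ⟶ inDegreeZero G (unitsSheaf G) :=
  ObjectProperty.homMk (HomologicalComplex.mkHomToSingle (unitsComplexXZero G hn).hom (by
    intro i hi
    have hi' : i + 1 = 0 := hi
    have h := (inferInstance : CochainComplex.IsStrictlyGE (((unitsDeRham G).extend
      ComplexShape.embeddingUpNat).stupidTrunc (ComplexShape.embeddingUpIntLE (n - 1))) 0)
    exact (CochainComplex.isZero_of_isStrictlyGE (((unitsDeRham G).extend
      ComplexShape.embeddingUpNat).stupidTrunc (ComplexShape.embeddingUpIntLE (n - 1)))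
      0 i (by lia)).eq_of_src _ _))

theorem stupidTrunc_d_eq (K : CochainComplex (GSheaf G) ℤ) {m : ℤ} {i j : ℕ} {i' j' : ℤ}
    (hi : (ComplexShape.embeddingUpIntLE m).f i = i')
    (hj : (ComplexShape.embeddingUpIntLE m).f j = j') :
    (K.stupidTrunc (ComplexShape.embeddingUpIntLE m)).d i' j' =
      (K.stupidTruncXIso (ComplexShape.embeddingUpIntLE m) hi).hom ≫ K.d i' j' ≫
        (K.stupidTruncXIso (ComplexShape.embeddingUpIntLE m) hj).inv := by
  subst hi hj
  unfold HomologicalComplex.stupidTrunc HomologicalComplex.stupidTruncXIso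
  rw [HomologicalComplex.extend_d_eq _ _ rfl rfl]
  simp
  rfl

theorem comp_stupidTruncXIso_inv_d (K : CochainComplex (GSheaf G) ℤ) {m : ℤ} {A : GSheaf G}
    (φ : A ⟶ K.X 0) (hφ : φ ≫ K.d 0 1 = 0) {i : ℕ}
    (hi : (ComplexShape.embeddingUpIntLE m).f i = 0) :
    (φ ≫ (K.stupidTruncXIso (ComplexShape.embeddingUpIntLE m) hi).inv) ≫
      (K.stupidTrunc (ComplexShape.embeddingUpIntLE m)).d 0 1 = 0 := by
  by_cases h : ∃ j, (ComplexShape.embeddingUpIntLE m).f j = 1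
  · obtain ⟨j, hj⟩ := h
    have h2 := stupidTrunc_d_eq G K hi hj
    rw [h2, Category.assoc, Iso.inv_hom_id_assoc, reassoc_of% hφ, Limits.zero_comp]
  · exact (HomologicalComplex.isZero_stupidTrunc_X _ _ 1 fun j hj => h ⟨j, hj⟩).eq_of_tgt _ _

theorem comp_extendXIso_inv_d (K : CochainComplex (GSheaf G) ℕ) {A : GSheaf G}
    (φ : A ⟶ K.X 0) (hφ : φ ≫ K.d 0 1 = 0) :
    (φ ≫ (K.extendXIso ComplexShape.embeddingUpNat (i := 0) (i' := 0) rfl).inv) ≫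
      (K.extend ComplexShape.embeddingUpNat).d 0 1 = 0 := by
  have h2 := K.extend_d_eq ComplexShape.embeddingUpNat (i := 0) (j := 1) (i' := 0) (j' := 1) rfl rfl
  rw [h2, Category.assoc, Iso.inv_hom_id_assoc, reassoc_of% hφ, Limits.zero_comp]

theorem unitsIncl_comp_unitsComplex_d {n : ℕ} (hn : 1 ≤ n) :
    (unitsInclHom G ≫ (unitsComplexXZero G hn).inv) ≫ (unitsComplex G n).obj.d 0 1 = 0 := by
  have h4 : (unitsDeRham G).d 0 1 = dlogHom G :=
    CochainComplex.of_d (unitsDeRhamX G) (unitsDeRhamD G) 0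
  have h5 := comp_extendXIso_inv_d G (unitsDeRham G) (unitsInclHom G)
    ((congrArg (unitsInclHom G ≫ ·) h4).trans (unitsInclHom_comp_dlogHom G))
  have h6 := comp_stupidTruncXIso_inv_d G _ _ h5 (m := (n : ℤ) - 1) (i := n - 1) (by
    show ((n : ℤ) - 1) - ((n - 1 : ℕ) : ℤ) = 0
    lia)
  exact (congrArg (· ≫ (unitsComplex G n).obj.d 0 1) (Category.assoc _ _ _).symm).trans h6

/-- The inclusion of the locally constant `ℂˣ`-valued functions in the degree `0` term. -/
noncomputable def constToUnits {n : ℕ} (hn : 1 ≤ n) :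
    inDegreeZero G (constSheaf G (Additive ℂˣ)) ⟶ unitsComplex G n :=
  ObjectProperty.homMk (HomologicalComplex.mkHomFromSingle
    (unitsInclHom G ≫ (unitsComplexXZero G hn).inv) (by
      intro k hk
      obtain rfl : k = 1 := by
        have hk' : 0 + 1 = k := hk
        lia
      exact unitsIncl_comp_unitsComplex_d G hn))

end Cohomology

end Groupoid
end DeligneGroupoid

/-! All three statements compare two complexes by a long exact sequence. Such sequences are
available once the right derived functor of `invariantSections G` is known to be triangulated. This
holds because bounded below complexes of injectives, up to homotopy, form a category equivalent to
the bounded below derived category, and on them the derived functor is computed termwise.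

Statement 1. Let c = 2πi / (2πi)^n. Then w ↦ exp(cw) is an epimorphism from the 0-forms to the units
with kernel ℤ(n) (`shortExact_exp`), and d log exp(cw) = c dw. Hence the exponential in degree 0 and
multiplication by ±c in positive degrees form an epimorphism from the Deligne complex, shifted by
one, to the complex of units. Its kernel lives in degrees -1 and 0 and has an isomorphism as
differential, so it contributes nothing (`isIso_hyperRightDerived_map_of_cokernel`).

Statement 3. A function with d log u = 0 is locally constant, and by the Poincaré lemma a closed
form is locally exact; a closed 1-form dβ is also d log exp β. So the complex of units resolves the
constant sheaf, except for cohomology in its top degree n - 1. The cokernel of the inclusion has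
cohomology only in degrees ≥ n - 1, hence no hypercohomology below n - 1
(`isIso_hyperRightDerived_map_fromSingle`).

Statement 2. The kernel of the projection consists of sheaves of forms in degrees 1, …, n - 1. If
these are acyclic, it has no hypercohomology in degrees ≥ n
(`isIso_hyperRightDerived_map_toSingle`). Acyclicity of the 0-forms in the exponential sequence
gives the comparison with ℤ.

Acyclicity over a proper groupoid (`InvariantAction.isRightAcyclic`) is proved for every sheaf on
which the invariant smooth functions act additively, each function killing the sections over the
open sets where it vanishes. The constants 1/m make the stalks divisible, so the Godement sheaf is
injective; both it and the cokernel of the embedding into it inherit an action. By dimension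
shifting it is enough that invariant sections lift along an epimorphism of such sheaves
(`InvariantAction.epi_invariantSections_map`). Here properness enters: a local lift is averaged over
the finitely many arrows of a slice, extended to the saturation of the slice, and the results are
glued by an invariant partition of unity, built from bump functions summed over orbits. -/

namespace CategoryTheory.Functor

open Limits Pretriangulated

/-! ### Right derived functors as triangulated functors -/

section Triangulated

variable {C D : Type*} [Category* C] [Category* D] [Abelian C] [Abelian D]
  [HasDerivedCategory C] [HasDerivedCategory D] (F : C ⥤ D) [F.Additive]

variable (C) in
/-- The functor from the bounded below homotopy category of injective objects to the bounded below
derived category. -/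
noncomputable abbrev injectivesToDerivedPlus :
    HomotopyCategory.Plus (InjectiveObject C) ⥤ DerivedCategory.Plus C :=
  (InjectiveObject.ι C).mapHomotopyCategoryPlus ⋙ DerivedCategory.Plus.Qh

instance isKInjective_mapHomotopyCategoryPlus_obj (X : HomotopyCategory.Plus (InjectiveObject C)) :
    CochainComplex.IsKInjective
      (((InjectiveObject.ι C).mapHomotopyCategoryPlus.obj X).obj.as) := by
  obtain ⟨K, rfl⟩ := HomotopyCategory.Plus.quotient_obj_surjective X
  exact inferInstanceAs (CochainComplex.IsKInjective
    (((InjectiveObject.ι C).mapHomologicalComplex (.up ℤ)).obj K.obj))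

/-- A bounded below complex of injectives is K-injective, so homotopy classes of maps into it are
already the morphisms of the derived category. -/
theorem injectivesToDerivedPlus_map_bijective (X Y : HomotopyCategory.Plus (InjectiveObject C)) :
    Function.Bijective ((injectivesToDerivedPlus C).map : (X ⟶ Y) → _) :=
  (DerivedCategory.Plus.Qh_map_bijective_of_isKInjective
    ((InjectiveObject.ι C).mapHomotopyCategoryPlus.obj X)
    ((InjectiveObject.ι C).mapHomotopyCategoryPlus.obj Y) inferInstance).comp
  ((FullyFaithful.ofFullyFaithful (InjectiveObject.ι C).mapHomotopyCategoryPlus).map_bijective X Y)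

instance : (injectivesToDerivedPlus C).Full :=
  ⟨(injectivesToDerivedPlus_map_bijective _ _).2⟩

instance : (injectivesToDerivedPlus C).Faithful :=
  ⟨fun h => (injectivesToDerivedPlus_map_bijective _ _).1 h⟩

variable [EnoughInjectives C]

/-- Essential surjectivity is the existence of injective resolutions of bounded below complexes. -/
instance : (injectivesToDerivedPlus C).IsEquivalence where

/-- On complexes of injective objects, the right derived functor is computed termwise. -/
noncomputable def injectivesCompRightDerivedIso :
    injectivesToDerivedPlus C ⋙ F.rightDerivedFunctorPlus ≅
      (InjectiveObject.ι C).mapHomotopyCategoryPlus ⋙ F.mapHomotopyCategoryPlus ⋙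
        DerivedCategory.Plus.Qh :=
  (NatIso.ofComponents (fun X => asIso (F.rightDerivedFunctorPlusUnit.app
    ((InjectiveObject.ι C).mapHomotopyCategoryPlus.obj X)))
    fun _ => F.rightDerivedFunctorPlusUnit.naturality _).symm

/-- An equivalence is a localization at the isomorphisms. In this form the general lifting of shift
structures along localizations carries the commutation with shifts, and with it triangulatedness,
from the termwise functor to `F.rightDerivedFunctorPlus`. -/
instance : (injectivesToDerivedPlus C).IsLocalization
    (MorphismProperty.isomorphisms (HomotopyCategory.Plus (InjectiveObject C))) :=
  Functor.IsLocalization.of_isEquivalence _ _ fun _ _ f (hf : IsIso f) => by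
    change IsIso _
    infer_instance

noncomputable instance : Localization.Lifting (injectivesToDerivedPlus C)
    (MorphismProperty.isomorphisms _)
    ((InjectiveObject.ι C).mapHomotopyCategoryPlus ⋙ F.mapHomotopyCategoryPlus ⋙
      DerivedCategory.Plus.Qh)
    F.rightDerivedFunctorPlus := ⟨injectivesCompRightDerivedIso F⟩

noncomputable instance : F.rightDerivedFunctorPlus.CommShift ℤ :=
  Functor.commShiftOfLocalization (injectivesToDerivedPlus C) (MorphismProperty.isomorphisms _) ℤ
    ((InjectiveObject.ι C).mapHomotopyCategoryPlus ⋙ F.mapHomotopyCategoryPlus ⋙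
      DerivedCategory.Plus.Qh)
    F.rightDerivedFunctorPlus

instance : NatTrans.CommShift (injectivesCompRightDerivedIso F).hom ℤ := by
  change NatTrans.CommShift (Localization.Lifting.iso (injectivesToDerivedPlus C)
    (MorphismProperty.isomorphisms _)
    ((InjectiveObject.ι C).mapHomotopyCategoryPlus ⋙ F.mapHomotopyCategoryPlus ⋙
      DerivedCategory.Plus.Qh) F.rightDerivedFunctorPlus).hom ℤ
  infer_instance

instance : F.rightDerivedFunctorPlus.IsTriangulated :=
  Functor.isTriangulated_of_precomp_iso (injectivesCompRightDerivedIso F)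

/-- The hypercohomology functors of an additive functor. -/
noncomputable abbrev hyperRightDerived (p : ℤ) : CochainComplex.Plus C ⥤ D :=
  DerivedCategory.Plus.Q ⋙ F.rightDerivedFunctorPlus ⋙ DerivedCategory.Plus.homologyFunctor D p

end Triangulated

end CategoryTheory.Functor

/-! ### Distinguished triangles and long exact sequences -/

namespace DerivedCategory.Plus

open CategoryTheory Limits Pretriangulated

variable {C : Type*} [Category* C] [Abelian C] [HasDerivedCategory C]

/-- The triangle exists in the unbounded derived category. Since `ι` is fully faithful and commutes
with the shift, its connecting morphism descends to the bounded below one, where distinguished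
triangles are detected by `ι`. -/
theorem exists_triangle_of_shortExact {K₁ K₂ K₃ : CochainComplex.Plus C} (f : K₁ ⟶ K₂)
    (g : K₂ ⟶ K₃) (w : f.hom ≫ g.hom = 0) (h : (ShortComplex.mk f.hom g.hom w).ShortExact) :
    ∃ δ : Q.obj K₃ ⟶ (Q.obj K₁)⟦(1 : ℤ)⟧,
      Triangle.mk (Q.map f) (Q.map g) δ ∈ distTriang (DerivedCategory.Plus C) := by
  refine ⟨ι.preimage (triangleOfSESδ h ≫ (ι.commShiftIso (1 : ℤ)).inv.app (Q.obj K₁)), ?_⟩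
  refine isomorphic_distinguished _ (triangleOfSES_distinguished h) _
    (Triangle.isoMk _ _ (Iso.refl _) (Iso.refl _) (Iso.refl _) ?_ ?_ ?_)
  · exact (Category.comp_id _).trans (Category.id_comp _).symm
  · exact (Category.comp_id _).trans (Category.id_comp _).symm
  · have h1 (γ : ι.obj (Q.obj K₃) ⟶ (ι.obj (Q.obj K₁))⟦(1 : ℤ)⟧) :
        ι.map (ι.preimage (γ ≫ (ι.commShiftIso (1 : ℤ)).inv.app (Q.obj K₁))) ≫
          (ι.commShiftIso (1 : ℤ)).hom.app (Q.obj K₁) = γ := by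
      rw [ι.map_preimage, Category.assoc, Iso.inv_hom_id_app]
      exact Category.comp_id _
    have h2 {X Y : DerivedCategory C} (γ : X ⟶ Y⟦(1 : ℤ)⟧) : γ ≫ (𝟙 Y)⟦(1 : ℤ)⟧' = γ := by
      rw [CategoryTheory.Functor.map_id, Category.comp_id]
    exact (h2 _).trans ((h1 _).trans (Category.id_comp _).symm)

instance isGE_Q_obj (K : CochainComplex.Plus C) (n : ℤ) [h : K.obj.IsGE n] : (Q.obj K).IsGE n := by
  rw [← isGE_ι_obj_iff]
  exact inferInstanceAs ((DerivedCategory.Q.obj K.obj).IsGE n)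

theorem isIso_Q_map {K L : CochainComplex.Plus C} (f : K ⟶ L) [QuasiIso f.hom] :
    IsIso (Q.map f) := by
  have : IsIso (ι.map (Q.map f)) := inferInstanceAs (IsIso (DerivedCategory.Q.map f.hom))
  exact isIso_of_fully_faithful ι _

end DerivedCategory.Plus

namespace CategoryTheory.Functor

open Limits Pretriangulated

section LongExactSequence

variable {C D : Type*} [Category* C] [Category* D] [Abelian C] [Abelian D]
  [HasDerivedCategory C] [HasDerivedCategory D] (F : C ⥤ D) [F.Additive] [EnoughInjectives C]

variable {K₁ K₂ K₃ : CochainComplex.Plus C} (f : K₁ ⟶ K₂)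
    (g : K₂ ⟶ K₃) (w : f.hom ≫ g.hom = 0) (h : (ShortComplex.mk f.hom g.hom w).ShortExact)

include h

/-- The long exact sequence of hypercohomology. -/
theorem exists_hyperRightDerived_exact (p : ℤ) :
    ∃ (δ : (F.hyperRightDerived p).obj K₃ ⟶ (F.hyperRightDerived (p + 1)).obj K₁)
      (w₁ : (F.hyperRightDerived p).map f ≫ (F.hyperRightDerived p).map g = 0)
      (w₂ : (F.hyperRightDerived p).map g ≫ δ = 0)
      (w₃ : δ ≫ (F.hyperRightDerived (p + 1)).map f = 0),
      (ShortComplex.mk _ _ w₁).Exact ∧ (ShortComplex.mk _ _ w₂).Exact ∧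
        (ShortComplex.mk _ _ w₃).Exact := by
  obtain ⟨δ, hδ⟩ := DerivedCategory.Plus.exists_triangle_of_shortExact f g w h
  have hT := F.rightDerivedFunctorPlus.map_distinguished _ hδ
  exact ⟨_, _, _, _,
    (DerivedCategory.Plus.homologyFunctor D 0).homologySequence_exact₂ _ hT p,
    (DerivedCategory.Plus.homologyFunctor D 0).homologySequence_exact₃ _ hT p (p + 1) rfl,
    (DerivedCategory.Plus.homologyFunctor D 0).homologySequence_exact₁ _ hT p (p + 1) rfl⟩

theorem isIso_hyperRightDerived_map_g (p : ℤ)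
    (h₁ : IsZero ((F.hyperRightDerived p).obj K₁))
    (h₂ : IsZero ((F.hyperRightDerived (p + 1)).obj K₁)) :
    IsIso ((F.hyperRightDerived p).map g) := by
  obtain ⟨δ, w₁, w₂, w₃, e₁, e₂, e₃⟩ := F.exists_hyperRightDerived_exact f g w h p
  have : Mono ((F.hyperRightDerived p).map g) := e₁.mono_g (h₁.eq_of_src _ _)
  have : Epi ((F.hyperRightDerived p).map g) := e₂.epi_f (h₂.eq_of_tgt _ _)
  exact isIso_of_mono_of_epi _

theorem isIso_hyperRightDerived_map_f (p : ℤ)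
    (h₁ : IsZero ((F.hyperRightDerived p).obj K₃))
    (h₂ : IsZero ((F.hyperRightDerived (p + 1)).obj K₃)) :
    IsIso ((F.hyperRightDerived (p + 1)).map f) := by
  obtain ⟨δ, w₁, w₂, w₃, e₁, e₂, e₃⟩ := F.exists_hyperRightDerived_exact f g w h p
  obtain ⟨δ', w₁', w₂', w₃', e₁', e₂', e₃'⟩ := F.exists_hyperRightDerived_exact f g w h (p + 1)
  have : Mono ((F.hyperRightDerived (p + 1)).map f) := e₃.mono_g (h₁.eq_of_src _ _)
  have : Epi ((F.hyperRightDerived (p + 1)).map f) := e₁'.epi_f (h₂.eq_of_tgt _ _)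
  exact isIso_of_mono_of_epi _

theorem nonempty_hyperRightDerived_iso (p : ℤ)
    (h₁ : IsZero ((F.hyperRightDerived p).obj K₂))
    (h₂ : IsZero ((F.hyperRightDerived (p + 1)).obj K₂)) :
    Nonempty ((F.hyperRightDerived p).obj K₃ ≅ (F.hyperRightDerived (p + 1)).obj K₁) := by
  obtain ⟨δ, w₁, w₂, w₃, e₁, e₂, e₃⟩ := F.exists_hyperRightDerived_exact f g w h p
  have : Mono δ := e₂.mono_g (h₁.eq_of_src _ _)
  have : Epi δ := e₃.epi_f (h₂.eq_of_tgt _ _)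
  have := isIso_of_mono_of_epi δ
  exact ⟨asIso δ⟩

/-- Surjectivity onto the cohomology of `K₃` makes the connecting map zero, so the cohomology of
`K₁` in degree `p + 1` embeds in that of `K₂`. This is the first step of dimension shifting. -/
theorem isZero_hyperRightDerived_X₁ (p : ℤ) (h₁ : Epi ((F.hyperRightDerived p).map g))
    (h₂ : IsZero ((F.hyperRightDerived (p + 1)).obj K₂)) :
    IsZero ((F.hyperRightDerived (p + 1)).obj K₁) := by
  obtain ⟨δ, w₁, w₂, w₃, e₁, e₂, e₃⟩ := F.exists_hyperRightDerived_exact f g w h p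
  have h0 : δ = 0 := by rw [← cancel_epi ((F.hyperRightDerived p).map g), w₂, comp_zero]
  exact e₃.isZero_X₂ h0 (h₂.eq_of_tgt _ _)

theorem isZero_hyperRightDerived_X₂ (p : ℤ) (h₁ : IsZero ((F.hyperRightDerived p).obj K₁))
    (h₂ : IsZero ((F.hyperRightDerived p).obj K₃)) :
    IsZero ((F.hyperRightDerived p).obj K₂) := by
  obtain ⟨δ, w₁, w₂, w₃, e₁, e₂, e₃⟩ := F.exists_hyperRightDerived_exact f g w h p
  exact e₁.isZero_X₂ (h₁.eq_of_src _ _) (h₂.eq_of_tgt _ _)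

end LongExactSequence

/-! ### Vanishing and comparison with termwise cohomology -/

section Computation

variable {C D : Type*} [Category* C] [Category* D] [Abelian C] [Abelian D]
  [HasDerivedCategory C] [HasDerivedCategory D] (F : C ⥤ D) [F.Additive] [EnoughInjectives C]

theorem isIso_hyperRightDerived_map_of_quasiIso {K L : CochainComplex.Plus C} (f : K ⟶ L)
    [QuasiIso f.hom] (p : ℤ) : IsIso ((F.hyperRightDerived p).map f) := by
  have := DerivedCategory.Plus.isIso_Q_map f
  dsimp only [Functor.comp_map]
  infer_instance

/-- A complex without cohomology below `n` is isomorphic, in the derived category, to a complex of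
injectives whose terms below `n` are zero; on the latter the derived functor is computed termwise.
-/
theorem isZero_hyperRightDerived_of_isGE (K : CochainComplex.Plus C) (n : ℤ) [K.obj.IsGE n]
    (p : ℤ) (hp : p < n) : IsZero ((F.hyperRightDerived p).obj K) := by
  obtain ⟨L, hL, ⟨e⟩⟩ :=
    DerivedCategory.Plus.exists_injective_nonempty_iso (DerivedCategory.Plus.Q.obj K) n
  refine IsZero.of_iso ?_ ((F.rightDerivedFunctorPlus ⋙
    DerivedCategory.Plus.homologyFunctor D p).mapIso (e.symm))
  refine IsZero.of_iso ?_ ((DerivedCategory.Plus.homologyFunctor D p).mapIso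
    ((injectivesCompRightDerivedIso F).app ((HomotopyCategory.Plus.quotient _).obj L)))
  let M : CochainComplex.Plus D := F.mapCochainComplexPlus.obj
    ((InjectiveObject.ι C).mapCochainComplexPlus.obj L)
  have h1 : CochainComplex.IsStrictlyGE (((InjectiveObject.ι C).mapHomologicalComplex _).obj L.obj)
    n := inferInstance
  have h2 : M.obj.IsStrictlyGE n := inferInstanceAs
    (CochainComplex.IsStrictlyGE ((F.mapHomologicalComplex _).obj
      (((InjectiveObject.ι C).mapHomologicalComplex _).obj L.obj)) n)
  exact DerivedCategory.Plus.isZero_homology_of_isGE (DerivedCategory.Plus.Q.obj M) n p hp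

/-- The comparison from the cohomology of the complex obtained by applying the functor termwise. -/
noncomputable def homologyToHyperRightDerived (p : ℤ) :
    CochainComplex.Plus.ι C ⋙ F.mapHomologicalComplex (.up ℤ) ⋙
      HomologicalComplex.homologyFunctor D (.up ℤ) p ⟶ F.hyperRightDerived p :=
  Functor.whiskerLeft (CochainComplex.Plus.ι C ⋙ F.mapHomologicalComplex (.up ℤ))
    (DerivedCategory.homologyFunctorFactors D p).inv ≫
  (show (HomotopyCategory.Plus.quotient C ⋙ F.mapHomotopyCategoryPlus ⋙
      DerivedCategory.Plus.Qh) ⋙ DerivedCategory.Plus.homologyFunctor D p ⟶ _ from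
    Functor.whiskerLeft (HomotopyCategory.Plus.quotient C)
      (Functor.whiskerRight F.rightDerivedFunctorPlusUnit
        (DerivedCategory.Plus.homologyFunctor D p)))

/-- On a complex of injectives the unit of the derived functor is an isomorphism; the other factor
of the comparison is always one. -/
theorem isIso_homologyToHyperRightDerived_app (K : CochainComplex.Plus C)
    [∀ n : ℤ, Injective (K.obj.X n)] (p : ℤ) :
    IsIso ((F.homologyToHyperRightDerived p).app K) := by
  have h1 : IsIso (F.rightDerivedFunctorPlusUnit.app ((HomotopyCategory.Plus.quotient C).obj K)) :=
    inferInstance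
  have h2 : IsIso ((DerivedCategory.Plus.homologyFunctor D p).map
    (F.rightDerivedFunctorPlusUnit.app ((HomotopyCategory.Plus.quotient C).obj K))) := inferInstance
  have h3 : IsIso ((DerivedCategory.homologyFunctorFactors D p).inv.app
    ((F.mapHomologicalComplex (.up ℤ)).obj K.obj)) := inferInstance
  exact @IsIso.comp_isIso _ _ _ _ _ _ _ h3 h2

/-- A left exact functor in the form in which it is easily checked. -/
def PreservesLeftExact : Prop :=
  ∀ S : ShortComplex C, S.Exact → Mono S.f → (S.map F).Exact ∧ Mono (F.map S.f)

variable (C) in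
/-- An object as a complex in a single degree. -/
noncomputable def _root_.CochainComplex.Plus.single (n : ℤ) : C ⥤ CochainComplex.Plus C :=
  ObjectProperty.lift _ (HomologicalComplex.single C (ComplexShape.up ℤ) n)
    fun _ => ⟨n, inferInstance⟩

theorem isZero_hyperRightDerived_single_of_injective (I : C) [Injective I] (p : ℤ) (hp : 0 < p) :
    IsZero ((F.hyperRightDerived p).obj ((CochainComplex.Plus.single C 0).obj I)) := by
  have h1 (n : ℤ) : Injective (((CochainComplex.Plus.single C 0).obj I).obj.X n) := by
    by_cases h : n = 0
    · subst h
      exact Injective.of_iso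
        (HomologicalComplex.singleObjXSelf (ComplexShape.up ℤ) 0 I).symm inferInstance
    · exact (HomologicalComplex.isZero_single_obj_X (ComplexShape.up ℤ) 0 I n h).injective
  have := F.isIso_homologyToHyperRightDerived_app ((CochainComplex.Plus.single C 0).obj I) p
  refine IsZero.of_iso ?_ (asIso ((F.homologyToHyperRightDerived p).app
    ((CochainComplex.Plus.single C 0).obj I))).symm
  refine HomologicalComplex.ExactAt.isZero_homology ?_
  refine ShortComplex.exact_of_isZero_X₂ _ ?_
  exact F.map_isZero (HomologicalComplex.isZero_single_obj_X (ComplexShape.up ℤ) 0 I p hp.ne')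

end Computation

end CategoryTheory.Functor

/-! ### Cohomology of single objects and dimension shifting -/

namespace CategoryTheory.Functor

open Limits Pretriangulated

/-- The cohomology of `K` in degree `0` is its term, and that of `L` is the kernel of `L.d 0 1`. The
condition is thus exactness of 0 → K⁰ → L⁰ → L¹, which a left exact functor preserves. -/
theorem _root_.CochainComplex.quasiIsoAt_zero_iff {C : Type*} [Category* C] [Abelian C]
    {K L : CochainComplex C ℤ} (φ : K ⟶ L) (hK : K.d (-1) 0 = 0) (hK' : K.d 0 1 = 0)
    (hL : L.d (-1) 0 = 0) :
    QuasiIsoAt φ 0 ↔ (ShortComplex.mk (φ.f 0) (L.d 0 1) (by simp [hK'])).Exact ∧ Mono (φ.f 0) := by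
  rw [quasiIsoAt_iff' φ (-1) 0 1 (by simp) (by simp)]
  exact ShortComplex.quasiIso_iff_of_zeros
    ((HomologicalComplex.shortComplexFunctor' C (.up ℤ) (-1) 0 1).map φ) hK hK' hL

variable {C D : Type*} [Category* C] [Category* D] [Abelian C] [Abelian D]
  [HasDerivedCategory C] [HasDerivedCategory D] (F : C ⥤ D) [F.Additive] [EnoughInjectives C]

omit [HasDerivedCategory C] [EnoughInjectives C] in
theorem shortExact_single {S : ShortComplex C} (hS : S.ShortExact) (n : ℤ) :
    (ShortComplex.mk ((CochainComplex.Plus.single C n).map S.f).hom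
      ((CochainComplex.Plus.single C n).map S.g).hom (by
        change ((CochainComplex.Plus.single C n).map S.f ≫
          (CochainComplex.Plus.single C n).map S.g).hom = 0
        rw [← Functor.map_comp, S.zero]
        exact (HomologicalComplex.single C (ComplexShape.up ℤ) n).map_zero _ _)).ShortExact :=
  hS.map_of_exact (HomologicalComplex.single C (ComplexShape.up ℤ) n)

variable {F} in
-- By left exactness `i` remains a quasi-isomorphism in degree `0` after applying `F`. In the
-- naturality square of the comparison at `i` the three other sides are then isomorphisms.
theorem isIso_homologyToHyperRightDerived_single_of_resolution (hF : F.PreservesLeftExact) {A : C}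
    {M : CochainComplex.Plus C} [∀ n : ℤ, Injective (M.obj.X n)] [M.obj.IsStrictlyGE 0]
    (i : (CochainComplex.Plus.single C 0).obj A ⟶ M) [QuasiIso i.hom] :
    IsIso ((F.homologyToHyperRightDerived 0).app ((CochainComplex.Plus.single C 0).obj A)) := by
  have hd : M.obj.d (-1) 0 = 0 :=
    (CochainComplex.isZero_of_isStrictlyGE M.obj 0 (-1) (by simp)).eq_of_src _ _
  have h1 := (CochainComplex.quasiIsoAt_zero_iff i.hom
    (HomologicalComplex.single_obj_d (ComplexShape.up ℤ) _ _ _ _)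
    (HomologicalComplex.single_obj_d (ComplexShape.up ℤ) _ _ _ _) hd).1 inferInstance
  obtain ⟨h2, h3⟩ := hF _ h1.1 h1.2
  have h4 : QuasiIsoAt ((F.mapHomologicalComplex (.up ℤ)).map i.hom) 0 := by
    refine (CochainComplex.quasiIsoAt_zero_iff _ ?_ ?_ ?_).2 ⟨h2, h3⟩
    · exact (congrArg F.map (HomologicalComplex.single_obj_d (ComplexShape.up ℤ) _ _ _ _)).trans
        (F.map_zero _ _)
    · exact (congrArg F.map (HomologicalComplex.single_obj_d (ComplexShape.up ℤ) _ _ _ _)).trans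
        (F.map_zero _ _)
    · exact (congrArg F.map hd).trans (F.map_zero _ _)
  have h5 : IsIso (HomologicalComplex.homologyMap ((F.mapHomologicalComplex (.up ℤ)).map i.hom) 0) :=
    (quasiIsoAt_iff_isIso_homologyMap _ 0).1 h4
  have h6 := F.isIso_homologyToHyperRightDerived_app M 0
  have h7 := F.isIso_hyperRightDerived_map_of_quasiIso i 0
  have h8 := (F.homologyToHyperRightDerived 0).naturality i
  have h9 : IsIso ((F.homologyToHyperRightDerived 0).app _ ≫ (F.hyperRightDerived 0).map i) := by
    rw [← h8]
    exact @IsIso.comp_isIso _ _ _ _ _ _ _ h5 h6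
  exact IsIso.of_isIso_comp_right _ ((F.hyperRightDerived 0).map i)

variable {F} in
theorem isIso_homologyToHyperRightDerived_single (hF : F.PreservesLeftExact) (A : C) :
    IsIso ((F.homologyToHyperRightDerived 0).app ((CochainComplex.Plus.single C 0).obj A)) := by
  have h0 : (((CochainComplex.Plus.single C 0).obj A).obj).IsStrictlyGE 0 :=
    inferInstanceAs (CochainComplex.IsStrictlyGE ((HomologicalComplex.single C _ 0).obj A) 0)
  obtain ⟨L, hL, i, hi⟩ :=
    CochainComplex.Plus.exists_quasiIso_injective ((CochainComplex.Plus.single C 0).obj A) 0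
  exact @isIso_homologyToHyperRightDerived_single_of_resolution _ _ _ _ _ _ _ _ F _ _ hF A
    ((InjectiveObject.ι C).mapCochainComplexPlus.obj L) (fun n => (L.obj.X n).property)
    (inferInstanceAs (CochainComplex.IsStrictlyGE
      (((InjectiveObject.ι C).mapHomologicalComplex _).obj L.obj) 0)) i hi

variable {F} in
-- In degree `0` the hypercohomology of a single object is the value of `F`, naturally in the
-- object, so surjectivity of `F.map g` carries over.
theorem epi_hyperRightDerived_single_map (hF : F.PreservesLeftExact) {A B : C} (g : A ⟶ B)
    [Epi (F.map g)] :
    Epi ((F.hyperRightDerived 0).map ((CochainComplex.Plus.single C 0).map g)) := by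
  have h1 := isIso_homologyToHyperRightDerived_single hF A
  have h2 := isIso_homologyToHyperRightDerived_single hF B
  let e : HomologicalComplex.single C (.up ℤ) 0 ⋙ F.mapHomologicalComplex (.up ℤ) ⋙
      HomologicalComplex.homologyFunctor D (.up ℤ) 0 ≅ F :=
    Functor.isoWhiskerRight (HomologicalComplex.singleMapHomologicalComplex F (.up ℤ) 0)
      (HomologicalComplex.homologyFunctor D (.up ℤ) 0) ≪≫
    Functor.isoWhiskerLeft F (HomologicalComplex.homologyFunctorSingleIso D (.up ℤ) 0)
  have h3 : Epi ((HomologicalComplex.homologyFunctor D (.up ℤ) 0).map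
      ((F.mapHomologicalComplex (.up ℤ)).map
        ((HomologicalComplex.single C (.up ℤ) 0).map g))) := by
    have h4 := e.hom.naturality g
    have h5 : Epi (e.hom.app A ≫ F.map g) := inferInstance
    rw [← h4] at h5
    exact (MorphismProperty.epimorphisms D).cancel_right_of_respectsIso _ (e.hom.app B) |>.1 h5
  have h8 := (F.homologyToHyperRightDerived 0).naturality ((CochainComplex.Plus.single C 0).map g)
  have h9 : Epi ((F.homologyToHyperRightDerived 0).app _ ≫
      (F.hyperRightDerived 0).map ((CochainComplex.Plus.single C 0).map g)) := by
    rw [← h8]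
    exact @epi_comp _ _ _ _ _ _ h3 _ (@IsIso.epi_of_iso _ _ _ _ _ h2)
  exact epi_of_epi ((F.homologyToHyperRightDerived 0).app _) _

variable {F} in
theorem isZero_hyperRightDerived_single_one (hF : F.PreservesLeftExact) {S : ShortComplex C}
    (hS : S.ShortExact) [Injective S.X₂] [Epi (F.map S.g)] :
    IsZero ((F.hyperRightDerived 1).obj ((CochainComplex.Plus.single C 0).obj S.X₁)) :=
  F.isZero_hyperRightDerived_X₁ _ _ _ (shortExact_single hS 0) 0
    (epi_hyperRightDerived_single_map hF S.g)
    (F.isZero_hyperRightDerived_single_of_injective S.X₂ _ (by simp))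

/-- For `0 < p` the injective middle term is acyclic in both degrees `p` and `p + 1`, so the
connecting map is an isomorphism. -/
theorem isZero_hyperRightDerived_single_succ {S : ShortComplex C}
    (hS : S.ShortExact) [Injective S.X₂] (p : ℤ) (hp : 0 < p)
    (h : IsZero ((F.hyperRightDerived p).obj ((CochainComplex.Plus.single C 0).obj S.X₃))) :
    IsZero ((F.hyperRightDerived (p + 1)).obj ((CochainComplex.Plus.single C 0).obj S.X₁)) := by
  obtain ⟨e⟩ := F.nonempty_hyperRightDerived_iso _ _ _ (shortExact_single hS 0) p
    (F.isZero_hyperRightDerived_single_of_injective S.X₂ _ hp)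
    (F.isZero_hyperRightDerived_single_of_injective S.X₂ _ (by lia))
  exact h.of_iso e.symm

/-- The localization functor and the derived functor both commute with the shift; cohomology in
degree `p` of a complex shifted by `a` is cohomology in degree `a + p`. -/
theorem nonempty_hyperRightDerived_iso_of_shift {K L : CochainComplex.Plus C} (a : ℤ)
    (e : K.obj ≅ L.obj⟦a⟧) (p q : ℤ) (h : a + p = q) :
    Nonempty ((F.hyperRightDerived p).obj K ≅ (F.hyperRightDerived q).obj L) := by
  let e1 : DerivedCategory.Plus.Q.obj K ≅ (DerivedCategory.Plus.Q.obj L)⟦a⟧ :=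
    DerivedCategory.Plus.ι.preimageIso (DerivedCategory.Q.mapIso e ≪≫
      (DerivedCategory.Q.commShiftIso a).app L.obj ≪≫
      ((DerivedCategory.Plus.ι (C := C)).commShiftIso a).symm.app (DerivedCategory.Plus.Q.obj L))
  exact ⟨(F.rightDerivedFunctorPlus ⋙ DerivedCategory.Plus.homologyFunctor D p).mapIso e1 ≪≫
    (DerivedCategory.Plus.homologyFunctor D p).mapIso
      ((F.rightDerivedFunctorPlus.commShiftIso a).app _) ≪≫
    ((DerivedCategory.Plus.homologyFunctor D 0).shiftIso a p q h).app _⟩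

/-- The vanishing of the higher cohomology of an object. -/
def IsRightAcyclic (A : C) : Prop :=
  ∀ p : ℤ, 0 < p → IsZero ((F.hyperRightDerived p).obj ((CochainComplex.Plus.single C 0).obj A))

variable {F} in
theorem IsRightAcyclic.isZero_single {A : C} (h : F.IsRightAcyclic A) (n p : ℤ) (hp : n < p) :
    IsZero ((F.hyperRightDerived p).obj ((CochainComplex.Plus.single C n).obj A)) := by
  obtain ⟨e⟩ := F.nonempty_hyperRightDerived_iso_of_shift
    (K := (CochainComplex.Plus.single C 0).obj A) (L := (CochainComplex.Plus.single C n).obj A) n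
    (((CochainComplex.singleFunctors C).shiftIso n 0 n (by simp)).symm.app A) (p - n) p (by lia)
  exact (h (p - n) (by lia)).of_iso e.symm

variable {F} in
theorem IsRightAcyclic.of_iso {A B : C} (h : F.IsRightAcyclic A) (e : A ≅ B) :
    F.IsRightAcyclic B := fun p hp =>
  (h p hp).of_iso ((F.hyperRightDerived p).mapIso ((CochainComplex.Plus.single C 0).mapIso e.symm))

theorem IsRightAcyclic.of_isZero {A : C} (h : IsZero A) : F.IsRightAcyclic A := fun p hp =>
  have := h.injective
  F.isZero_hyperRightDerived_single_of_injective A p hp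

end CategoryTheory.Functor

/-! ### Kernels and cokernels of bounded below complexes -/

namespace CochainComplex.Plus

open CategoryTheory Limits

variable {C : Type*} [Category* C] [Abelian C]

theorem exists_kernel {K L : Plus C} (f : K ⟶ L) [Epi f.hom] :
    ∃ (N : Plus C) (j : N ⟶ K) (w : j.hom ≫ f.hom = 0),
      (ShortComplex.mk j.hom f.hom w).ShortExact := by
  obtain ⟨n, hn⟩ := K.property
  refine ⟨⟨kernel f.hom, n, ?_⟩, ObjectProperty.homMk (kernel.ι f.hom), kernel.condition _, ?_⟩
  · rw [CochainComplex.isStrictlyGE_iff]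
    intro i hi
    exact (K.obj.isZero_of_isStrictlyGE n i hi).of_mono ((kernel.ι f.hom).f i)
  · have h1 : (ShortComplex.mk (kernel.ι f.hom) f.hom (kernel.condition _)).Exact :=
      ShortComplex.exact_of_f_is_kernel _ (kernelIsKernel f.hom)
    exact { exact := h1, mono_f := inferInstanceAs (Mono (kernel.ι f.hom)), epi_g := inferInstanceAs (Epi f.hom) }

theorem exists_cokernel {K L : Plus C} (f : K ⟶ L) [Mono f.hom] :
    ∃ (N : Plus C) (q : L ⟶ N) (w : f.hom ≫ q.hom = 0),
      (ShortComplex.mk f.hom q.hom w).ShortExact := by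
  obtain ⟨n, hn⟩ := L.property
  refine ⟨⟨cokernel f.hom, n, ?_⟩, ObjectProperty.homMk (cokernel.π f.hom),
    cokernel.condition _, ?_⟩
  · rw [CochainComplex.isStrictlyGE_iff]
    intro i hi
    exact (L.obj.isZero_of_isStrictlyGE n i hi).of_epi ((cokernel.π f.hom).f i)
  · have h1 : (ShortComplex.mk f.hom (cokernel.π f.hom) (cokernel.condition _)).Exact :=
      ShortComplex.exact_of_g_is_cokernel _ (cokernelIsCokernel f.hom)
    exact { exact := h1, mono_f := inferInstanceAs (Mono f.hom), epi_g := inferInstanceAs (Epi (cokernel.π f.hom)) }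

theorem shortExact_degreewise {K L N : Plus C} {f : K ⟶ L} {g : L ⟶ N} {w : f.hom ≫ g.hom = 0}
    (h : (ShortComplex.mk f.hom g.hom w).ShortExact) (i : ℤ) :
    (ShortComplex.mk (f.hom.f i) (g.hom.f i) (by
      rw [← HomologicalComplex.comp_f, w, HomologicalComplex.zero_f])).ShortExact :=
  h.map_of_exact (HomologicalComplex.eval C (.up ℤ) i)

/-- The kernel of the projection of a complex to its term of lowest degree consists of the other
terms. -/
theorem exists_kernel_single {a : ℤ} {N : Plus C} [N.obj.IsStrictlyGE a] {A : C}
    (π : N ⟶ (single C a).obj A) (hπ : IsIso (π.hom.f a)) :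
    ∃ (M : Plus C) (j : M ⟶ N) (w : j.hom ≫ π.hom = 0),
      (ShortComplex.mk j.hom π.hom w).ShortExact ∧ M.obj.IsStrictlyGE (a + 1) ∧
      ∀ i, i ≠ a → IsIso (j.hom.f i) := by
  have h0 (i : ℤ) (hi : i ≠ a) : IsZero (((single C a).obj A).obj.X i) :=
    HomologicalComplex.isZero_single_obj_X _ _ _ _ hi
  have : Epi π.hom := by
    refine @HomologicalComplex.epi_of_epi_f _ _ _ _ _ _ _ _ fun i => ?_
    by_cases hi : i = a
    · subst hi
      infer_instance
    · exact (h0 i hi).epi _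
  obtain ⟨M, j, w, hS⟩ := exists_kernel π
  have hd := shortExact_degreewise hS
  have hj (i : ℤ) (hi : i ≠ a) : IsIso (j.hom.f i) := by
    have := (hd i).mono_f
    have : Epi (j.hom.f i) := (hd i).exact.epi_f ((h0 i hi).eq_of_tgt _ _)
    exact isIso_of_mono_of_epi _
  have hMa : IsZero (M.obj.X a) := by
    have h1 := (hd a).mono_f
    have h2 : j.hom.f a ≫ π.hom.f a = 0 := by
      rw [← HomologicalComplex.comp_f, w, HomologicalComplex.zero_f]
    exact IsZero.of_mono_eq_zero _ ((cancel_mono (π.hom.f a)).1 (h2.trans zero_comp.symm))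
  refine ⟨M, j, w, hS, ?_, hj⟩
  rw [CochainComplex.isStrictlyGE_iff]
  intro i hi
  by_cases h : i = a
  · exact h ▸ hMa
  · have := hj i h
    exact (N.obj.isZero_of_isStrictlyGE a i (by lia)).of_iso (asIso (j.hom.f i))

end CochainComplex.Plus

/-! ### Comparison of hypercohomology from termwise data -/

namespace CategoryTheory.Functor

open Limits Pretriangulated

variable {C D : Type*} [Category* C] [Category* D] [Abelian C] [Abelian D]
  [HasDerivedCategory C] [HasDerivedCategory D] {F : C ⥤ D} [F.Additive] [EnoughInjectives C]

/-- An acyclic term placed in degree `i` has no hypercohomology in degrees above `i`, so nothing is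
left beyond the last term. The induction is on the number `k` of degrees `a, …, a + k - 1`:
splitting off the lowest term leaves a kernel that starts at `a + 1`, which is why `a` varies. -/
theorem isZero_hyperRightDerived_of_isRightAcyclic (k : ℕ) : ∀ (a : ℤ) (N : CochainComplex.Plus C)
    [N.obj.IsStrictlyGE a], (∀ i : ℤ, a + k ≤ i → IsZero (N.obj.X i)) →
    (∀ i, F.IsRightAcyclic (N.obj.X i)) → ∀ p : ℤ, a + k ≤ p →
    IsZero ((F.hyperRightDerived p).obj N) := by
  induction k with
  | zero =>
    intro a N _ hN _ p _
    -- All terms are zero, so any integer is a lower bound; `p + 1` is the one that kills degree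
    -- `p`.
    have : N.obj.IsStrictlyGE (p + 1) := by
      rw [CochainComplex.isStrictlyGE_iff]
      intro i _
      by_cases h : i < a
      · exact N.obj.isZero_of_isStrictlyGE a i h
      · exact hN i (by push_cast; lia)
    exact F.isZero_hyperRightDerived_of_isGE N (p + 1) p (by lia)
  | succ k ih =>
    intro a N _ hN hA p hp
    push_cast at hN hp
    have hNa (i : ℤ) (hi : (ComplexShape.up ℤ).Rel i a) : N.obj.d i a ≫ 𝟙 (N.obj.X a) = 0 :=
      (N.obj.isZero_of_isStrictlyGE a i (by
        have : i + 1 = a := hi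
        lia)).eq_of_src _ _
    let π : N ⟶ (CochainComplex.Plus.single C a).obj (N.obj.X a) :=
      ObjectProperty.homMk (HomologicalComplex.mkHomToSingle (𝟙 _) hNa)
    have hπa : IsIso (π.hom.f a) := by
      have h1 := HomologicalComplex.mkHomToSingle_f (𝟙 (N.obj.X a)) hNa
      have h2 : IsIso (𝟙 (N.obj.X a) ≫
        (HomologicalComplex.singleObjXSelf (.up ℤ) a (N.obj.X a)).inv) := inferInstance
      rw [← h1] at h2
      exact h2
    obtain ⟨M, j, w, hS, hM, hj⟩ := CochainComplex.Plus.exists_kernel_single π hπa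
    refine F.isZero_hyperRightDerived_X₂ j π w hS p (ih (a + 1) M (fun i hi => ?_) (fun i => ?_) p
      (by lia)) ((hA a).isZero_single a p (by lia))
    · have := hj i (by lia)
      exact (hN i (by lia)).of_iso (asIso (j.hom.f i))
    · by_cases h : i = a
      · exact IsRightAcyclic.of_isZero F (M.obj.isZero_of_isStrictlyGE (a + 1) i (by lia))
      · have := hj i h
        exact (hA i).of_iso (asIso (j.hom.f i)).symm

/-- If the terms of positive degree are acyclic and vanish in degrees `≥ m`, the projection to
the term of degree `0` is an isomorphism on hypercohomology in degrees `≥ m`. -/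
theorem isIso_hyperRightDerived_map_toSingle {N : CochainComplex.Plus C} [N.obj.IsStrictlyGE 0]
    {A : C} (π : N ⟶ (CochainComplex.Plus.single C 0).obj A) (hπ : IsIso (π.hom.f 0)) (m : ℕ)
    (hm : 1 ≤ m) (hN : ∀ i : ℤ, m ≤ i → IsZero (N.obj.X i))
    (hA : ∀ i : ℤ, 0 < i → F.IsRightAcyclic (N.obj.X i)) (p : ℤ) (hp : m ≤ p) :
    IsIso ((F.hyperRightDerived p).map π) := by
  obtain ⟨M, j, w, hS, hM, hj⟩ := CochainComplex.Plus.exists_kernel_single π hπ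
  have h1 (q : ℤ) (hq : m ≤ q) : IsZero ((F.hyperRightDerived q).obj M) := by
    -- The kernel occupies the `m - 1` degrees `1, …, m - 1`; the bound is `1 + (m - 1) = m`, where
    -- `1 ≤ m` validates the natural subtraction.
    refine isZero_hyperRightDerived_of_isRightAcyclic (m - 1) (0 + 1) M (fun i hi => ?_)
      (fun i => ?_) q (by lia)
    · have := hj i (by lia)
      exact (hN i (by lia)).of_iso (asIso (j.hom.f i))
    · by_cases h : 0 < i
      · have := hj i h.ne'
        exact (hA i h).of_iso (asIso (j.hom.f i)).symm
      · exact IsRightAcyclic.of_isZero F (M.obj.isZero_of_isStrictlyGE (0 + 1) i (by lia))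
  exact F.isIso_hyperRightDerived_map_g j π w hS p (h1 p hp) (h1 (p + 1) (by lia))

/-- If a complex is a resolution of an object in degrees `< m`, the inclusion of this object is an
isomorphism on hypercohomology in degrees `< m`. -/
theorem isIso_hyperRightDerived_map_fromSingle {N : CochainComplex.Plus C} [N.obj.IsStrictlyGE 0]
    {A : C} (κ : (CochainComplex.Plus.single C 0).obj A ⟶ N) (hκ : Mono (κ.hom.f 0)) (m : ℤ)
    (h0 : 0 < m → QuasiIsoAt κ.hom 0)
    (hN : ∀ i : ℤ, 0 < i → i < m → N.obj.ExactAt i) (p : ℤ) (hp : p < m) :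
    IsIso ((F.hyperRightDerived p).map κ) := by
  have hz (i : ℤ) (hi : i ≠ 0) : IsZero (((CochainComplex.Plus.single C 0).obj A).obj.X i) :=
    HomologicalComplex.isZero_single_obj_X _ _ _ _ hi
  have : Mono κ.hom := by
    refine @HomologicalComplex.mono_of_mono_f _ _ _ _ _ _ _ _ fun i => ?_
    by_cases hi : i = 0
    · subst hi
      infer_instance
    · exact (hz i hi).mono _
  obtain ⟨R, q, w, hS⟩ := CochainComplex.Plus.exists_cokernel κ
  have hd := CochainComplex.Plus.shortExact_degreewise hS
  -- In degree `i ≥ 0` below `m` the map on cohomology induced by `κ` is surjective, and the single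
  -- complex has no cohomology in degree `i + 1 > 0`; the long exact sequence leaves no room for
  -- cohomology of the cokernel.
  have hR : R.obj.IsGE m := by
    rw [CochainComplex.isGE_iff]
    intro i hi
    rcases lt_or_ge i 0 with h | h
    · have h2 : Epi (q.hom.f i) := (hd i).epi_g
      exact ShortComplex.exact_of_isZero_X₂ _
        (@IsZero.of_epi _ _ _ _ _ (q.hom.f i) h2 (N.obj.isZero_of_isStrictlyGE 0 i h))
    · rw [HomologicalComplex.exactAt_iff_isZero_homology]
      have e₂ := hS.homology_exact₂ i
      have e₃ := hS.homology_exact₃ i (i + 1) rfl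
      refine e₃.isZero_X₂ ?_ (IsZero.eq_of_tgt ?_ _ _)
      · have : Epi (HomologicalComplex.homologyMap κ.hom i) := by
          rcases h.eq_or_lt with h | h
          · subst h
            have := (quasiIsoAt_iff_isIso_homologyMap _ 0).1 (h0 hi)
            infer_instance
          · exact ((HomologicalComplex.exactAt_iff_isZero_homology _ _).1 (hN i h hi)).epi _
        refine (cancel_epi (HomologicalComplex.homologyMap κ.hom i)).1 ?_
        refine Eq.trans ?_ comp_zero.symm
        exact (HomologicalComplex.homologyMap_comp _ _ _).symm.trans
          ((congrArg (HomologicalComplex.homologyMap · i) w).trans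
            (HomologicalComplex.homologyMap_zero _ _ _))
      · exact HomologicalComplex.isZero_single_obj_homology _ _ _ _ (by lia)
  have h1 (i : ℤ) (hi : i < m) := F.isZero_hyperRightDerived_of_isGE R m i hi
  obtain ⟨p, rfl⟩ : ∃ p', p = p' + 1 := ⟨p - 1, by lia⟩
  exact F.isIso_hyperRightDerived_map_f κ q w hS p (h1 p (by lia)) (h1 (p + 1) hp)

/-- A morphism that is an isomorphism except in two consecutive degrees, where it is the cokernel
of the differential, is an isomorphism on hypercohomology. -/
theorem isIso_hyperRightDerived_map_of_cokernel {K L : CochainComplex.Plus C} (f : K ⟶ L)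
    (hf : ∀ i : ℤ, i ≠ -1 → i ≠ 0 → IsIso (f.hom.f i)) (hL : IsZero (L.obj.X (-1)))
    (w₀ : K.obj.d (-1) 0 ≫ f.hom.f 0 = 0)
    (h : (ShortComplex.mk (K.obj.d (-1) 0) (f.hom.f 0) w₀).ShortExact) (p : ℤ) :
    IsIso ((F.hyperRightDerived p).map f) := by
  have he := h.epi_g
  have hm := h.mono_f
  dsimp only at he hm
  have : Epi f.hom := by
    refine @HomologicalComplex.epi_of_epi_f _ _ _ _ _ _ _ _ fun i => ?_
    by_cases h1 : i = -1
    · exact h1 ▸ hL.epi _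
    · by_cases h2 : i = 0
      · subst h2
        exact he
      · have := hf i h1 h2
        infer_instance
  obtain ⟨M, j, w, hS⟩ := CochainComplex.Plus.exists_kernel f
  have hd := CochainComplex.Plus.shortExact_degreewise hS
  have hj (i : ℤ) : Mono (j.hom.f i) := (hd i).mono_f
  have hjf (i : ℤ) : j.hom.f i ≫ f.hom.f i = 0 := by
    rw [← HomologicalComplex.comp_f, w, HomologicalComplex.zero_f]
  have hj1 : IsIso (j.hom.f (-1)) := by
    have : Epi (j.hom.f (-1)) := (hd (-1)).exact.epi_f (hL.eq_of_tgt _ _)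
    exact isIso_of_mono_of_epi _
  -- In degree `-1` the kernel `M` is all of `K`; in degree `0` it is the kernel of `f`, which by
  -- `h` is the image of the differential of `K`. Lifting the inclusion `j` through that
  -- differential gives a section of the differential of `M`.
  have hdM : IsIso (M.obj.d (-1) 0) := by
    have hc : j.hom.f (-1) ≫ K.obj.d (-1) 0 = M.obj.d (-1) 0 ≫ j.hom.f 0 := j.hom.comm (-1) 0
    have : Mono (M.obj.d (-1) 0 ≫ j.hom.f 0) := hc ▸ inferInstance
    have : Mono (M.obj.d (-1) 0) := mono_of_mono _ (j.hom.f 0)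
    let s : M.obj.X 0 ⟶ K.obj.X (-1) := h.exact.lift (j.hom.f 0) (hjf 0)
    have hs : s ≫ K.obj.d (-1) 0 = j.hom.f 0 := h.exact.lift_f _ _
    have : (s ≫ CategoryTheory.inv (j.hom.f (-1))) ≫ M.obj.d (-1) 0 = 𝟙 _ := by
      rw [← cancel_mono (j.hom.f 0), Category.assoc, Category.assoc, ← hc, IsIso.inv_hom_id_assoc,
        hs, Category.id_comp]
    have : IsSplitEpi (M.obj.d (-1) 0) := ⟨⟨⟨_, this⟩⟩⟩
    exact isIso_of_mono_of_epi _
  have hM (i : ℤ) : M.obj.ExactAt i := by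
    by_cases h1 : i = -1
    · subst h1
      rw [HomologicalComplex.exactAt_iff' _ (-2) (-1) 0 (by simp) (by simp)]
      refine (ShortComplex.exact_iff_mono _ ?_).2 ?_
      · have h2 := hf (-2) (by simp) (by simp)
        exact IsZero.eq_of_src (IsZero.of_mono_eq_zero (j.hom.f (-2))
          ((cancel_mono (f.hom.f (-2))).1 ((hjf _).trans zero_comp.symm))) _ _
      · exact inferInstanceAs (Mono (M.obj.d (-1) 0))
    · by_cases h2 : i = 0
      · subst h2
        rw [HomologicalComplex.exactAt_iff' _ (-1) 0 1 (by simp) (by simp)]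
        refine (ShortComplex.exact_iff_epi _ ?_).2 ?_
        · have h2 := hf 1 (by simp) (by simp)
          exact IsZero.eq_of_tgt (IsZero.of_mono_eq_zero (j.hom.f 1)
            ((cancel_mono (f.hom.f 1)).1 ((hjf _).trans zero_comp.symm))) _ _
        · exact inferInstanceAs (Epi (M.obj.d (-1) 0))
      · have h3 := hf i h1 h2
        have h4 := hj i
        exact ShortComplex.exact_of_isZero_X₂ _ (@IsZero.of_mono_eq_zero _ _ _ _ _ (j.hom.f i) h4
          ((cancel_mono (f.hom.f i)).1 ((hjf _).trans zero_comp.symm)))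
  have h1 (q : ℤ) : IsZero ((F.hyperRightDerived q).obj M) := by
    have : M.obj.IsGE (q + 1) := by
      rw [CochainComplex.isGE_iff]
      exact fun i _ => hM i
    exact F.isZero_hyperRightDerived_of_isGE M (q + 1) q (by lia)
  exact F.isIso_hyperRightDerived_map_g j f w hS p (h1 p) (h1 (p + 1))

end CategoryTheory.Functor

/-! ### Sections of groupoid sheaves -/

namespace DeligneGroupoid

variable {d : ℕ} {X₀ X₁ : Type u}
  [TopologicalSpace X₀] [ChartedSpace (EuclideanSpace ℝ (Fin d)) X₀]
  [TopologicalSpace X₁] [ChartedSpace (EuclideanSpace ℝ (Fin d)) X₁]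
  {G : SmoothEtaleGroupoid d X₀ X₁}

namespace GSheaf

open Opposite

/-- The group of sections of a `G`-sheaf over an open set. -/
abbrev Sections (F : GSheaf G) (U : EtaleSite G) : Type u := F.obj.obj (op U)

/-- The transport of sections along a local section of arrows. -/
def pull (F : GSheaf G) {U V : EtaleSite G} (σ : U ⟶ V) : F.Sections V →+ F.Sections U :=
  (F.obj.map σ.op).hom

/-- The map induced on sections by a morphism of `G`-sheaves. -/
def mapSections {F F' : GSheaf G} (φ : F ⟶ F') (U : EtaleSite G) : F.Sections U →+ F'.Sections U :=
  (φ.hom.app (op U)).hom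

theorem pull_comp (F : GSheaf G) {U V W : EtaleSite G} (σ : U ⟶ V) (τ : V ⟶ W)
    (a : F.Sections W) : F.pull (σ ≫ τ) a = F.pull σ (F.pull τ a) :=
  ConcreteCategory.congr_hom (F.obj.map_comp τ.op σ.op) a

theorem _root_.DeligneGroupoid.EtaleSite.incl_comp_incl {U V W : EtaleSite G}
    (h : U.carrier ≤ V.carrier) (h' : V.carrier ≤ W.carrier) :
    EtaleSite.incl h ≫ EtaleSite.incl h' = EtaleSite.incl (h.trans h') := by
  ext y
  rw [EtaleSite.incl_comp_toMap]
  rfl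

theorem pull_incl_pull_incl (F : GSheaf G) {U V W : EtaleSite G} (h : U.carrier ≤ V.carrier)
    (h' : V.carrier ≤ W.carrier) (a : F.Sections W) :
    F.pull (EtaleSite.incl h) (F.pull (EtaleSite.incl h') a) =
      F.pull (EtaleSite.incl (h.trans h')) a := by
  rw [← EtaleSite.incl_comp_incl h h', pull_comp]

theorem mapSections_pull {F F' : GSheaf G} (φ : F ⟶ F') {U V : EtaleSite G} (σ : U ⟶ V)
    (a : F.Sections V) : mapSections φ U (F.pull σ a) = F'.pull σ (mapSections φ V a) :=
  ConcreteCategory.congr_hom (φ.hom.naturality σ.op) a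

theorem mapSections_comp {F F' F'' : GSheaf G} (φ : F ⟶ F') (ψ : F' ⟶ F'') {U : EtaleSite G}
    (a : F.Sections U) : mapSections (φ ≫ ψ) U a = mapSections ψ U (mapSections φ U a) := rfl

theorem mapSections_zero (F F' : GSheaf G) {U : EtaleSite G}
    (a : F.Sections U) : mapSections (0 : F ⟶ F') U a = 0 := rfl

/-- A morphism of the site with values in a smaller open set. -/
def _root_.DeligneGroupoid.EtaleSite.Hom.codRestrict {U V : EtaleSite G} (σ : U ⟶ V)
    (W : EtaleSite G) (h : ∀ x, G.tgt (EtaleSite.Hom.toMap σ x) ∈ W.carrier) : U ⟶ W :=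
  ({ toMap := EtaleSite.Hom.toMap σ
     src_eq := EtaleSite.Hom.src_eq σ
     tgt_mem := h } : EtaleSite.Hom U W)

theorem _root_.DeligneGroupoid.EtaleSite.Hom.codRestrict_comp_incl {U V : EtaleSite G} (σ : U ⟶ V)
    {W : EtaleSite G} (h : ∀ x, G.tgt (EtaleSite.Hom.toMap σ x) ∈ W.carrier)
    (hW : W.carrier ≤ V.carrier) :
    EtaleSite.Hom.codRestrict σ W h ≫ EtaleSite.incl hW = σ := by
  ext x
  rw [EtaleSite.comp_incl_toMap]
  rfl

theorem isSheaf_forget (F : GSheaf G) :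
    Presieve.IsSheaf (EtaleSite.topology G) (F.obj ⋙ CategoryTheory.forget AddCommGrpCat.{u}) := by
  rw [← isSheaf_iff_isSheaf_of_type, ← Presheaf.isSheaf_iff_isSheaf_forget]
  exact F.property

theorem generate_mem_topology {ι : Type*} {U : EtaleSite G} (W : ι → EtaleSite G)
    (hW : ∀ i, (W i).carrier ≤ U.carrier) (hcov : ∀ x ∈ U.carrier, ∃ i, x ∈ (W i).carrier) :
    Sieve.generate (Presieve.ofArrows W fun i => EtaleSite.incl (hW i)) ∈
      EtaleSite.topology G U := by
  intro x hx
  obtain ⟨i, hi⟩ := hcov x hx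
  exact ⟨W i, hW i, hi, Sieve.le_generate _ _ _ (Presieve.ofArrows.mk i)⟩

theorem isSheafFor_ofArrows (F : GSheaf G) {ι : Type*} {U : EtaleSite G} (W : ι → EtaleSite G)
    (hW : ∀ i, (W i).carrier ≤ U.carrier) (hcov : ∀ x ∈ U.carrier, ∃ i, x ∈ (W i).carrier) :
    Presieve.IsSheafFor (F.obj ⋙ CategoryTheory.forget AddCommGrpCat.{u})
      (Presieve.ofArrows W fun i => EtaleSite.incl (hW i)) :=
  (Presieve.isSheafFor_iff_generate _).2 (F.isSheaf_forget _ (generate_mem_topology W hW hcov))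

/-- Sections that agree on the members of a cover are equal. -/
theorem sections_ext (F : GSheaf G) {ι : Type*} {U : EtaleSite G} (W : ι → EtaleSite G)
    (hW : ∀ i, (W i).carrier ≤ U.carrier) (hcov : ∀ x ∈ U.carrier, ∃ i, x ∈ (W i).carrier)
    {a b : F.Sections U}
    (h : ∀ i, F.pull (EtaleSite.incl (hW i)) a = F.pull (EtaleSite.incl (hW i)) b) : a = b := by
  refine (F.isSheafFor_ofArrows W hW hcov).isSeparatedFor.ext fun V f hf => ?_
  obtain ⟨i⟩ := hf
  exact h i

theorem sections_ext_of_forall_mem (F : GSheaf G) {U : EtaleSite G} {a b : F.Sections U}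
    (h : ∀ x ∈ U.carrier, ∃ (W : EtaleSite G) (hW : W.carrier ≤ U.carrier), x ∈ W.carrier ∧
      F.pull (EtaleSite.incl hW) a = F.pull (EtaleSite.incl hW) b) : a = b := by
  choose W hW hx hab using h
  exact F.sections_ext (fun x : U.carrier => W x.1 x.2) (fun x => hW x.1 x.2)
    (fun x hx' => ⟨⟨x, hx'⟩, hx x hx'⟩) fun x => hab x.1 x.2

/-- Compatible sections over the members of a cover come from a section. -/
theorem exists_glue (F : GSheaf G) {ι : Type*} {U : EtaleSite G} (W : ι → EtaleSite G)
    (hW : ∀ i, (W i).carrier ≤ U.carrier) (hcov : ∀ x ∈ U.carrier, ∃ i, x ∈ (W i).carrier)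
    (s : ∀ i, F.Sections (W i))
    (hs : ∀ (i j : ι) (V : EtaleSite G) (hi : V.carrier ≤ (W i).carrier)
      (hj : V.carrier ≤ (W j).carrier),
      F.pull (EtaleSite.incl hi) (s i) = F.pull (EtaleSite.incl hj) (s j)) :
    ∃ t : F.Sections U, ∀ i, F.pull (EtaleSite.incl (hW i)) t = s i := by
  obtain ⟨t, ht, -⟩ := (Presieve.isSheafFor_arrows_iff _ _).1 (F.isSheafFor_ofArrows W hW hcov) s
    (by
      intro i j Z gi gj e
      -- Two morphisms that agree after the inclusions are the same family of arrows, and this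
      -- family takes its targets in the intersection of the two open sets. Hence compatibility on
      -- open subsets implies compatibility for all morphisms of the site.
      have hg : ∀ x, EtaleSite.Hom.toMap gi x = EtaleSite.Hom.toMap gj x := fun x => by
        rw [← EtaleSite.comp_incl_toMap gi (hW i), e, EtaleSite.comp_incl_toMap]
      let V : EtaleSite G := ⟨(W i).carrier ⊓ (W j).carrier⟩
      have hVi : V.carrier ≤ (W i).carrier := inf_le_left
      have hVj : V.carrier ≤ (W j).carrier := inf_le_right
      have hm : ∀ x, G.tgt (EtaleSite.Hom.toMap gi x) ∈ V.carrier := fun x =>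
        ⟨EtaleSite.Hom.tgt_mem gi x, by rw [hg]; exact EtaleSite.Hom.tgt_mem gj x⟩
      have e1 := EtaleSite.Hom.codRestrict_comp_incl gi hm hVi
      have e2 : EtaleSite.Hom.codRestrict gi V hm ≫ EtaleSite.incl hVj = gj := by
        ext x
        rw [EtaleSite.comp_incl_toMap]
        exact hg x
      change F.pull gi (s i) = F.pull gj (s j)
      rw [← e1, ← e2, pull_comp, pull_comp, hs i j V hVi hVj])
  exact ⟨t, ht⟩

theorem mapSections_injective {F F' : GSheaf G} (φ : F ⟶ F') [Mono φ] (U : EtaleSite G) :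
    Function.Injective (mapSections φ U) := by
  have h1 : Mono ((sheafToPresheaf _ _).map φ) := inferInstance
  have h2 : Mono (((sheafToPresheaf _ _).map φ).app (op U)) := inferInstance
  exact (AddCommGrpCat.mono_iff_injective _).1 h2

theorem mono_of_injective {F F' : GSheaf G} (φ : F ⟶ F')
    (h : ∀ U, Function.Injective (mapSections φ U)) : Mono φ := by
  have h2 (U) : Mono (((sheafToPresheaf _ _).map φ).app U) :=
    (AddCommGrpCat.mono_iff_injective _).2 (h U.unop)
  have h1 : Mono ((sheafToPresheaf _ _).map φ) := NatTrans.mono_of_mono_app _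
  exact (sheafToPresheaf _ _).mono_of_mono_map h1

/-- Sections of the target of an epimorphism can be lifted locally. -/
theorem exists_local_lift {F F' : GSheaf G} (φ : F ⟶ F') [Epi φ] {U : EtaleSite G}
    (b : F'.Sections U) {x : X₀} (hx : x ∈ U.carrier) :
    ∃ (W : EtaleSite G) (hW : W.carrier ≤ U.carrier), x ∈ W.carrier ∧
      ∃ a : F.Sections W, mapSections φ W a = F'.pull (EtaleSite.incl hW) b := by
  have h1 : Sheaf.IsLocallySurjective φ := (Sheaf.isLocallySurjective_iff_epi' _ φ).2 inferInstance
  obtain ⟨W, hW, hxW, a, ha⟩ := Presheaf.imageSieve_mem (EtaleSite.topology G) φ.hom b x hx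
  exact ⟨W, hW, hxW, a, ha⟩

theorem epi_of_local_lift {F F' : GSheaf G} (φ : F ⟶ F')
    (h : ∀ (U : EtaleSite G) (b : F'.Sections U), ∀ x ∈ U.carrier,
      ∃ (W : EtaleSite G) (hW : W.carrier ≤ U.carrier), x ∈ W.carrier ∧
      ∃ a : F.Sections W, mapSections φ W a = F'.pull (EtaleSite.incl hW) b) : Epi φ := by
  refine (Sheaf.isLocallySurjective_iff_epi' _ φ).1 ⟨fun {U} b x hx => ?_⟩
  obtain ⟨W, hW, hxW, a, ha⟩ := h U b x hx
  exact ⟨W, hW, hxW, a, ha⟩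

/-- Sections are left exact. -/
theorem exists_lift_of_exact {S : ShortComplex (GSheaf G)} (hS : S.Exact) [Mono S.f]
    {U : EtaleSite G} (b : S.X₂.Sections U) (hb : mapSections S.g U b = 0) :
    ∃ a : S.X₁.Sections U, mapSections S.f U a = b := by
  have h1 : (S.map (sheafToPresheaf _ _)).Exact := (hS.map_of_mono_of_preservesKernel
    (sheafToPresheaf (EtaleSite.topology G) AddCommGrpCat.{u}) inferInstance inferInstance)
  have h3 : Mono (S.map (sheafToPresheaf (EtaleSite.topology G) AddCommGrpCat.{u})).f :=
    inferInstanceAs (Mono ((sheafToPresheaf _ _).map S.f))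
  have h2 := h1.map_of_mono_of_preservesKernel ((evaluation _ AddCommGrpCat.{u}).obj (op U)) h3
    inferInstance
  exact (ShortComplex.ab_exact_iff _).1 h2 b hb

/-- Exactness says that the lift of `S.f` to the kernel of `S.g` is an epimorphism, which is a local
condition. As the kernel embeds in `S.X₂` on sections, the lifts may be compared there. -/
theorem exact_of_local_lift {S : ShortComplex (GSheaf G)}
    (h : ∀ (U : EtaleSite G) (b : S.X₂.Sections U), mapSections S.g U b = 0 → ∀ x ∈ U.carrier,
      ∃ (W : EtaleSite G) (hW : W.carrier ≤ U.carrier), x ∈ W.carrier ∧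
      ∃ a : S.X₁.Sections W, mapSections S.f W a = S.X₂.pull (EtaleSite.incl hW) b) : S.Exact := by
  rw [ShortComplex.exact_iff_epi_kernel_lift]
  refine epi_of_local_lift _ fun U b x hx => ?_
  obtain ⟨W, hW, hxW, a, ha⟩ := h U (mapSections (Limits.kernel.ι S.g) U b) (by
    rw [← mapSections_comp, Limits.kernel.condition, mapSections_zero]) x hx
  refine ⟨W, hW, hxW, a, mapSections_injective (Limits.kernel.ι S.g) W ?_⟩
  rw [← mapSections_comp, Limits.kernel.lift_ι, ha, mapSections_pull]

end GSheaf

/-- Taking sections is left exact, and a section whose image under a monomorphism is invariant is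
itself invariant. -/
theorem preservesLeftExact_invariantSections (G : SmoothEtaleGroupoid d X₀ X₁) :
    (invariantSections G).PreservesLeftExact := by
  intro S hS hf
  refine ⟨?_, ?_⟩
  · rw [ShortComplex.ab_exact_iff]
    intro b hb
    obtain ⟨a, ha⟩ := GSheaf.exists_lift_of_exact hS b.1 (congrArg Subtype.val hb)
    refine ⟨⟨a, fun U σ => ?_⟩, Subtype.ext ha⟩
    apply GSheaf.mapSections_injective S.f U
    change GSheaf.mapSections S.f U (S.X₁.pull σ a) =
      GSheaf.mapSections S.f U (S.X₁.pull (EtaleSite.incl _) a)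
    rw [GSheaf.mapSections_pull, GSheaf.mapSections_pull, ha]
    exact b.2 U σ
  · rw [AddCommGrpCat.mono_iff_injective]
    intro a b hab
    exact Subtype.ext (GSheaf.mapSections_injective S.f _ (congrArg Subtype.val hab))

end DeligneGroupoid

/-! ### Germs of arrows and the points of the site -/

namespace DeligneGroupoid

variable {d : ℕ} {X₀ X₁ : Type u}
  [TopologicalSpace X₀] [ChartedSpace (EuclideanSpace ℝ (Fin d)) X₀]
  [TopologicalSpace X₁] [ChartedSpace (EuclideanSpace ℝ (Fin d)) X₁]

namespace SmoothEtaleGroupoid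

variable (G : SmoothEtaleGroupoid d X₀ X₁)

theorem continuous_src : Continuous G.src := G.isLocalDiffeomorph_src.contMDiff.continuous

theorem continuous_tgt : Continuous G.tgt := G.isLocalDiffeomorph_tgt.contMDiff.continuous

theorem isLocallyInjective_src : IsLocallyInjective G.src :=
  G.isLocalDiffeomorph_src.isLocalHomeomorph.isLocallyInjective

theorem mul_left_cancel {g h h' : X₁} (e : G.tgt g = G.src h) (e' : G.tgt g = G.src h')
    (H : G.mul g h e = G.mul g h' e') : h = h' := by
  have key : ∀ (k : X₁) (e : G.tgt g = G.src k),
      k = G.mul (G.inv g) (G.mul g k e) ((G.tgt_inv g).trans (G.src_mul g k e).symm) := by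
    intro k e
    rw [← G.mul_assoc (G.inv g) g k (G.tgt_inv g) e]
    exact (G.one_mul k).symm.trans
      (EtaleSite.mul_congr (G := G) _ ((congrArg G.one e.symm).trans (G.inv_mul g).symm) rfl)
  rw [key h e, key h' e']
  exact EtaleSite.mul_congr (G := G) _ rfl H

end SmoothEtaleGroupoid

variable {G : SmoothEtaleGroupoid d X₀ X₁}

namespace EtaleSite

/-- Local sections of arrows with the same value at a point agree near this point. -/
theorem exists_incl_comp_eq {U V : EtaleSite G} (σ τ : U ⟶ V) (x : U.carrier)
    (h : Hom.toMap σ x = Hom.toMap τ x) :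
    ∃ (W : EtaleSite G) (hW : W.carrier ≤ U.carrier), x.1 ∈ W.carrier ∧
      incl hW ≫ σ = incl hW ≫ τ := by
  have h1 : IsOpen {y : U.carrier | Hom.toMap σ y = Hom.toMap τ y} :=
    G.isLocallyInjective_src.isOpen_eqLocus (Hom.toMap σ).continuous (Hom.toMap τ).continuous
      (funext fun y => (Hom.src_eq σ y).trans (Hom.src_eq τ y).symm)
  refine ⟨⟨⟨Subtype.val '' {y : U.carrier | Hom.toMap σ y = Hom.toMap τ y},
    U.carrier.isOpen.isOpenMap_subtype_val _ h1⟩⟩, ?_, ⟨x, h, rfl⟩, ?_⟩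
  · rintro _ ⟨y, -, rfl⟩
    exact y.2
  · ext ⟨_, y, hy, rfl⟩
    rw [incl_comp_toMap, incl_comp_toMap]
    exact hy

/-- The arrows from a point `x` to the points of an open set. -/
@[ext]
structure ArrowFrom (x : X₀) (U : EtaleSite G) where
  arrow : X₁
  src_eq : G.src arrow = x
  tgt_mem : G.tgt arrow ∈ U.carrier

namespace ArrowFrom

variable {x : X₀}

/-- The target of an arrow as a point of the open set. -/
abbrev target {U : EtaleSite G} (g : ArrowFrom x U) : U.carrier := ⟨G.tgt g.arrow, g.tgt_mem⟩

/-- Composition of an arrow with a local section of arrows. -/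
def map {U V : EtaleSite G} (σ : U ⟶ V) (g : ArrowFrom x U) : ArrowFrom x V where
  arrow := G.mul g.arrow (Hom.toMap σ g.target) (Hom.src_eq σ g.target).symm
  src_eq := (G.src_mul _ _ _).trans g.src_eq
  tgt_mem := by
    rw [G.tgt_mul]
    exact Hom.tgt_mem σ _

theorem map_id {U : EtaleSite G} (g : ArrowFrom x U) : g.map (𝟙 U) = g :=
  ArrowFrom.ext (G.mul_one _)

theorem map_comp {U V W : EtaleSite G} (σ : U ⟶ V) (τ : V ⟶ W) (g : ArrowFrom x U) :
    g.map (σ ≫ τ) = (g.map σ).map τ := by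
  refine ArrowFrom.ext ?_
  refine (G.mul_assoc g.arrow (Hom.toMap σ g.target)
    (Hom.toMap τ (Hom.target σ g.target)) (Hom.src_eq σ g.target).symm
    (Hom.src_eq τ (Hom.target σ g.target)).symm).symm.trans ?_
  exact mul_congr (G := G) _ rfl
    (congrArg (Hom.toMap τ) (Subtype.ext (G.tgt_mul _ _ _).symm))

/-- The unit arrow of a point of an open set. -/
def one {U : EtaleSite G} (hx : x ∈ U.carrier) : ArrowFrom x U :=
  ⟨G.one x, G.src_one x, (G.tgt_one x).symm ▸ hx⟩

theorem map_one_arrow {U V : EtaleSite G} (σ : U ⟶ V) (hx : x ∈ U.carrier) :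
    ((one hx).map σ).arrow = Hom.toMap σ ⟨x, hx⟩ := by
  have h : (one hx : ArrowFrom x U).target = ⟨x, hx⟩ := Subtype.ext (G.tgt_one x)
  exact (mul_congr (G := G) _ (congrArg G.one (Hom.src_eq σ ⟨x, hx⟩).symm)
    (congrArg (Hom.toMap σ) h)).trans (G.one_mul _)

variable [IsManifold (𝓡 d) ∞ X₀] [IsManifold (𝓡 d) ∞ X₁]

/-- Every arrow from `x` comes from the unit arrow by a local section of arrows. -/
theorem exists_map_one_eq {V : EtaleSite G} (g : ArrowFrom x V) :
    ∃ (U : EtaleSite G) (hU : x ∈ U.carrier) (σ : U ⟶ V), (one hU).map σ = g := by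
  obtain ⟨g, rfl, hg⟩ := g
  obtain ⟨U, hU, σ, hσ⟩ := exists_section g hg
  exact ⟨U, hU, σ, ArrowFrom.ext ((map_one_arrow σ hU).trans hσ)⟩

end ArrowFrom

variable (G) in
/-- The functor sending an open set to the set of arrows from `x` to its points. -/
def arrowsFrom (x : X₀) : EtaleSite G ⥤ Type u where
  obj U := ArrowFrom x U
  map σ := TypeCat.ofHom fun g => ArrowFrom.map σ g
  map_id U := by
    ext g
    exact congrArg ArrowFrom.arrow (ArrowFrom.map_id g)
  map_comp σ τ := by
    ext g
    exact congrArg ArrowFrom.arrow (ArrowFrom.map_comp σ τ g)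

variable [IsManifold (𝓡 d) ∞ X₀] [IsManifold (𝓡 d) ∞ X₁]

/-- Every arrow from `x` extends to a local section of arrows, so every element receives a map from
the unit arrow on some neighbourhood of `x`, and neighbourhoods can be intersected. Parallel maps
become equal on a smaller neighbourhood, because sections with the same value at `x` agree near `x`.
-/
instance isCofiltered_elements_arrowsFrom (x : X₀) :
    IsCofiltered (arrowsFrom G x).Elements where
  nonempty := ⟨⟨⟨⊤⟩, ArrowFrom.one (U := (⟨⊤⟩ : EtaleSite G)) trivial⟩⟩
  cone_objs := by
    rintro ⟨V, g⟩ ⟨V', g'⟩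
    obtain ⟨U, hU, σ, hσ⟩ := ArrowFrom.exists_map_one_eq g
    obtain ⟨U', hU', σ', hσ'⟩ := ArrowFrom.exists_map_one_eq g'
    let W : EtaleSite G := ⟨U.carrier ⊓ U'.carrier⟩
    have h1 : W.carrier ≤ U.carrier := inf_le_left
    have h2 : W.carrier ≤ U'.carrier := inf_le_right
    have hW : x ∈ W.carrier := ⟨hU, hU'⟩
    refine ⟨⟨W, ArrowFrom.one hW⟩, ⟨incl h1 ≫ σ, ?_⟩, ⟨incl h2 ≫ σ', ?_⟩, trivial⟩
    · refine ArrowFrom.ext (Eq.trans (ArrowFrom.map_one_arrow (incl h1 ≫ σ) hW) ?_)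
      rw [incl_comp_toMap]
      exact (ArrowFrom.map_one_arrow σ hU).symm.trans (congrArg ArrowFrom.arrow hσ)
    · refine ArrowFrom.ext (Eq.trans (ArrowFrom.map_one_arrow (incl h2 ≫ σ') hW) ?_)
      rw [incl_comp_toMap]
      exact (ArrowFrom.map_one_arrow σ' hU').symm.trans (congrArg ArrowFrom.arrow hσ')
  cone_maps := by
    rintro ⟨V, g⟩ ⟨V', g'⟩ ⟨σ, hσ⟩ ⟨τ, hτ⟩
    obtain ⟨U, hU, ρ, hρ⟩ := ArrowFrom.exists_map_one_eq g
    have h (κ : V ⟶ V') : Hom.toMap (ρ ≫ κ) ⟨x, hU⟩ = (ArrowFrom.map κ g).arrow := by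
      rw [← ArrowFrom.map_one_arrow, ArrowFrom.map_comp, hρ]
    have h' : Hom.toMap (ρ ≫ σ) ⟨x, hU⟩ = Hom.toMap (ρ ≫ τ) ⟨x, hU⟩ :=
      (h σ).trans ((congrArg ArrowFrom.arrow (hσ.trans hτ.symm)).trans (h τ).symm)
    obtain ⟨W, hW, hxW, e⟩ := exists_incl_comp_eq (ρ ≫ σ) (ρ ≫ τ) ⟨x, hU⟩ h'
    refine ⟨⟨W, ArrowFrom.one hxW⟩, ⟨incl hW ≫ ρ, ?_⟩, Subtype.ext ?_⟩
    · refine ArrowFrom.ext (Eq.trans (ArrowFrom.map_one_arrow (incl hW ≫ ρ) hxW) ?_)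
      rw [incl_comp_toMap]
      exact (ArrowFrom.map_one_arrow ρ hU).symm.trans (congrArg ArrowFrom.arrow hρ)
    · change CategoryStruct.comp (CategoryStruct.comp _ _) _ =
        CategoryStruct.comp (CategoryStruct.comp _ _) _
      rw [Category.assoc, Category.assoc]
      exact e

variable (G) in
/-- A point of the space of objects as a point of the site. -/
def point (x : X₀) : (topology G).Point where
  fiber := arrowsFrom G x
  initiallySmall := initiallySmall_of_essentiallySmall _
  jointly_surjective {U} R hR g := by
    obtain ⟨W, hW, hgW, hRW⟩ := hR _ (ArrowFrom.tgt_mem g)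
    exact ⟨W, incl hW, hRW, (⟨ArrowFrom.arrow g, ArrowFrom.src_eq g, hgW⟩ : ArrowFrom x W),
      ArrowFrom.ext (G.mul_one _)⟩

end EtaleSite
end DeligneGroupoid

/-! ### Actions of invariant functions and Godement sheaves -/

namespace DeligneGroupoid

variable {d : ℕ} {X₀ X₁ : Type u}
  [TopologicalSpace X₀] [ChartedSpace (EuclideanSpace ℝ (Fin d)) X₀]
  [TopologicalSpace X₁] [ChartedSpace (EuclideanSpace ℝ (Fin d)) X₁]

/-- The ring of invariant smooth real functions on the space of objects. -/
def invariantFunctions (G : SmoothEtaleGroupoid d X₀ X₁) : Subring (X₀ → ℝ) where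
  carrier := {f | ContMDiff (𝓡 d) 𝓘(ℝ, ℝ) ∞ f ∧ ∀ g, f (G.src g) = f (G.tgt g)}
  mul_mem' hf hg := ⟨hf.1.mul hg.1, fun k => by simp only [Pi.mul_apply, hf.2, hg.2]⟩
  one_mem' := ⟨contMDiff_const, fun _ => rfl⟩
  add_mem' hf hg := ⟨hf.1.add hg.1, fun k => by simp only [Pi.add_apply, hf.2, hg.2]⟩
  zero_mem' := ⟨contMDiff_const, fun _ => rfl⟩
  neg_mem' hf := ⟨hf.1.neg, fun k => by simp only [Pi.neg_apply, hf.2]⟩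

variable {G : SmoothEtaleGroupoid d X₀ X₁}

open GSheaf

/-- An additive action of the invariant smooth functions on a `G`-sheaf, for which a function
annihilates the sections over the open sets where it is zero. -/
structure InvariantAction (F : GSheaf G) where
  act : invariantFunctions G →+ (F ⟶ F)
  act_one : act 1 = 𝟙 F
  act_eq_zero : ∀ (f : invariantFunctions G) (W : EtaleSite G), (∀ x ∈ W.carrier, f.1 x = 0) →
    ∀ a : F.Sections W, mapSections (act f) W a = 0

namespace GSheaf

variable [IsManifold (𝓡 d) ∞ X₀] [IsManifold (𝓡 d) ∞ X₁]

open EtaleSite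

variable (G) in
/-- The functor sending a `G`-sheaf to the skyscraper sheaf of its stalk at `x`. -/
noncomputable def stalkSkyscraper (x : X₀) : GSheaf G ⥤ GSheaf G :=
  (point G x).sheafFiber ⋙ (point G x).skyscraperSheafFunctor

instance (x : X₀) : (point G x).sheafFiber (A := AddCommGrpCat.{u}).Additive :=
  Functor.additive_of_preserves_binary_products _

instance (x : X₀) : ((point G x).skyscraperSheafFunctor (A := AddCommGrpCat.{u})).Additive :=
  Adjunction.right_adjoint_additive (point G x).skyscraperSheafAdjunction

instance (x : X₀) : (stalkSkyscraper G x).Additive := by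
  unfold stalkSkyscraper; infer_instance

/-- The product over all points of the skyscraper sheaves of the stalks. -/
noncomputable def godement (F : GSheaf G) : GSheaf G :=
  ∏ᶜ fun x : X₀ => (stalkSkyscraper G x).obj F

/-- The projections of the Godement sheaf. -/
noncomputable def godementπ (F : GSheaf G) (x : X₀) : godement F ⟶ (stalkSkyscraper G x).obj F :=
  Limits.Pi.π _ x

theorem godement_hom_ext {F F' : GSheaf G} {φ ψ : F' ⟶ godement F}
    (h : ∀ x, CategoryStruct.comp φ (godementπ F x) = CategoryStruct.comp ψ (godementπ F x)) :
    φ = ψ :=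
  Limits.Pi.hom_ext _ _ h

/-- Sections of the Godement sheaf are determined by their projections. -/
theorem godement_sections_ext {F : GSheaf G} {U : EtaleSite G} {a b : (godement F).Sections U}
    (h : ∀ x, mapSections (godementπ F x) U a = mapSections (godementπ F x) U b) : a = b := by
  let E : GSheaf G ⥤ AddCommGrpCat.{u} := sheafToPresheaf _ _ ⋙ (evaluation _ _).obj (Opposite.op U)
  refine Limits.Concrete.isLimit_ext _ (Limits.isLimitOfPreserves E (Limits.limit.isLimit
    (Discrete.functor fun x : X₀ => (stalkSkyscraper G x).obj F))) a b ?_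
  rintro ⟨x⟩
  exact h x

/-- The functoriality of the Godement sheaf. -/
noncomputable def godementMap {F F' : GSheaf G} (φ : F ⟶ F') : godement F ⟶ godement F' :=
  Limits.Pi.map fun x => (stalkSkyscraper G x).map φ

theorem godementMap_π {F F' : GSheaf G} (φ : F ⟶ F') (x : X₀) :
    CategoryStruct.comp (godementMap φ) (godementπ F' x) =
      CategoryStruct.comp (godementπ F x) ((stalkSkyscraper G x).map φ) :=
  Limits.Pi.map_π _ _

/-- A sheaf maps to the skyscraper sheaf of its stalk. -/
noncomputable def toSkyscraper (F : GSheaf G) (x : X₀) : F ⟶ (stalkSkyscraper G x).obj F :=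
  (point G x).skyscraperSheafAdjunction.unit.app F

/-- A sheaf maps to its Godement sheaf. -/
noncomputable def toGodement (F : GSheaf G) : F ⟶ godement F :=
  Limits.Pi.lift fun x => toSkyscraper F x

theorem toGodement_π (F : GSheaf G) (x : X₀) :
    CategoryStruct.comp (toGodement F) (godementπ F x) = toSkyscraper F x :=
  Limits.Pi.lift_π _ _

theorem toGodement_naturality {F F' : GSheaf G} (φ : F ⟶ F') :
    CategoryStruct.comp φ (toGodement F') = CategoryStruct.comp (toGodement F) (godementMap φ) := by
  refine godement_hom_ext fun x => ?_
  rw [Category.assoc, Category.assoc, godementMap_π, toGodement_π, ← Category.assoc, toGodement_π]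
  exact (point G x).skyscraperSheafAdjunction.unit.naturality φ

theorem godementMap_id (F : GSheaf G) : godementMap (𝟙 F) = 𝟙 (godement F) := by
  refine godement_hom_ext fun x => ?_
  rw [godementMap_π, CategoryTheory.Functor.map_id, Category.id_comp]
  exact Category.comp_id _

theorem godementMap_add {F F' : GSheaf G} (φ ψ : F ⟶ F') :
    godementMap (φ + ψ) = godementMap φ + godementMap ψ := by
  refine godement_hom_ext fun x => ?_
  rw [godementMap_π, Functor.map_add, Preadditive.add_comp, godementMap_π, godementMap_π,
    Preadditive.comp_add]

/-- The stalk of a `G`-sheaf. -/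
noncomputable abbrev stalk (F : GSheaf G) (x : X₀) : AddCommGrpCat.{u} :=
  ((point G x).sheafFiber (A := AddCommGrpCat.{u})).obj F

/-- The map induced on stalks. -/
noncomputable def stalkMap {F F' : GSheaf G} (φ : F ⟶ F') (x : X₀) : F.stalk x →+ F'.stalk x :=
  (((point G x).sheafFiber (A := AddCommGrpCat.{u})).map φ).hom

/-- The germ of a section along an arrow. -/
noncomputable def germ (F : GSheaf G) {U : EtaleSite G} {x : X₀} (g : ArrowFrom x U) :
    F.Sections U →+ F.stalk x :=
  ((point G x).toPresheafFiber U g F.obj).hom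

theorem germ_pull (F : GSheaf G) {U V : EtaleSite G} (σ : U ⟶ V) {x : X₀} (g : ArrowFrom x U)
    (a : F.Sections V) : F.germ g (F.pull σ a) = F.germ (g.map σ) a :=
  ConcreteCategory.congr_hom ((point G x).toPresheafFiber_w σ g F.obj) a

theorem stalkMap_germ {F F' : GSheaf G} (φ : F ⟶ F') {U : EtaleSite G} {x : X₀}
    (g : ArrowFrom x U) (a : F.Sections U) :
    stalkMap φ x (F.germ g a) = F'.germ g (mapSections φ U a) :=
  ConcreteCategory.congr_hom ((point G x).toPresheafFiber_naturality φ.hom U g) a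

/-- The germs in a stalk are germs of sections along the unit arrow. -/
theorem exists_germ_one_eq (F : GSheaf G) {x : X₀} (s : F.stalk x) :
    ∃ (U : EtaleSite G) (hx : x ∈ U.carrier) (a : F.Sections U), F.germ (ArrowFrom.one hx) a = s := by
  obtain ⟨V, g, a, rfl⟩ := (point G x).toPresheafFiber_jointly_surjective (P := F.obj) s
  obtain ⟨U, hU, σ, hσ⟩ := ArrowFrom.exists_map_one_eq (G := G) g
  refine ⟨U, hU, F.pull σ a, ?_⟩
  rw [germ_pull, hσ]
  rfl

/-- A section with zero germ at a point is zero near this point. -/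
theorem exists_pull_eq_zero (F : GSheaf G) {U : EtaleSite G} {x : X₀} (hx : x ∈ U.carrier)
    (a : F.Sections U) (ha : F.germ (ArrowFrom.one hx) a = 0) :
    ∃ (W : EtaleSite G) (hW : W.carrier ≤ U.carrier), x ∈ W.carrier ∧
      F.pull (EtaleSite.incl hW) a = 0 := by
  obtain ⟨Y, f, y, hy, h⟩ := ((point G x).toPresheafFiber_eq_iff' (P := F.obj) U
    (ArrowFrom.one hx : ArrowFrom x U) a 0).1 (ha.trans (map_zero (F.germ (ArrowFrom.one hx))).symm)
  obtain ⟨V, hV, τ, hτ⟩ := ArrowFrom.exists_map_one_eq (G := G) y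
  have h1 : (ArrowFrom.one hV).map (τ ≫ f) = ArrowFrom.one hx := by
    rw [ArrowFrom.map_comp, hτ]
    exact hy
  have h2 : Hom.toMap (τ ≫ f) ⟨x, hV⟩ = G.one x := by
    rw [← ArrowFrom.map_one_arrow, h1]
    rfl
  let W : EtaleSite G := ⟨V.carrier ⊓ U.carrier⟩
  have hWV : W.carrier ≤ V.carrier := inf_le_left
  have hWU : W.carrier ≤ U.carrier := inf_le_right
  obtain ⟨Z, hZ, hxZ, e⟩ := exists_incl_comp_eq (incl hWV ≫ τ ≫ f) (incl hWU) ⟨x, hV, hx⟩ (by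
    rw [incl_comp_toMap, h2]
    rfl)
  refine ⟨Z, hZ.trans hWU, hxZ, ?_⟩
  rw [← EtaleSite.incl_comp_incl hZ hWU, ← e, pull_comp, pull_comp, pull_comp]
  have h3 : F.pull f a = 0 := h.trans (map_zero (F.pull f))
  rw [h3, map_zero, map_zero, map_zero]

/-- The components of a section of the skyscraper sheaf. -/
noncomputable def skyscraperπ (F : GSheaf G) (x : X₀) {U : EtaleSite G} (g : ArrowFrom x U) :
    ((stalkSkyscraper G x).obj F).Sections U →+ F.stalk x :=
  (Limits.Pi.π (fun _ : (point G x).fiber.obj U => F.stalk x) g).hom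

theorem skyscraper_sections_ext (F : GSheaf G) (x : X₀) {U : EtaleSite G}
    {a b : ((stalkSkyscraper G x).obj F).Sections U}
    (h : ∀ g : ArrowFrom x U, F.skyscraperπ x g a = F.skyscraperπ x g b) : a = b := by
  refine Limits.Concrete.isLimit_ext _ (Limits.limit.isLimit
    (Discrete.functor fun _ : (point G x).fiber.obj U => F.stalk x)) a b ?_
  rintro ⟨g⟩
  exact h g

theorem skyscraperπ_map {F F' : GSheaf G} (φ : F ⟶ F') (x : X₀) {U : EtaleSite G}
    (g : ArrowFrom x U) (a : ((stalkSkyscraper G x).obj F).Sections U) :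
    F'.skyscraperπ x g (mapSections ((stalkSkyscraper G x).map φ) U a) =
      stalkMap φ x (F.skyscraperπ x g a) :=
  ConcreteCategory.congr_hom (Limits.Pi.map_π
    (fun _ : (point G x).fiber.obj U => ((point G x).sheafFiber (A := AddCommGrpCat.{u})).map φ) g) a

theorem skyscraperπ_unit (F : GSheaf G) (x : X₀) {U : EtaleSite G} (g : ArrowFrom x U)
    (a : F.Sections U) : F.skyscraperπ x g
      (mapSections (toSkyscraper F x) U a) = F.germ g a := by
  have h := (point G x).skyscraperSheafAdjunction_homEquiv_apply_hom
    (𝟙 (F.stalk x) : (point G x).presheafFiber.obj F.obj ⟶ _)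
  have h2 := (point G x).skyscraperPresheafHomEquiv_app_π
    (𝟙 (F.stalk x) : (point G x).presheafFiber.obj F.obj ⟶ _) U g
  have h0 := (point G x).skyscraperSheafAdjunction.homEquiv_id F
  have h3 := (congrArg (fun τ => τ.hom.app (Opposite.op U)) h0.symm).trans
    (congrArg (fun τ => τ.app (Opposite.op U)) h)
  have h4 := ConcreteCategory.congr_hom ((congrArg (fun τ => CategoryStruct.comp τ
    (Limits.Pi.π (fun _ : (point G x).fiber.obj U => F.stalk x) g)) h3).trans h2) a
  refine Eq.trans h4 ?_
  exact ConcreteCategory.congr_hom (Category.comp_id ((point G x).toPresheafFiber U g F.obj)) a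

/-- A section whose germs along all unit arrows vanish is zero near every point. -/
theorem toGodement_injective (F : GSheaf G) (U : EtaleSite G) :
    Function.Injective (mapSections (toGodement F) U) := by
  rw [injective_iff_map_eq_zero]
  intro a ha
  refine F.sections_ext_of_forall_mem fun x hx => ?_
  have h1 : mapSections (toSkyscraper F x) U a = 0 := by
    rw [← toGodement_π, mapSections_comp, ha, map_zero]
  obtain ⟨W, hW, hxW, e⟩ := F.exists_pull_eq_zero hx a (by
    rw [← skyscraperπ_unit, h1, map_zero])
  exact ⟨W, hW, hxW, e.trans (map_zero _).symm⟩

instance (F : GSheaf G) : Mono (toGodement F) := mono_of_injective _ (toGodement_injective F)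

/-- A divisible abelian group is injective. -/
theorem _root_.AddCommGrpCat.injective_of_forall_exists_nsmul (A : AddCommGrpCat.{u})
    (h : ∀ (m : ℕ) (a : A), m ≠ 0 → ∃ b : A, m • b = a) : Injective A := by
  have hd : ∀ {m : ℤ} (_ : m ≠ 0), Function.Surjective fun a : A => m • a := by
    intro m hm a
    obtain ⟨b, hb⟩ := h m.natAbs a (Int.natAbs_ne_zero.2 hm)
    rcases Int.natAbs_eq m with e | e
    · exact ⟨b, by
        beta_reduce
        rw [e, natCast_zsmul]
        exact hb⟩
    · exact ⟨-b, by
        beta_reduce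
        rw [e, neg_smul, smul_neg, neg_neg, natCast_zsmul]
        exact hb⟩
  let _ : DivisibleBy A ℤ := divisibleByOfSMulRightSurj A ℤ hd
  exact AddCommGrpCat.injective_of_divisible A

/-- The invariant function with constant value `c`. -/
def _root_.DeligneGroupoid.invariantFunctions.const (c : ℝ) : invariantFunctions G :=
  ⟨fun _ => c, contMDiff_const, fun _ => rfl⟩

end GSheaf

namespace InvariantAction

open EtaleSite

variable {F : GSheaf G}

/-- The constant 1/m inverts `m` on the sheaf. This serves twice: for the divisibility of the stalks
and for averaging over finitely many arrows. -/
theorem nsmul_act_const (ρ : InvariantAction F) {m : ℕ} (hm : m ≠ 0) :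
    m • ρ.act (invariantFunctions.const (m : ℝ)⁻¹) = 𝟙 F := by
  rw [← map_nsmul, ← ρ.act_one]
  congr 1
  ext x
  have : (m : ℝ) ≠ 0 := Nat.cast_ne_zero.2 hm
  simp [invariantFunctions.const, this]

theorem pull_act (ρ : InvariantAction F) (f : invariantFunctions G) {U V : EtaleSite G}
    (σ : U ⟶ V) (a : F.Sections V) :
    F.pull σ (mapSections (ρ.act f) V a) = mapSections (ρ.act f) U (F.pull σ a) :=
  (mapSections_pull _ _ _).symm

variable [IsManifold (𝓡 d) ∞ X₀] [IsManifold (𝓡 d) ∞ X₁]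

theorem injective_stalk (ρ : InvariantAction F) (x : X₀) : Injective (F.stalk x) := by
  refine AddCommGrpCat.injective_of_forall_exists_nsmul _ fun m a hm => ?_
  refine ⟨stalkMap (ρ.act (invariantFunctions.const (m : ℝ)⁻¹)) x a, ?_⟩
  have h := congrArg ((point G x).sheafFiber (A := AddCommGrpCat.{u})).map (ρ.nsmul_act_const hm)
  rw [Functor.map_nsmul, CategoryTheory.Functor.map_id] at h
  exact ConcreteCategory.congr_hom h a

/-- The stalks are divisible, hence injective groups. The skyscraper functor is right adjoint to the
exact stalk functor, so it preserves injectives, and so do products. Thus `toGodement` embeds the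
sheaf in an injective one without losing the action. -/
theorem injective_godement (ρ : InvariantAction F) : Injective (godement F) := by
  have h (x : X₀) : Injective ((stalkSkyscraper G x).obj F) :=
    haveI := ρ.injective_stalk x
    Adjunction.map_injective (point G x).skyscraperSheafAdjunction _ inferInstance
  unfold godement
  infer_instance

/-- The induced action on the Godement sheaf. -/
noncomputable def godement (ρ : InvariantAction F) : InvariantAction (godement F) where
  act := AddMonoidHom.mk' (fun f => godementMap (ρ.act f)) fun f g => by
    rw [map_add, godementMap_add]
  act_one := by
    rw [AddMonoidHom.mk'_apply, ρ.act_one, godementMap_id]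
  act_eq_zero f W hf a := by
    refine godement_sections_ext fun x => ?_
    rw [map_zero, AddMonoidHom.mk'_apply, ← mapSections_comp, godementMap_π, mapSections_comp]
    refine skyscraper_sections_ext _ _ fun g => ?_
    rw [map_zero, skyscraperπ_map]
    obtain ⟨U, hU, b, hb⟩ := exists_germ_one_eq F
      (F.skyscraperπ x g (mapSections (godementπ F x) W a))
    obtain ⟨V, hV, σ, hσ⟩ := ArrowFrom.exists_map_one_eq g
    let Z : EtaleSite G := ⟨U.carrier ⊓ V.carrier⟩
    have hZU : Z.carrier ≤ U.carrier := inf_le_left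
    have hZV : Z.carrier ≤ V.carrier := inf_le_right
    have hxZ : x ∈ Z.carrier := ⟨hU, hV⟩
    have hone : (ArrowFrom.one hxZ).map (incl hZU) = ArrowFrom.one hU := by
      refine ArrowFrom.ext ?_
      rw [ArrowFrom.map_one_arrow]
      rfl
    rw [← hb, ← hone, ← germ_pull, stalkMap_germ, ρ.act_eq_zero f Z, map_zero]
    intro y hy
    -- The stalk components of a section over `W` are indexed by arrows from `x` into `W`, while `f`
    -- is only known to vanish on `W`. Points of `Z` are sources of arrows ending in `W`, so
    -- invariance of `f` makes it vanish on `Z` too.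
    have h1 : f.1 y = f.1 (G.tgt (Hom.toMap σ ⟨y, hZV hy⟩)) :=
      (congrArg f.1 (Hom.src_eq σ ⟨y, hZV hy⟩)).symm.trans (f.2.2 _)
    rw [h1]
    exact hf _ (Hom.tgt_mem σ _)

theorem toGodement_act (ρ : InvariantAction F) (f : invariantFunctions G) :
    CategoryStruct.comp (ρ.act f) (toGodement F) =
      CategoryStruct.comp (toGodement F) (ρ.godement.act f) :=
  toGodement_naturality _

/-- The induced action on a cokernel. -/
noncomputable def ofEpi {F F' : GSheaf G} (ρ : InvariantAction F) (π : F ⟶ F') [Epi π]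
    (act : invariantFunctions G → (F' ⟶ F'))
    (h : ∀ f, CategoryStruct.comp π (act f) = CategoryStruct.comp (ρ.act f) π) :
    InvariantAction F' where
  act := AddMonoidHom.mk' act fun f g => by
    rw [← cancel_epi π, h, map_add, Preadditive.add_comp, Preadditive.comp_add, h, h]
  act_one := by
    rw [AddMonoidHom.mk'_apply, ← cancel_epi π, h, ρ.act_one]
    exact (Category.id_comp π).trans (Category.comp_id π).symm
  act_eq_zero f W hf b := by
    refine sections_ext_of_forall_mem _ fun x hx => ?_
    obtain ⟨V, hV, hxV, a, ha⟩ := exists_local_lift π b hx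
    refine ⟨V, hV, hxV, ?_⟩
    rw [map_zero, AddMonoidHom.mk'_apply, ← mapSections_pull, ← ha, ← mapSections_comp, h,
      mapSections_comp, ρ.act_eq_zero f V (fun y hy => hf y (hV hy)), map_zero]

/-- The induced action on the cokernel of the embedding in the Godement sheaf. -/
noncomputable def cokernel (ρ : InvariantAction F) :
    InvariantAction (Limits.cokernel (toGodement F)) :=
  ρ.godement.ofEpi (Limits.cokernel.π (toGodement F))
    (fun f => Limits.cokernel.map _ _ (ρ.act f) (ρ.godement.act f) (ρ.toGodement_act f).symm)
    fun _ => Limits.cokernel.π_desc _ _ _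

theorem cokernel_act (ρ : InvariantAction F) (f : invariantFunctions G) :
    CategoryStruct.comp (Limits.cokernel.π (toGodement F)) (ρ.cokernel.act f) =
      CategoryStruct.comp (ρ.godement.act f) (Limits.cokernel.π (toGodement F)) :=
  Limits.cokernel.π_desc _ _ _

end InvariantAction

end DeligneGroupoid

/-! ### Local structure of proper groupoids -/

namespace DeligneGroupoid

variable {d : ℕ} {X₀ X₁ : Type u}
  [TopologicalSpace X₀] [ChartedSpace (EuclideanSpace ℝ (Fin d)) X₀]
  [TopologicalSpace X₁] [ChartedSpace (EuclideanSpace ℝ (Fin d)) X₁]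
  {G : SmoothEtaleGroupoid d X₀ X₁}

namespace EtaleSite

/-- The range is the set of arrows `g` over `U` that equal the value of `σ` at `G.src g`. Both sides
are lifts of the same map through the locally injective source map, so the locus of equality is
open. -/
theorem isOpen_range_toMap {U V : EtaleSite G} (σ : U ⟶ V) : IsOpen (Set.range (Hom.toMap σ)) := by
  have h : IsOpen {g : X₁ | G.src g ∈ U.carrier} := U.carrier.isOpen.preimage G.continuous_src
  have h1 : IsOpen {g : {g : X₁ | G.src g ∈ U.carrier} | Hom.toMap σ ⟨G.src g.1, g.2⟩ = g.1} :=
    G.isLocallyInjective_src.isOpen_eqLocus ((Hom.toMap σ).continuous.comp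
      ((G.continuous_src.comp continuous_subtype_val).subtype_mk _)) continuous_subtype_val
      (funext fun g => Hom.src_eq σ _)
  convert! h.isOpenMap_subtype_val _ h1 using 1
  ext g
  constructor
  · rintro ⟨x, rfl⟩
    refine ⟨⟨Hom.toMap σ x, ?_⟩, ?_, rfl⟩
    · change G.src _ ∈ U.carrier
      rw [Hom.src_eq σ]
      exact x.2
    · exact congrArg (Hom.toMap σ) (Subtype.ext (Hom.src_eq σ x))
  · rintro ⟨⟨g, hg⟩, h, rfl⟩
    exact ⟨_, h⟩

/-- The set is compact by properness and discrete because the source map is locally injective and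
constant on it. -/
theorem finite_arrows (hG : G.IsProper) {K : Set X₀} (hK : IsCompact K) (y : X₀) :
    {g : X₁ | G.src g = y ∧ G.tgt g ∈ K}.Finite := by
  set S := {g : X₁ | G.src g = y ∧ G.tgt g ∈ K} with hS
  have hc : IsCompact S := by
    have := hG.isCompact_preimage ((isCompact_singleton (x := y)).prod hK)
    exact this
  have hloc : ∀ g : X₁, ∃ O : Set X₁, IsOpen O ∧ g ∈ O ∧ Set.InjOn G.src O := fun g => by
    obtain ⟨O, h1, h2, h3⟩ := (isLocallyInjective_iff_nhds.1 G.isLocallyInjective_src g) |>.imp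
      fun O h => (⟨h.1, h.2, trivial⟩ : O ∈ 𝓝 g ∧ Set.InjOn G.src O ∧ True)
    obtain ⟨O', hO', h4, h5⟩ := mem_nhds_iff.1 h1
    exact ⟨O', h4, h5, h2.mono hO'⟩
  choose O hO hgO hinj using hloc
  obtain ⟨t, ht⟩ := hc.elim_finite_subcover O hO fun g _ => Set.mem_iUnion.2 ⟨g, hgO g⟩
  refine (Set.Finite.biUnion t.finite_toSet (t := fun g => O g ∩ S) fun g _ => ?_).subset ?_
  · exact Set.Subsingleton.finite fun a ha b hb =>
      hinj g ha.1 hb.1 (ha.2.1.trans hb.2.1.symm)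
  · intro a ha
    obtain ⟨g, hg, hag⟩ := Set.mem_iUnion₂.1 (ht ha)
    exact Set.mem_iUnion₂.2 ⟨g, hg, hag, ha⟩

variable [IsManifold (𝓡 d) ∞ X₀] [IsManifold (𝓡 d) ∞ X₁] [T2Space X₀] [T2Space X₁]

/-- For a proper groupoid, the arrows from points near `y` to a compact set are among the values
of finitely many disjoint local sections. -/
theorem exists_sections_of_isCompact (hG : G.IsProper) {K : Set X₀} (hK : IsCompact K) (y : X₀) :
    ∃ (V : EtaleSite G) (hy : y ∈ V.carrier) (ι : Type u) (_ : Fintype ι)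
      (σ : ι → (V ⟶ EtaleSite.total G)),
      (∀ z, Function.Injective fun i => Hom.toMap (σ i) z) ∧
      (∀ i, G.tgt (Hom.toMap (σ i) ⟨y, hy⟩) ∈ K) ∧
      ∀ z : V.carrier, ∀ g, G.src g = z → G.tgt g ∈ K → ∃ i, Hom.toMap (σ i) z = g := by
  let S := {g : X₁ | G.src g = y ∧ G.tgt g ∈ K}
  have hfin : S.Finite := finite_arrows hG hK y
  have hsec : ∀ g : S, ∃ (U : EtaleSite G) (hU : y ∈ U.carrier) (σ : U ⟶ EtaleSite.total G),
      Hom.toMap σ ⟨y, hU⟩ = g.1 := by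
    rintro ⟨g, rfl, hg⟩
    exact exists_section g (V := EtaleSite.total G) trivial
  choose U hU σ hσ using hsec
  have : Finite S := hfin
  let V₀ : EtaleSite G := ⟨⟨⋂ g, (U g).carrier, isOpen_iInter_of_finite fun g => (U g).carrier.isOpen⟩⟩
  have hV₀ : ∀ g, V₀.carrier ≤ (U g).carrier := fun g x hx => Set.mem_iInter.1 hx g
  have hyV₀ : y ∈ V₀.carrier := Set.mem_iInter.2 hU
  let σ₀ : S → (V₀ ⟶ EtaleSite.total G) := fun g => incl (hV₀ g) ≫ σ g
  have hσ₀ : ∀ g, Hom.toMap (σ₀ g) ⟨y, hyV₀⟩ = g.1 := fun g =>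
    (incl_comp_toMap _ _ _).trans (hσ g)
  -- the sections are disjoint near `y`
  have hdis : ∀ᶠ z in 𝓝 (⟨y, hyV₀⟩ : V₀.carrier), ∀ p : S × S, p.1 ≠ p.2 →
      Hom.toMap (σ₀ p.1) z ≠ Hom.toMap (σ₀ p.2) z := by
    rw [eventually_all]
    intro p
    by_cases hp : p.1 = p.2
    · exact Eventually.of_forall fun _ h => absurd hp h
    · have h1 : Hom.toMap (σ₀ p.1) ⟨y, hyV₀⟩ ≠ Hom.toMap (σ₀ p.2) ⟨y, hyV₀⟩ := by
        rw [hσ₀, hσ₀]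
        exact fun h => hp (Subtype.ext h)
      filter_upwards [(isOpen_ne_fun (Hom.toMap (σ₀ p.1)).continuous
        (Hom.toMap (σ₀ p.2)).continuous).mem_nhds h1] with z hz _ using hz
  -- arrows from points near `y` to `K` are values of the sections
  let O : Set X₁ := ⋃ g, Set.range (Hom.toMap (σ₀ g))
  have hO : IsOpen O := isOpen_iUnion fun g => isOpen_range_toMap _
  -- A proper map is closed, so the pairs (source, target) of arrows into `K` missed by the sections
  -- form a closed set. It does not meet `{y} ×ˢ K`, and the tube lemma yields a neighbourhood of
  -- `y` from which no arrow into `K` is missed.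
  have hD : IsClosed ((fun g => (G.src g, G.tgt g)) '' (G.tgt ⁻¹' K ∩ Oᶜ)) :=
    hG.isClosedMap _ ((hK.isClosed.preimage G.continuous_tgt).inter hO.isClosed_compl)
  obtain ⟨u, v, hu, -, hyu, hKv, huv⟩ := generalized_tube_lemma (isCompact_singleton (x := y)) hK
    hD.isOpen_compl (by
      rintro ⟨a, b⟩ ⟨ha, hb⟩ ⟨g, ⟨-, hgO⟩, hg⟩
      obtain ⟨rfl, rfl⟩ := Prod.mk.inj hg
      have hgS : g ∈ S := ⟨ha, hb⟩
      exact hgO (Set.mem_iUnion.2 ⟨⟨g, hgS⟩, ⟨y, hyV₀⟩, hσ₀ ⟨g, hgS⟩⟩))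
  have hyu : y ∈ u := hyu rfl
  rw [nhds_subtype_eq_comap, eventually_comap] at hdis
  obtain ⟨w, hw, hwo, hyw⟩ := eventually_nhds_iff.1 hdis
  let V : EtaleSite G := ⟨⟨(V₀.carrier : Set X₀) ∩ (w ∩ u),
    V₀.carrier.isOpen.inter (hwo.inter hu)⟩⟩
  have hV : V.carrier ≤ V₀.carrier := fun z hz => hz.1
  refine ⟨V, ⟨hyV₀, hyw, hyu⟩, S, Fintype.ofFinite S, fun g => incl hV ≫ σ₀ g, ?_, ?_, ?_⟩
  · intro z g g' h
    by_contra hne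
    replace h := (incl_comp_toMap hV (σ₀ g) z).symm.trans (h.trans (incl_comp_toMap hV (σ₀ g') z))
    exact hw z z.2.2.1 ⟨z, hV z.2⟩ rfl (g, g') hne h
  · intro g
    rw [incl_comp_toMap, hσ₀]
    exact g.2.2
  · intro z g hgz hgK
    have hgO : g ∈ O := by
      by_contra hgO
      refine huv (Set.mk_mem_prod (?_ : G.src g ∈ u) (hKv hgK)) ⟨g, ⟨hgK, hgO⟩, rfl⟩
      rw [hgz]
      exact z.2.2.2
    obtain ⟨i, ⟨z', hz'⟩⟩ := Set.mem_iUnion.1 hgO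
    refine ⟨i, ?_⟩
    rw [incl_comp_toMap, ← hz']
    congr 1
    apply Subtype.ext
    rw [← Hom.src_eq (σ₀ i) z', hz', hgz]

/-- For a proper groupoid, each point has arbitrarily small open neighbourhoods such that the
arrows between points of the neighbourhood are the values of finitely many disjoint sections. -/
theorem exists_slice (hG : G.IsProper) {O : Set X₀} (hO : IsOpen O) {x : X₀} (hx : x ∈ O) :
    ∃ (U : EtaleSite G), x ∈ U.carrier ∧ (U.carrier : Set X₀) ⊆ O ∧
      ∃ (ι : Type u) (_ : Fintype ι) (σ : ι → (U ⟶ U)),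
      (∀ z, Function.Injective fun i => Hom.toMap (σ i) z) ∧
      ∀ z : U.carrier, ∀ g, G.src g = z → G.tgt g ∈ U.carrier → ∃ i, Hom.toMap (σ i) z = g := by
  have : LocallyCompactSpace X₀ := ChartedSpace.locallyCompactSpace (EuclideanSpace ℝ (Fin d)) X₀
  obtain ⟨K₀, hK₀, hxK₀, hK₀O⟩ := exists_compact_subset hO hx
  -- The finitely many other points of the orbit of `x` in `K₀`. Once `K` avoids them, every arrow
  -- from `x` to `K` ends at `x`, and the sections found below come from isotropy arrows.
  let T : Set X₀ := (G.tgt '' {g : X₁ | G.src g = x ∧ G.tgt g ∈ K₀}) \ {x}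
  have hT : T.Finite := ((finite_arrows hG hK₀ x).image _).subset Set.sdiff_subset
  obtain ⟨K, hK, hxK, hKT⟩ := exists_compact_subset
    (isOpen_interior.inter hT.isClosed.isOpen_compl : IsOpen (interior K₀ ∩ Tᶜ))
    (⟨hxK₀, fun h => h.2 rfl⟩ : x ∈ interior K₀ ∩ Tᶜ)
  obtain ⟨V, hxV, ι, _, σ, hinj, hσK, hall⟩ := exists_sections_of_isCompact hG hK x
  have hσx : ∀ i, G.tgt (Hom.toMap (σ i) ⟨x, hxV⟩) = x := by
    intro i
    by_contra hne
    exact (hKT (hσK i)).2 ⟨⟨_, ⟨Hom.src_eq (σ i) _, interior_subset (hKT (hσK i)).1⟩, rfl⟩, hne⟩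
  -- the points of an open set that are mapped to it by all sections
  have hstep : ∀ W : Set X₀, IsOpen W → x ∈ W → ∃ W' : EtaleSite G, x ∈ W'.carrier ∧
      ∀ z, z ∈ W'.carrier ↔ z ∈ W ∧ ∃ h : z ∈ V.carrier, ∀ i, G.tgt (Hom.toMap (σ i) ⟨z, h⟩) ∈ W := by
    intro W hW hxW
    let W₁ : EtaleSite G := ⟨⟨W, hW⟩⟩
    refine ⟨⟨⟨(W ∩ V.carrier) ∩ ⋂ i, (preimage (σ i) W₁).carrier, (hW.inter V.carrier.isOpen).inter
      (isOpen_iInter_of_finite fun i => (preimage (σ i) W₁).carrier.isOpen)⟩⟩, ?_, ?_⟩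
    · refine ⟨⟨hxW, hxV⟩, Set.mem_iInter.2 fun i => ⟨hxV, ?_⟩⟩
      rw [hσx]
      exact hxW
    · intro z
      constructor
      · rintro ⟨⟨h1, h2⟩, h3⟩
        exact ⟨h1, h2, fun i => (Set.mem_iInter.1 h3 i).2⟩
      · rintro ⟨h1, h2, h3⟩
        exact ⟨⟨h1, h2⟩, Set.mem_iInter.2 fun i => ⟨h2, h3 i⟩⟩
  -- Two rounds are needed. Translates of points of `V₁` stay in `K`, so for a point of `U`, whose
  -- translates lie in `V₁`, the product of two sections is again an arrow into `K` and therefore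
  -- one of the sections. Its target then lies in `V₁`, which shows that translates of points of `U`
  -- remain in `U`.
  obtain ⟨V₁, hxV₁, hV₁⟩ := hstep (interior K) isOpen_interior hxK
  obtain ⟨U, hxU, hU⟩ := hstep V₁.carrier V₁.carrier.isOpen hxV₁
  have hUV : U.carrier ≤ V.carrier := fun z hz => ((hU z).1 hz).2.1
  have hUK : (U.carrier : Set X₀) ⊆ K := fun z hz =>
    interior_subset ((hV₁ z).1 ((hU z).1 hz).1).1
  have hmem : ∀ i (z : U.carrier), G.tgt (Hom.toMap (incl hUV ≫ σ i) z) ∈ U.carrier := by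
    intro i z
    rw [incl_comp_toMap]
    have h1 : ∀ j, G.tgt (Hom.toMap (σ j) ⟨z, hUV z.2⟩) ∈ V₁.carrier := ((hU z).1 z.2).2.2
    obtain ⟨-, h2, h3⟩ := (hV₁ _).1 (h1 i)
    refine (hU _).2 ⟨h1 i, h2, fun j => ?_⟩
    obtain ⟨k, hk⟩ := hall ⟨z, hUV z.2⟩ (G.mul (Hom.toMap (σ i) ⟨z, hUV z.2⟩)
      (Hom.toMap (σ j) ⟨_, h2⟩) (Hom.src_eq (σ j) ⟨_, h2⟩).symm) ((G.src_mul _ _ _).trans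
        (Hom.src_eq (σ i) _)) (by
        rw [G.tgt_mul]
        exact interior_subset (h3 j))
    have h4 := h1 k
    rw [hk, G.tgt_mul] at h4
    exact h4
  refine ⟨U, hxU, fun z hz => hK₀O (interior_subset (hKT (hUK hz)).1), ι, inferInstance,
    fun i => Hom.codRestrict (incl hUV ≫ σ i) U (hmem i), ?_, ?_⟩
  · intro z i j h
    refine hinj ⟨z, hUV z.2⟩ ?_
    have h' : Hom.toMap (incl hUV ≫ σ i) z = Hom.toMap (incl hUV ≫ σ j) z := h
    rw [incl_comp_toMap, incl_comp_toMap] at h'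
    exact h'
  · intro z g hgz hgU
    obtain ⟨i, hi⟩ := hall ⟨z, hUV z.2⟩ g hgz (hUK hgU)
    refine ⟨i, ?_⟩
    change Hom.toMap (incl hUV ≫ σ i) z = g
    rw [incl_comp_toMap, hi]

end EtaleSite

end DeligneGroupoid

/-! ### Orbit sums and invariant bump functions -/

namespace DeligneGroupoid

variable {d : ℕ} {X₀ X₁ : Type u}
  [TopologicalSpace X₀] [ChartedSpace (EuclideanSpace ℝ (Fin d)) X₀]
  [TopologicalSpace X₁] [ChartedSpace (EuclideanSpace ℝ (Fin d)) X₁]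
  {G : SmoothEtaleGroupoid d X₀ X₁}

/-- The sum of the values of a function at the targets of the arrows from a point. -/
noncomputable def orbitSum (G : SmoothEtaleGroupoid d X₀ X₁) (χ : X₀ → ℝ) (y : X₀) : ℝ :=
  ∑ᶠ g : {g : X₁ // G.src g = y}, χ (G.tgt g.1)

/-- Composition with an arrow as a bijection between sets of arrows. -/
def arrowsEquiv (G : SmoothEtaleGroupoid d X₀ X₁) (g : X₁) :
    {h : X₁ // G.src h = G.tgt g} ≃ {h : X₁ // G.src h = G.src g} where
  toFun h := ⟨G.mul g h.1 h.2.symm, G.src_mul _ _ _⟩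
  invFun h := ⟨G.mul (G.inv g) h.1 ((G.tgt_inv g).trans h.2.symm),
    (G.src_mul _ _ _).trans (G.src_inv g)⟩
  left_inv := by
    rintro ⟨h, hh⟩
    refine Subtype.ext ?_
    refine (G.mul_assoc (G.inv g) g h (G.tgt_inv g) hh.symm).symm.trans ?_
    exact (EtaleSite.mul_congr (G := G) _ ((G.inv_mul g).trans (congrArg G.one hh.symm)) rfl).trans
      (G.one_mul h)
  right_inv := by
    rintro ⟨h, hh⟩
    refine Subtype.ext ?_
    refine (G.mul_assoc g (G.inv g) h (G.src_inv g).symm ((G.tgt_inv g).trans hh.symm)).symm.trans ?_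
    exact (EtaleSite.mul_congr (G := G) _ ((G.mul_inv g).trans (congrArg G.one hh.symm)) rfl).trans
      (G.one_mul h)

theorem orbitSum_src_eq_tgt (χ : X₀ → ℝ) (g : X₁) :
    orbitSum G χ (G.src g) = orbitSum G χ (G.tgt g) := by
  refine (finsum_eq_of_bijective (arrowsEquiv G g) (arrowsEquiv G g).bijective fun h => ?_).symm
  exact congrArg χ (G.tgt_mul _ _ _).symm

namespace EtaleSite

open SmoothEtaleGroupoid

/-- Only arrows ending in `K` contribute, and they occur, once each, among the values of the
sections. The formula exhibits the orbit sum as a sum over an index set that does not depend on the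
point. -/
theorem orbitSum_eq_sum {χ : X₀ → ℝ} {K : Set X₀} (hχ : ∀ y, y ∉ K → χ y = 0) {V W : EtaleSite G}
    {ι : Type*} [Fintype ι] (σ : ι → (V ⟶ W)) (z : V.carrier)
    (hinj : Function.Injective fun i => Hom.toMap (σ i) z)
    (hall : ∀ g, G.src g = z → G.tgt g ∈ K → ∃ i, Hom.toMap (σ i) z = g) :
    orbitSum G χ z = ∑ i, χ (G.tgt (Hom.toMap (σ i) z)) := by
  classical
  let e : ι → {g : X₁ // G.src g = z} := fun i => ⟨Hom.toMap (σ i) z, Hom.src_eq (σ i) z⟩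
  have he : Function.Injective e := fun i j h => hinj (congrArg Subtype.val h)
  rw [orbitSum, finsum_eq_sum_of_support_subset (s := Finset.univ.map ⟨e, he⟩), Finset.sum_map]
  · rfl
  · rintro ⟨g, hg⟩ hne
    have hK : G.tgt g ∈ K := by
      by_contra h
      exact hne (hχ _ h)
    obtain ⟨i, hi⟩ := hall g hg hK
    simp only [Finset.coe_map, Function.Embedding.coeFn_mk, Finset.coe_univ, Set.image_univ]
    exact ⟨i, Subtype.ext hi⟩

variable [IsManifold (𝓡 d) ∞ X₀] [IsManifold (𝓡 d) ∞ X₁] [T2Space X₀] [T2Space X₁]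

/-- Near each point the orbit sum is a fixed finite sum of composites of `χ` with the smooth target
maps of local sections. -/
theorem contMDiff_orbitSum (hG : G.IsProper) {χ : X₀ → ℝ} (hχ : ContMDiff (𝓡 d) 𝓘(ℝ, ℝ) ∞ χ)
    {K : Set X₀} (hK : IsCompact K) (hχK : ∀ y, y ∉ K → χ y = 0) :
    ContMDiff (𝓡 d) 𝓘(ℝ, ℝ) ∞ (orbitSum G χ) := by
  intro y
  obtain ⟨V, hy, ι, _, σ, hinj, -, hall⟩ := exists_sections_of_isCompact hG hK y
  choose τ hτ hτσ using fun i => exists_local_target (σ i) ⟨y, hy⟩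
  have h : orbitSum G χ =ᶠ[𝓝 y] fun z => ∑ i, χ (τ i z) := by
    filter_upwards [V.carrier.isOpen.mem_nhds hy, eventually_all.2 hτσ] with z hz h
    rw [orbitSum_eq_sum hχK σ ⟨z, hz⟩ (hinj _) (hall _)]
    exact Finset.sum_congr rfl fun i _ => congrArg χ (h i hz).1
  refine ContMDiffAt.congr_of_eventuallyEq ?_ h
  exact ContMDiffAt.sum fun i _ => (hχ (τ i y)).comp y (hτ i)

/-- The points that are joined to a point of a compact set form a closed set. -/
theorem isClosed_saturation (hG : G.IsProper) {K : Set X₀} (hK : IsCompact K) :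
    IsClosed {y | ∃ g, G.src g = y ∧ G.tgt g ∈ K} := by
  rw [← isOpen_compl_iff, isOpen_iff_mem_nhds]
  intro y hy
  obtain ⟨V, hyV, ι, _, σ, -, hσ, hall⟩ := exists_sections_of_isCompact hG hK y
  filter_upwards [V.carrier.isOpen.mem_nhds hyV] with z hz
  rintro ⟨g, hg, hgK⟩
  -- The mere existence of an index is a contradiction: every section of the family has an arrow
  -- from `y` into `K` as its value at `y`.
  obtain ⟨i, -⟩ := hall ⟨z, hz⟩ g hg hgK
  exact hy ⟨_, Hom.src_eq (σ i) ⟨y, hyV⟩, hσ i⟩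

/-- Invariant smooth bump functions. -/
theorem exists_invariant_bump (hG : G.IsProper) {U : Set X₀} {x : X₀} (hU : U ∈ 𝓝 x) :
    ∃ (θ : invariantFunctions G) (C : Set X₀), IsClosed C ∧
      (∀ y ∈ C, ∃ g, G.src g = y ∧ G.tgt g ∈ U) ∧ (∀ y, y ∉ C → θ.1 y = 0) ∧
      ∀ᶠ y in 𝓝 x, θ.1 y = 1 := by
  obtain ⟨f, -, hf⟩ := (SmoothBumpFunction.nhds_basis_tsupport (I := 𝓡 d) x).mem_iff.1 hU
  have hK : IsCompact (tsupport f) := f.hasCompactSupport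
  have hfK : ∀ y, y ∉ tsupport f → f y = 0 := fun y hy => image_eq_zero_of_notMem_tsupport hy
  have hsm := contMDiff_orbitSum hG f.contMDiff hK hfK
  have hone : 1 ≤ orbitSum G f x := by
    obtain ⟨V, hy, ι, _, σ, hinj, -, hall⟩ := exists_sections_of_isCompact hG hK x
    rw [orbitSum_eq_sum hfK σ ⟨x, hy⟩ (hinj _) (hall _)]
    obtain ⟨i, hi⟩ := hall ⟨x, hy⟩ (G.one x) (G.src_one x) (by
      rw [G.tgt_one]
      exact subset_tsupport _ (by simp))
    have h1 : f (G.tgt (Hom.toMap (σ i) ⟨x, hy⟩)) = 1 := by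
      rw [hi, G.tgt_one]
      exact f.eq_one
    rw [← h1]
    exact Finset.single_le_sum (f := fun i => f (G.tgt (Hom.toMap (σ i) ⟨x, hy⟩)))
      (fun j _ => f.nonneg) (Finset.mem_univ i)
  -- The unit arrow makes the orbit sum at least `1` at `x`, hence greater than `1 / 2` nearby;
  -- after doubling, the smooth transition is constantly `1` there, while it is `0` where the orbit
  -- sum is.
  refine ⟨⟨fun y => Real.smoothTransition (2 * orbitSum G f y), ?_, fun g => by
    simp only [orbitSum_src_eq_tgt]⟩, {y | ∃ g, G.src g = y ∧ G.tgt g ∈ tsupport f},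
    isClosed_saturation hG hK, ?_, ?_, ?_⟩
  · have h1 : ContDiff ℝ ∞ fun t : ℝ => Real.smoothTransition (2 * t) :=
      Real.smoothTransition.contDiff.comp (contDiff_const.mul contDiff_id)
    exact h1.contMDiff.comp hsm
  · rintro y ⟨g, hg, hgK⟩
    exact ⟨g, hg, hf hgK⟩
  · intro y hy
    have h0 : orbitSum G f y = 0 := by
      refine finsum_eq_zero_of_forall_eq_zero fun g => hfK _ fun h => hy ⟨g.1, g.2, h⟩
    simp [h0]
  · have h1 : ∀ᶠ y in 𝓝 x, 1 / 2 < orbitSum G f y :=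
      hsm.continuous.continuousAt.eventually_const_lt (lt_of_lt_of_le (by norm_num) hone)
    filter_upwards [h1] with y hy
    exact Real.smoothTransition.one_of_one_le (by linarith)

end EtaleSite

end DeligneGroupoid

/-- The summands θ_k ∏_{j<k} (1 - θ_j) telescope. Where some θ_j equals 1 the product on the right
vanishes, so they sum to 1, and all summands with k > j are zero: a partition of unity needing only
countably many bumps. -/
theorem Finset.one_sub_sum_mul_prod_one_sub
    {R : Type*} [CommRing R] (θ : ℕ → R) (n : ℕ) :
    1 - ∑ k ∈ Finset.range n, θ k * ∏ j ∈ Finset.range k, (1 - θ j) =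
      ∏ j ∈ Finset.range n, (1 - θ j) := by
  induction n with
  | zero => simp
  | succ n ih => rw [Finset.sum_range_succ, Finset.prod_range_succ, ← ih]; ring

/-! ### Lifting invariant sections by averaging and partitions of unity -/

namespace DeligneGroupoid

variable {d : ℕ} {X₀ X₁ : Type u}
  [TopologicalSpace X₀] [ChartedSpace (EuclideanSpace ℝ (Fin d)) X₀]
  [TopologicalSpace X₁] [ChartedSpace (EuclideanSpace ℝ (Fin d)) X₁]
  {G : SmoothEtaleGroupoid d X₀ X₁}

open EtaleSite GSheaf

/-- The inclusion of an open set in the whole space. -/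
def EtaleSite.toTotal (U : EtaleSite G) : U ⟶ total G := incl (fun _ _ => trivial)

theorem EtaleSite.preimageHom_comp_toTotal {V : EtaleSite G} (σ : V ⟶ total G) (W : EtaleSite G) :
    preimageHom σ W ≫ toTotal W = incl (preimage_le σ W) ≫ σ :=
  preimageHom_comp_incl σ _

namespace GSheaf

theorem pull_incl_total (F : GSheaf G) {V : EtaleSite G} (h : V.carrier ≤ (total G).carrier)
    (a : F.Sections (total G)) : F.pull (incl h) a = F.pull (toTotal V) a := rfl

theorem pull_incl_toTotal (F : GSheaf G) {V W : EtaleSite G} (h : V.carrier ≤ W.carrier)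
    (a : F.Sections (total G)) : F.pull (incl h) (F.pull (toTotal W) a) = F.pull (toTotal V) a :=
  F.pull_incl_pull_incl h _ a

/-- A section over an open set is invariant if it is fixed by the arrows between the points of the
open set. -/
def IsInvariant (F : GSheaf G) {U : EtaleSite G} (a : F.Sections U) : Prop :=
  ∀ (V : EtaleSite G) (σ : V ⟶ U) (hV : V.carrier ≤ U.carrier), F.pull σ a = F.pull (incl hV) a

/-- The finite intersection of open neighbourhoods. -/
theorem _root_.DeligneGroupoid.EtaleSite.exists_le_of_finite {ι : Type*} [Finite ι] {U : EtaleSite G} {x : X₀}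
    (hx : x ∈ U.carrier) (W : ι → EtaleSite G) (hW : ∀ i, x ∈ (W i).carrier) :
    ∃ Z : EtaleSite G, x ∈ Z.carrier ∧ Z.carrier ≤ U.carrier ∧ ∀ i, Z.carrier ≤ (W i).carrier :=
  ⟨⟨⟨U.carrier ∩ ⋂ i, (W i).carrier, U.carrier.isOpen.inter
    (isOpen_iInter_of_finite fun i => (W i).carrier.isOpen)⟩⟩, ⟨hx, Set.mem_iInter.2 hW⟩,
    fun _ h => h.1, fun i _ h => Set.mem_iInter.1 h.2 i⟩

/-- The sum of the translates of a section over a slice is invariant. -/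
theorem isInvariant_sum_pull (F : GSheaf G) {U : EtaleSite G} {ι : Type*} [Fintype ι]
    (σ : ι → (U ⟶ U)) (hinj : ∀ z, Function.Injective fun i => Hom.toMap (σ i) z)
    (hall : ∀ z : U.carrier, ∀ g, G.src g = z → G.tgt g ∈ U.carrier →
      ∃ i, Hom.toMap (σ i) z = g) (a : F.Sections U) :
    F.IsInvariant (∑ i, F.pull (σ i) a) := by
  intro V τ hV
  refine F.sections_ext_of_forall_mem fun y hy => ?_
  -- Composition with the arrow of `τ` at `y` maps the arrows of the slice at the target to those at
  -- `y`; `k` is the resulting permutation of the indices. The equalities at `y` hold near `y`, and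
  -- the sums agree after reindexing.
  choose k hk using fun i => hall ⟨y, hV hy⟩ (Hom.toMap (τ ≫ σ i) ⟨y, hy⟩)
    (Hom.src_eq (τ ≫ σ i) _) (Hom.tgt_mem (τ ≫ σ i) _)
  have hki : Function.Injective k := by
    intro i j hij
    have h1 : Hom.toMap (τ ≫ σ i) ⟨y, hy⟩ = Hom.toMap (τ ≫ σ j) ⟨y, hy⟩ := by
      rw [← hk i, ← hk j, hij]
    exact hinj (Hom.target τ ⟨y, hy⟩) (G.mul_left_cancel (Hom.src_eq (σ i) (Hom.target τ ⟨y, hy⟩)).symm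
      (Hom.src_eq (σ j) (Hom.target τ ⟨y, hy⟩)).symm h1)
  have hloc : ∀ i, ∃ (W : EtaleSite G) (hW : W.carrier ≤ V.carrier), y ∈ W.carrier ∧
      incl hW ≫ incl hV ≫ σ (k i) = incl hW ≫ τ ≫ σ i := fun i =>
    exists_incl_comp_eq (incl hV ≫ σ (k i)) (τ ≫ σ i) ⟨y, hy⟩ (by
      rw [incl_comp_toMap]
      exact hk i)
  choose W hW hyW he using hloc
  obtain ⟨Z, hyZ, hZ, hZW⟩ := exists_le_of_finite hy W hyW
  refine ⟨Z, hZ, hyZ, ?_⟩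
  simp only [map_sum]
  refine Fintype.sum_bijective k (Finite.injective_iff_bijective.1 hki) _ _ fun i => ?_
  rw [← incl_comp_incl (hZW i) (hW i)]
  simp only [← pull_comp]
  simp only [pull_comp]
  have h2 := congrArg (fun κ => F.pull κ a) (he i)
  simp only [pull_comp] at h2
  rw [h2]

/-- Two local sections with values in an open set transport an invariant section in the same
way. -/
theorem IsInvariant.pull_eq_pull [IsManifold (𝓡 d) ∞ X₀] [IsManifold (𝓡 d) ∞ X₁]
    {F : GSheaf G} {U : EtaleSite G} {a : F.Sections U}
    (ha : F.IsInvariant a) {Z : EtaleSite G} (κ κ' : Z ⟶ U) : F.pull κ a = F.pull κ' a := by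
  refine F.sections_ext_of_forall_mem fun z hz => ?_
  -- The section `ν` is a local inverse of `κ`. The composite of `ν` and `κ'` consists of arrows
  -- between points of `U`, so the invariance of `a` applies to it, and precomposing with `κ` gives
  -- the claim.
  obtain ⟨V, hV, ν, hν⟩ := exists_section (G := G) (G.inv (Hom.toMap κ ⟨z, hz⟩)) (V := Z) (by
    rw [G.tgt_inv, Hom.src_eq κ]
    exact hz)
  rw [G.src_inv] at hV
  let V₁ : EtaleSite G := ⟨V.carrier ⊓ U.carrier⟩
  have h1 : V₁.carrier ≤ V.carrier := inf_le_left
  have h2 : V₁.carrier ≤ U.carrier := inf_le_right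
  have hz₁ : z ∈ (preimage κ V₁).carrier := ⟨hz, hV, Hom.tgt_mem κ _⟩
  have hν' : Hom.toMap (incl h1 ≫ ν) ⟨G.tgt (Hom.toMap κ ⟨z, hz⟩), hV, Hom.tgt_mem κ _⟩ =
      G.inv (Hom.toMap κ ⟨z, hz⟩) := by
    rw [incl_comp_toMap, ← hν]
    congr 1
    exact Subtype.ext (G.src_inv _).symm
  obtain ⟨W, hW, hzW, e⟩ := exists_incl_comp_eq (preimageHom κ V₁ ≫ incl h1 ≫ ν)
    (incl (preimage_le κ V₁)) ⟨z, hz₁⟩ (by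
      refine (mul_congr (G := G) _ rfl hν').trans ((G.mul_inv _).trans ?_)
      rw [Hom.src_eq]
      rfl)
  refine ⟨W, hW.trans (preimage_le κ V₁), hzW, ?_⟩
  rw [← incl_comp_incl hW (preimage_le κ V₁)]
  have e' := ha V₁ ((incl h1 ≫ ν) ≫ κ') h2
  have h3 := congrArg (fun b => F.pull (incl hW ≫ preimageHom κ V₁) b) e'
  have h4 := congrArg (fun α => F.pull α (F.pull κ' a)) e
  have h5 := congrArg (fun α => F.pull (incl hW) (F.pull α a)) (preimageHom_comp_incl κ h2)
  simp only [pull_comp] at h3 h4 h5 ⊢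
  rw [← h4, h3, h5]

/-- The saturation of an open set. -/
def _root_.DeligneGroupoid.EtaleSite.saturation (U : EtaleSite G) : EtaleSite G where
  carrier := ⟨G.src '' (G.tgt ⁻¹' U.carrier),
    G.isLocalDiffeomorph_src.isLocalHomeomorph.isOpenMap _
      (U.carrier.isOpen.preimage G.continuous_tgt)⟩

theorem _root_.DeligneGroupoid.EtaleSite.le_saturation_of_hom {U V : EtaleSite G} (τ : V ⟶ U) :
    V.carrier ≤ (saturation U).carrier := fun x hx =>
  ⟨Hom.toMap τ ⟨x, hx⟩, Hom.tgt_mem τ _, Hom.src_eq τ _⟩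

theorem _root_.DeligneGroupoid.EtaleSite.mem_saturation_of_tgt_mem {U : EtaleSite G} {g : X₁}
    (h : G.tgt g ∈ (saturation U).carrier) : G.src g ∈ (saturation U).carrier := by
  obtain ⟨k, hk, e⟩ := h
  exact ⟨G.mul g k e.symm, Set.mem_of_eq_of_mem (s := (U.carrier : Set X₀)) (G.tgt_mul g k e.symm) hk, G.src_mul _ _ _⟩

variable [IsManifold (𝓡 d) ∞ X₀] [IsManifold (𝓡 d) ∞ X₁]

theorem _root_.DeligneGroupoid.EtaleSite.exists_hom_of_mem_saturation {U : EtaleSite G} {x : X₀}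
    (hx : x ∈ (saturation U).carrier) :
    ∃ (V : EtaleSite G) (_ : V ⟶ U), x ∈ V.carrier := by
  obtain ⟨g, hg, rfl⟩ := hx
  obtain ⟨V, hV, τ, -⟩ := exists_section g hg
  exact ⟨V, τ, hV⟩

/-- An invariant section extends to the saturation. -/
theorem IsInvariant.exists_extension {F : GSheaf G} {U : EtaleSite G} {a : F.Sections U}
    (ha : F.IsInvariant a) : ∃ b : F.Sections (saturation U), F.IsInvariant b ∧
      ∀ (V : EtaleSite G) (τ : V ⟶ U), F.pull (incl (le_saturation_of_hom τ)) b = F.pull τ a := by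
  obtain ⟨b, hb⟩ := F.exists_glue (ι := Σ V : EtaleSite G, (V ⟶ U)) (U := saturation U)
    (fun p => p.1) (fun p => le_saturation_of_hom p.2)
    (fun x hx => by
      obtain ⟨V, τ, hV⟩ := exists_hom_of_mem_saturation hx
      exact ⟨⟨V, τ⟩, hV⟩)
    (fun p => F.pull p.2 a) (fun p q V hp hq => by
      rw [← pull_comp, ← pull_comp]
      exact ha.pull_eq_pull _ _)
  have hb' : ∀ (V : EtaleSite G) (τ : V ⟶ U),
      F.pull (incl (le_saturation_of_hom τ)) b = F.pull τ a := fun V τ => hb ⟨V, τ⟩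
  refine ⟨b, fun V σ hV => F.sections_ext_of_forall_mem fun y hy => ?_, hb'⟩
  obtain ⟨V₁, τ, hV₁⟩ := exists_hom_of_mem_saturation (Hom.tgt_mem σ ⟨y, hy⟩)
  refine ⟨preimage σ V₁, preimage_le σ V₁, ⟨hy, hV₁⟩, ?_⟩
  rw [← pull_comp, ← preimageHom_comp_incl σ (le_saturation_of_hom τ), pull_comp, hb',
    pull_incl_pull_incl, ← pull_comp]
  exact (hb' _ (preimageHom σ V₁ ≫ τ)).symm

end GSheaf

namespace InvariantAction

variable [IsManifold (𝓡 d) ∞ X₀] [IsManifold (𝓡 d) ∞ X₁]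
  {I Q : GSheaf G}

/-- Invariant sections lift locally to invariant sections. -/
theorem exists_invariant_local_lift [T2Space X₀] [T2Space X₁] (hG : G.IsProper)
    (ρ : InvariantAction I) (ρ' : InvariantAction Q) (π : I ⟶ Q) [Epi π]
    (hπ : ∀ f, CategoryStruct.comp π (ρ'.act f) = CategoryStruct.comp (ρ.act f) π)
    (b : Q.Sections (total G)) (hb : Q.IsInvariant b) (x : X₀) :
    ∃ (U : EtaleSite G), x ∈ U.carrier ∧ ∃ a : I.Sections (saturation U), I.IsInvariant a ∧
      mapSections π _ a = Q.pull (toTotal _) b := by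
  obtain ⟨O, hO, hxO, a₀, ha₀⟩ := exists_local_lift π b (x := x) trivial
  obtain ⟨U, hxU, hUO, ι, _, σ, hinj, hall⟩ := exists_slice hG O.carrier.isOpen hxO
  have hUO : U.carrier ≤ O.carrier := hUO
  -- The unit arrow at `x` is one of the arrows of the slice.
  have hm : Fintype.card ι ≠ 0 := by
    obtain ⟨i, -⟩ := hall ⟨x, hxU⟩ (G.one x) (G.src_one x) (by rwa [G.tgt_one])
    exact (Fintype.card_pos_iff.2 ⟨i⟩).ne'
  set f : invariantFunctions G := invariantFunctions.const (Fintype.card ι : ℝ)⁻¹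
  -- The sum of the translates is invariant, and each translate still lifts `b` because `b` is
  -- invariant. Division by the number of arrows, through the action of `f`, turns the sum into a
  -- lift.
  set a₁ : I.Sections U := ∑ i, I.pull (σ i) (I.pull (incl hUO) a₀) with ha₁
  have hinv₁ : I.IsInvariant a₁ := isInvariant_sum_pull I σ hinj hall _
  have hinv : I.IsInvariant (mapSections (ρ.act f) U a₁) := by
    intro V τ hV
    rw [ρ.pull_act, ρ.pull_act, hinv₁ V τ hV]
  have hlift₀ : ∀ (V : EtaleSite G) (τ : V ⟶ U), mapSections π V (I.pull τ (I.pull (incl hUO) a₀)) =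
      Q.pull (toTotal _) b := by
    intro V τ
    rw [mapSections_pull, mapSections_pull, ha₀, ← pull_comp, ← pull_comp]
    exact hb V _ _
  have hlift : mapSections π U (mapSections (ρ.act f) U a₁) =
      Q.pull (toTotal _) b := by
    rw [← mapSections_comp, ← hπ, mapSections_comp, ha₁, map_sum, Finset.sum_congr rfl
      fun i _ => hlift₀ U (σ i), Finset.sum_const, Finset.card_univ, map_nsmul]
    exact congrArg (fun φ => mapSections φ U (Q.pull (toTotal _) b))
      (ρ'.nsmul_act_const hm)
  obtain ⟨a, ha, ha'⟩ := hinv.exists_extension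
  refine ⟨U, hxU, a, ha, sections_ext_of_forall_mem _ fun y hy => ?_⟩
  obtain ⟨V, τ, hV⟩ := exists_hom_of_mem_saturation hy
  refine ⟨V, le_saturation_of_hom τ, hV, ?_⟩
  rw [← mapSections_pull, ha' V τ, mapSections_pull, hlift, ← pull_comp, ← pull_comp]
  exact (hb V _ (fun _ _ => trivial)).trans (hb V _ _).symm

omit [IsManifold (𝓡 d) ∞ X₀] [IsManifold (𝓡 d) ∞ X₁] in
/-- Multiplication of an invariant section by an invariant function and extension by zero. -/
theorem exists_invariant_extension_by_zero (ρ : InvariantAction I) (ρ' : InvariantAction Q)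
    (π : I ⟶ Q) (hπ : ∀ f, CategoryStruct.comp π (ρ'.act f) = CategoryStruct.comp (ρ.act f) π)
    (b : Q.Sections (total G)) {U : EtaleSite G} {a : I.Sections (saturation U)}
    (ha : I.IsInvariant a) (hab : mapSections π _ a = Q.pull (toTotal _) b)
    (f : invariantFunctions G) {C : Set X₀} (hC : IsClosed C)
    (hCU : ∀ y ∈ C, y ∈ (saturation U).carrier) (hf : ∀ y, y ∉ C → f.1 y = 0) :
    ∃ s : I.Sections (total G), I.IsInvariant s ∧
      mapSections π _ s = mapSections (ρ'.act f) _ b ∧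
      ∀ V : EtaleSite G, (∀ y ∈ V.carrier, f.1 y = 0) →
        I.pull (toTotal V) s = 0 := by
  let C' : EtaleSite G := ⟨⟨Cᶜ, hC.isOpen_compl⟩⟩
  -- The saturation, where the section is `f` times `a`, and the complement of `C`, where it is
  -- zero; on the overlap `f` vanishes, so the two pieces glue.
  let W : Bool → EtaleSite G := fun i => bif i then saturation U else C'
  have hcov : ∀ y : X₀, ∃ i, y ∈ (W i).carrier := fun y => by
    by_cases hy : y ∈ C
    · exact ⟨true, hCU y hy⟩
    · exact ⟨false, hy⟩
  have hzero : ∀ V : EtaleSite G, V.carrier ≤ C'.carrier → ∀ y ∈ V.carrier, f.1 y = 0 :=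
    fun V hV y hy => hf y (hV hy)
  let c : ∀ i, I.Sections (W i) := fun i => match i with
    | true => mapSections (ρ.act f) (saturation U) a
    | false => 0
  obtain ⟨s, hs⟩ := I.exists_glue (U := total G) W (fun i _ _ => trivial) (fun y _ => hcov y) c (by
    intro i j V hi hj
    match i, j with
    | true, true => rfl
    | false, false => rfl
    | true, false =>
      refine (ρ.pull_act f (incl hi) a).trans ((ρ.act_eq_zero f V (hzero V hj) _).trans ?_)
      exact (map_zero (I.pull (incl hj))).symm
    | false, true =>
      refine Eq.trans ?_ ((ρ.pull_act f (incl hj) a).trans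
        (ρ.act_eq_zero f V (hzero V hi) _)).symm
      exact map_zero (I.pull (incl hi)))
  have hs₁ : I.pull (toTotal (saturation U)) s =
    mapSections (ρ.act f) (saturation U) a := hs true
  have hs₀ : I.pull (toTotal C') s = 0 := hs false
  refine ⟨s, fun V σ hV => I.sections_ext_of_forall_mem fun y hy => ?_, ?_, fun V hV => ?_⟩
  · by_cases hyU : G.tgt (Hom.toMap σ ⟨y, hy⟩) ∈ (saturation U).carrier
    · have hle : (preimage σ (saturation U)).carrier ≤ (saturation U).carrier := by
        rintro z ⟨hz, hz'⟩
        have := mem_saturation_of_tgt_mem hz'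
        rwa [Hom.src_eq σ] at this
      refine ⟨preimage σ (saturation U), preimage_le _ _, ⟨hy, hyU⟩, ?_⟩
      rw [← pull_comp, ← preimageHom_comp_toTotal, pull_comp, hs₁, ρ.pull_act,
        ha _ _ hle, ← ρ.pull_act, ← hs₁, pull_incl_toTotal, pull_incl_total, pull_incl_toTotal]
    · have hyC : G.tgt (Hom.toMap σ ⟨y, hy⟩) ∈ C'.carrier := fun h => hyU (hCU _ h)
      have hyC' : y ∈ C'.carrier := fun h => hyU (by
        have h1 := hCU y h
        rw [← G.src_inv]
        refine mem_saturation_of_tgt_mem (U := U) ?_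
        rw [G.tgt_inv, Hom.src_eq σ]
        exact h1)
      let Z : EtaleSite G := ⟨(preimage σ C').carrier ⊓ C'.carrier⟩
      have h1 : Z.carrier ≤ (preimage σ C').carrier := inf_le_left
      have h2 : Z.carrier ≤ C'.carrier := inf_le_right
      refine ⟨Z, h1.trans (preimage_le _ _), ⟨⟨hy, hyC⟩, hyC'⟩, ?_⟩
      rw [pull_incl_total, pull_incl_toTotal, ← incl_comp_incl h1 (preimage_le _ _), pull_comp,
        ← pull_comp _ _ σ, ← preimageHom_comp_toTotal, pull_comp, hs₀, map_zero, map_zero,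
        ← pull_incl_toTotal I h2, hs₀, map_zero]
  · refine sections_ext Q (U := total G) W (fun i _ _ => trivial) (fun y _ => hcov y) fun i => ?_
    rw [← mapSections_pull, ρ'.pull_act]
    match i with
    | true =>
      refine (congrArg (mapSections π _) hs₁).trans ?_
      rw [← mapSections_comp, ← hπ, mapSections_comp, hab]
      rfl
    | false =>
      refine (congrArg (mapSections π _) hs₀).trans ?_
      rw [map_zero, ρ'.act_eq_zero]
      exact hzero _ le_rfl
  · refine I.sections_ext_of_forall_mem fun y hy => ?_
    obtain ⟨i, hi⟩ := hcov y
    let Z : EtaleSite G := ⟨V.carrier ⊓ (W i).carrier⟩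
    have h1 : Z.carrier ≤ V.carrier := inf_le_left
    have h2 : Z.carrier ≤ (W i).carrier := inf_le_right
    refine ⟨Z, h1, ⟨hy, hi⟩, ?_⟩
    rw [map_zero, pull_incl_toTotal, ← pull_incl_toTotal I h2]
    refine (congrArg (I.pull (incl h2)) (hs i)).trans ?_
    match i with
    | true => exact (ρ.pull_act f _ a).trans (ρ.act_eq_zero f Z (fun y hy => hV y (h1 hy)) _)
    | false => exact map_zero _

/-- For a proper groupoid, an epimorphism between sheaves with an action of the invariant
functions is surjective on invariant sections. -/
theorem epi_invariantSections_map [T2Space X₀] [T2Space X₁] [SecondCountableTopology X₀]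
    (hG : G.IsProper)
    (ρ : InvariantAction I) (ρ' : InvariantAction Q) (π : I ⟶ Q) [Epi π]
    (hπ : ∀ f, CategoryStruct.comp π (ρ'.act f) = CategoryStruct.comp (ρ.act f) π) :
    Epi ((invariantSections G).map π) := by
  rw [AddCommGrpCat.epi_iff_surjective]
  rintro ⟨b, hb⟩
  have hb : Q.IsInvariant b := fun V σ _ => hb V σ
  suffices h : ∃ t : I.Sections (total G), I.IsInvariant t ∧ mapSections π _ t = b by
    obtain ⟨t, ht, htb⟩ := h
    exact ⟨⟨t, fun V σ => ht V σ (fun _ _ => trivial)⟩, Subtype.ext htb⟩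
  -- The countable cover chosen below is enumerated by `ℕ`, which needs a point.
  rcases isEmpty_or_nonempty X₀ with hX | hX
  · exact ⟨0, fun V σ hV => I.sections_ext_of_forall_mem fun x => isEmptyElim x,
      Q.sections_ext_of_forall_mem fun x => isEmptyElim x⟩
  choose U hxU a ha hab using fun x => exists_invariant_local_lift hG ρ ρ' π hπ b hb x
  choose θ C hC hCU hθC hθ using fun x => exists_invariant_bump hG
    ((U x).carrier.isOpen.mem_nhds (hxU x))
  -- Second countability: countably many of the open sets on which a bump equals `1` cover the
  -- space.
  obtain ⟨S, hS, hScov⟩ := TopologicalSpace.countable_cover_nhds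
    fun x => interior_mem_nhds.2 (hθ x)
  have hSne : S.Nonempty := by
    by_contra h
    rw [Set.not_nonempty_iff_eq_empty] at h
    obtain ⟨x⟩ := hX
    have : x ∈ (Set.univ : Set X₀) := trivial
    rw [← hScov, h] at this
    simp at this
  obtain ⟨e, rfl⟩ := hS.exists_eq_range hSne
  -- The telescoping partition of unity. The products are formed in the ring of functions before
  -- acting, so the action need not be multiplicative.
  let f : ℕ → invariantFunctions G := fun k =>
    θ (e k) * ∏ j ∈ Finset.range k, (1 - θ (e j))
  have hfC : ∀ k y, y ∉ C (e k) → (f k).1 y = 0 := fun k y hy => by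
    have : (f k).1 y = (θ (e k)).1 y * (∏ j ∈ Finset.range k, (1 - θ (e j))).1 y := rfl
    rw [this, hθC _ _ hy, zero_mul]
  choose s hs hsb hs0 using fun k => exists_invariant_extension_by_zero ρ ρ' π hπ b (ha (e k))
    (hab (e k)) (f k) (hC (e k)) (fun y hy => by
      obtain ⟨g, hg, hgU⟩ := hCU (e k) y hy
      exact ⟨g, hgU, hg⟩) (hfC k)
  let N : ℕ → EtaleSite G := fun j => ⟨⟨interior {y | (θ (e j)).1 y = 1}, isOpen_interior⟩⟩
  have hNθ : ∀ j, ∀ y ∈ (N j).carrier, (θ (e j)).1 y = 1 := fun j y hy =>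
    interior_subset (s := {y | (θ (e j)).1 y = 1}) hy
  have hN : ∀ x : X₀, ∃ j, x ∈ (N j).carrier := fun x => by
    have h : x ∈ (Set.univ : Set X₀) := trivial
    rw [← hScov] at h
    obtain ⟨_, ⟨j, rfl⟩, hj⟩ := Set.mem_iUnion₂.1 h
    exact ⟨j, hj⟩
  have hprod : ∀ j k, j < k → ∀ y ∈ (N j).carrier,
      (∏ i ∈ Finset.range k, (1 - θ (e i))).1 y = 0 := by
    intro j k hjk y hy
    rw [← Finset.mul_prod_erase _ _ (Finset.mem_range.2 hjk)]
    change (1 - (θ (e j)).1 y) * _ = 0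
    rw [hNθ j y hy, sub_self, zero_mul]
  have hf0 : ∀ j k, j < k → ∀ y ∈ (N j).carrier, (f k).1 y = 0 := by
    intro j k hjk y hy
    have : (f k).1 y = (θ (e k)).1 y * (∏ j ∈ Finset.range k, (1 - θ (e j))).1 y := rfl
    rw [this, hprod j k hjk y hy, mul_zero]
  -- On `N j` the sections `s k` with `k > j` vanish, so the partial sums are constant there from
  -- index `j + 1` on. Gluing these stable values defines the infinite sum.
  let S : ℕ → I.Sections (total G) := fun n => ∑ k ∈ Finset.range n, s k
  have hS : ∀ (V : EtaleSite G) (j m n : ℕ), V.carrier ≤ (N j).carrier → j < m → j < n →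
      I.pull (toTotal V) (S m) = I.pull (toTotal V) (S n) := by
    intro V j m n hV
    have key : ∀ n, j < n → I.pull (toTotal V) (S n) = I.pull (toTotal V) (S (j + 1)) := by
      intro n hn
      induction n, hn using Nat.le_induction with
      | base => rfl
      | succ n hn ih =>
        change I.pull (toTotal V) (∑ k ∈ Finset.range (n + 1), s k) = _
        rw [Finset.sum_range_succ, map_add, hs0 n V fun y hy => hf0 j n hn y (hV hy), add_zero]
        exact ih
    exact fun hm hn => (key m hm).trans (key n hn).symm
  obtain ⟨t, ht⟩ := I.exists_glue (U := total G) N (fun _ _ _ => trivial) (fun x _ => hN x)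
    (fun j => I.pull (toTotal (N j)) (S (j + 1))) (fun i j V hi hj => by
      rw [pull_incl_toTotal, pull_incl_toTotal, hS V i (i + 1) (max i j + 1) hi (by lia) (by lia),
        hS V j (j + 1) (max i j + 1) hj (by lia) (by lia)])
  have ht' : ∀ (V : EtaleSite G) (j n : ℕ), V.carrier ≤ (N j).carrier → j < n →
      I.pull (toTotal V) t = I.pull (toTotal V) (S n) := by
    intro V j n hV hn
    rw [← pull_incl_toTotal I hV]
    refine (congrArg (I.pull (incl hV)) (ht j)).trans ?_
    rw [pull_incl_toTotal]
    exact hS V j _ _ hV (Nat.lt_succ_self j) hn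
  have hSinv : ∀ n, I.IsInvariant (S n) := by
    intro n V σ hV
    simp only [S, map_sum]
    exact Finset.sum_congr rfl fun k _ => hs k V σ hV
  refine ⟨t, fun V σ hV => I.sections_ext_of_forall_mem fun y hy => ?_,
    Q.sections_ext (U := total G) N (fun _ _ _ => trivial) (fun x _ => hN x) fun j => ?_⟩
  · obtain ⟨i, hi⟩ := hN y
    obtain ⟨j, hj⟩ := hN (G.tgt (Hom.toMap σ ⟨y, hy⟩))
    let Z : EtaleSite G := ⟨(preimage σ (N j)).carrier ⊓ (N i).carrier⟩
    have h1 : Z.carrier ≤ (preimage σ (N j)).carrier := inf_le_left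
    have h2 : Z.carrier ≤ (N i).carrier := inf_le_right
    refine ⟨Z, h1.trans (preimage_le _ _), ⟨⟨hy, hj⟩, hi⟩, ?_⟩
    rw [pull_incl_total, pull_incl_toTotal, ht' Z i (max i j + 1) h2 (by lia),
      ← incl_comp_incl h1 (preimage_le _ _), pull_comp, ← pull_comp _ _ σ,
      ← preimageHom_comp_toTotal, pull_comp, ht' (N j) j (max i j + 1) le_rfl (by lia),
      ← pull_comp _ _ (toTotal (N j)), preimageHom_comp_toTotal, pull_comp _ _ σ,
      hSinv _ V σ hV, pull_incl_total, pull_incl_toTotal, pull_incl_toTotal]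
  · rw [← mapSections_pull]
    change mapSections π (N j) (I.pull (toTotal (N j)) t) = Q.pull (toTotal (N j)) b
    rw [ht' (N j) j (j + 1) le_rfl (Nat.lt_succ_self j), mapSections_pull]
    -- The partial sum maps to `b` minus the action of ∏ (1 - θ) on `b`, and this product vanishes
    -- on `N j`.
    have h1 : mapSections π _ (S (j + 1)) =
        mapSections (ρ'.act (∑ k ∈ Finset.range (j + 1), f k)) _ b := by
      simp only [S, map_sum]
      rw [Finset.sum_congr rfl fun k _ => hsb k]
      let m : (Q ⟶ Q) →+ (Q.Sections (total G) →+ Q.Sections (total G)) :=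
        AddMonoidHom.mk' (fun φ => mapSections φ (total G)) fun _ _ => rfl
      have h := congrArg (fun φ => φ b) (map_sum m (fun k => ρ'.act (f k)) (Finset.range (j + 1)))
      rw [AddMonoidHom.finsetSum_apply] at h
      exact h.symm
    have h2 : ∑ k ∈ Finset.range (j + 1), f k = 1 - ∏ i ∈ Finset.range (j + 1), (1 - θ (e i)) := by
      rw [← Finset.one_sub_sum_mul_prod_one_sub (fun k => θ (e k)) (j + 1), sub_sub_cancel]
    have h3 : mapSections (ρ'.act (∑ k ∈ Finset.range (j + 1), f k)) _ b = b -
        mapSections (ρ'.act (∏ i ∈ Finset.range (j + 1), (1 - θ (e i)))) _ b := by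
      rw [h2, map_sub, ρ'.act_one]
      rfl
    rw [h1, h3, map_sub, ρ'.pull_act, ρ'.act_eq_zero _ (N j) (hprod j (j + 1) (Nat.lt_succ_self j)),
      sub_zero]

/-- For a proper groupoid, the sheaves with an action of the invariant functions are acyclic. -/
theorem isRightAcyclic [HasDerivedCategory (GSheaf G)] [HasDerivedCategory AddCommGrpCat.{u}]
    [T2Space X₀] [T2Space X₁] [SecondCountableTopology X₀] (hG : G.IsProper)
    {F : GSheaf G} (ρ : InvariantAction F) : (invariantSections G).IsRightAcyclic F := by
  intro p hp
  obtain ⟨n, rfl⟩ : ∃ n : ℕ, p = n + 1 := ⟨(p - 1).toNat, by lia⟩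
  -- Dimension shifting replaces the sheaf by the cokernel of its embedding in the Godement sheaf,
  -- which again carries an action; hence the sheaf must vary.
  induction n generalizing F with
  | zero =>
    have := ρ.injective_godement
    have hS := ShortComplex.ShortExact.mk' (ShortComplex.exact_cokernel (toGodement F))
      inferInstance (inferInstanceAs (Epi (Limits.cokernel.π (toGodement F))))
    have h := epi_invariantSections_map hG ρ.godement ρ.cokernel
      (Limits.cokernel.π (toGodement F)) ρ.cokernel_act
    exact Functor.isZero_hyperRightDerived_single_one
      (preservesLeftExact_invariantSections G) hS
  | succ n ih =>
    have := ρ.injective_godement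
    have hS := ShortComplex.ShortExact.mk' (ShortComplex.exact_cokernel (toGodement F))
      inferInstance (inferInstanceAs (Epi (Limits.cokernel.π (toGodement F))))
    exact Functor.isZero_hyperRightDerived_single_succ _ hS _ (by lia) (ih ρ.cokernel (by lia))

end InvariantAction

end DeligneGroupoid

/-! ### The action of invariant functions on forms -/

namespace DeligneGroupoid

section SmulForms

variable {d : ℕ} {M : Type*} [TopologicalSpace M] [ChartedSpace (EuclideanSpace ℝ (Fin d)) M]
  [IsManifold (𝓡 d) ∞ M]

theorem SmoothFormAt.smul {k : ℕ} {f : M → ℝ} {α : M → FormFiber d k} {x : M}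
    (hf : ContMDiffAt (𝓡 d) 𝓘(ℝ, ℝ) ∞ f x) (hα : SmoothFormAt α x) :
    SmoothFormAt (fun y => f y • α y) x := by
  have h : ContDiffAt ℝ ∞ (f ∘ (extChartAt (𝓡 d) x).symm) (extChartAt (𝓡 d) x x) := by
    rw [← contMDiffAt_iff_contDiffAt]
    refine ContMDiffAt.comp (g := f) _ ?_ (eventually_smooth_symm (d := d) x).self_of_nhds
    rwa [extChartAt_to_inv]
  exact ContDiffAt.smul h hα

end SmulForms

variable {d : ℕ} {X₀ X₁ : Type u}
  [TopologicalSpace X₀] [ChartedSpace (EuclideanSpace ℝ (Fin d)) X₀]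
  [TopologicalSpace X₁] [ChartedSpace (EuclideanSpace ℝ (Fin d)) X₁]
  {G : SmoothEtaleGroupoid d X₀ X₁}

namespace FunctionSheafData

open GSheaf

variable {A B : Type} [AddCommGroup A] [AddCommGroup B]
  {D : FunctionSheafData G A} {D' : FunctionSheafData G B}

/-- A section of the sheaf of a `FunctionSheafData` as a function. -/
def toFun {U : EtaleSite G} (a : D.sheaf.Sections U) : U.carrier → A := Subtype.val (p := (· ∈ D.sections U)) a

theorem toFun_injective {U : EtaleSite G} {a b : D.sheaf.Sections U} (h : toFun a = toFun b) :
    a = b := Subtype.ext h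

theorem toFun_pull_incl {U V : EtaleSite G} (h : U.carrier ≤ V.carrier) (a : D.sheaf.Sections V)
    (x : U.carrier) : toFun (D.sheaf.pull (EtaleSite.incl h) a) x = toFun a ⟨x, h x.2⟩ :=
  D.transport_incl h a x

theorem isSection_toFun {U : EtaleSite G} (a : D.sheaf.Sections U) (x : U.carrier) :
    D.IsSection (extendZero U.carrier (toFun a)) x :=
  Subtype.property (p := (· ∈ D.sections U)) a x

/-- The section of the sheaf defined by a function. -/
def ofFun {U : EtaleSite G} (f : X₀ → A) (hf : ∀ x ∈ U.carrier, D.IsSection f x) :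
    D.sheaf.Sections U :=
  (⟨fun x => f x, fun x => D.congr (by
    filter_upwards [U.carrier.isOpen.mem_nhds x.2] with y hy
    rw [extendZero_apply_mem _ hy]) (hf x x.2)⟩ : D.sections U)

theorem toFun_hom (L : Operator D D') {U : EtaleSite G} (a : D.sheaf.Sections U) (x : U.carrier) :
    toFun (mapSections L.hom U a) x = L.op (extendZero U.carrier (toFun a)) x := rfl

theorem toFun_hom_of_eventuallyEq (L : Operator D D') {U : EtaleSite G} (a : D.sheaf.Sections U)
    (x : U.carrier) {f : X₀ → A} (h : ∀ᶠ y in 𝓝 x.1, ∀ hy : y ∈ U.carrier, toFun a ⟨y, hy⟩ = f y) :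
    toFun (mapSections L.hom U a) x = L.op f x := by
  rw [toFun_hom]
  refine L.congr ?_
  filter_upwards [h, U.carrier.isOpen.mem_nhds x.2] with y hy hyU
  rw [extendZero_apply_mem _ hyU, hy hyU]

theorem toFun_hom_ofFun (L : Operator D D') {U : EtaleSite G} (f : X₀ → A)
    (hf : ∀ x ∈ U.carrier, D.IsSection f x) (x : U.carrier) :
    toFun (mapSections L.hom U (ofFun f hf)) x = L.op f x :=
  toFun_hom_of_eventuallyEq L _ x (Eventually.of_forall fun _ _ => rfl)

end FunctionSheafData

theorem GSheaf.hom_ext_mapSections {F F' : GSheaf G} {φ ψ : F ⟶ F'}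
    (h : ∀ U (a : F.Sections U), mapSections φ U a = mapSections ψ U a) : φ = ψ := by
  apply Sheaf.hom_ext
  ext U a
  exact h U.unop a

variable [IsManifold (𝓡 d) ∞ X₀] [IsManifold (𝓡 d) ∞ X₁]

open FunctionSheafData GSheaf

variable (G) in
/-- Multiplication of forms by an invariant function. -/
noncomputable def smulOperator (k : ℕ) (f : invariantFunctions G) :
    Operator (formData G k) (formData G k) where
  op α x := f.1 x • α x
  congr h := by simp only [h.self_of_nhds]
  add _ _ := smul_add _ _ _
  isSection hα := SmoothFormAt.smul (f.2.1 _) hα.self_of_nhds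
  equivariant σ x α hα := by
    rw [extendZero_apply]
    have h : f.1 x = f.1 (EtaleSite.Hom.target σ x) :=
      (congrArg f.1 (EtaleSite.Hom.src_eq σ x)).symm.trans (f.2.2 _)
    rw [h]
    rfl

variable (G) in
/-- The action of the invariant functions on forms. -/
noncomputable def formSheafAction (k : ℕ) : InvariantAction (formSheaf G k) where
  act := AddMonoidHom.mk' (fun f => (smulOperator G k f).hom) fun f g => by
    refine hom_ext_mapSections fun U a => toFun_injective (D := formData G k) (funext fun x => ?_)
    exact add_smul (f.1 x) (g.1 x) (extendZero U.carrier (toFun (D := formData G k) a) x)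
  act_one := by
    refine hom_ext_mapSections fun U a => toFun_injective (D := formData G k) (funext fun x => ?_)
    exact (one_smul ℝ _).trans (extendZero_apply _ _)
  act_eq_zero f W hf a := by
    refine toFun_injective (D := formData G k) (funext fun x => ?_)
    refine Eq.trans ?_ (zero_smul ℝ (extendZero W.carrier (toFun (D := formData G k) a) x))
    rw [← hf x x.2]
    rfl

end DeligneGroupoid

/-! ### Differentiation under the integral and the Poincaré lemma -/

section ParametricIntegral

open MeasureTheory

variable {H E : Type u} [NormedAddCommGroup H] [NormedSpace ℝ H]
  [NormedAddCommGroup E] [NormedSpace ℝ E]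

theorem ContDiff.hasFDerivAt_uncurry_left {f : H → ℝ → E}
    (hf : ContDiff ℝ 1 (Function.uncurry f)) (x : H) (t : ℝ) :
    HasFDerivAt (fun y => f y t)
      ((fderiv ℝ (Function.uncurry f) (x, t)).comp (.inl ℝ H ℝ)) x :=
  HasFDerivAt.comp (g := Function.uncurry f) (f := fun y => (y, t)) x
    (hf.differentiable (by simp) (x, t)).hasFDerivAt (hasFDerivAt_prodMk_left x t)

variable [ProperSpace H]

/-- Dominated differentiation: the partial derivative is continuous, hence bounded on the product of
a closed ball and the interval, which is compact because `H` is proper. -/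
theorem hasFDerivAt_parametric_intervalIntegral {f : H → ℝ → E}
    (hf : ContDiff ℝ 1 (Function.uncurry f)) (a b : ℝ) (x : H) :
    HasFDerivAt (fun y => ∫ t in a..b, f y t)
      (∫ t in a..b, (fderiv ℝ (Function.uncurry f) (x, t)).comp (.inl ℝ H ℝ)) x := by
  have hc : Continuous fun p : H × ℝ =>
      (fderiv ℝ (Function.uncurry f) p).comp (ContinuousLinearMap.inl ℝ H ℝ) :=
    (hf.continuous_fderiv (by simp)).clm_comp continuous_const
  have hcx (y : H) : Continuous (f y) := hf.continuous.comp (Continuous.prodMk_right y)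
  obtain ⟨C, hC⟩ := ((isCompact_closedBall x 1).prod isCompact_uIcc).exists_bound_of_continuousOn
    (f := fun p : H × ℝ => (fderiv ℝ (Function.uncurry f) p).comp (ContinuousLinearMap.inl ℝ H ℝ))
    (s := Metric.closedBall x 1 ×ˢ Set.uIcc a b) hc.continuousOn
  refine intervalIntegral.hasFDerivAt_integral_of_dominated_of_fderiv_le
    (Metric.closedBall_mem_nhds x one_pos) (bound := fun _ => C)
    (F' := fun y t => (fderiv ℝ (Function.uncurry f) (y, t)).comp (.inl ℝ H ℝ))
    (Eventually.of_forall fun y => (hcx y).aestronglyMeasurable) ((hcx x).intervalIntegrable _ _)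
    (hc.comp (Continuous.prodMk_right x)).aestronglyMeasurable ?_ (by simp) ?_
  · exact Eventually.of_forall fun t ht y hy => hC (y, t) ⟨hy, Set.uIoc_subset_uIcc ht⟩
  · exact Eventually.of_forall fun t _ y _ =>
      hf.hasFDerivAt_uncurry_left y t

/-- The shape of a homotopy formula: after a linear map `A`, here meant to be alternatization, the
differentiated integrand becomes a total derivative in `t`, and the integral reduces to boundary
values. -/
theorem map_fderiv_parametric_intervalIntegral {F : Type*} [NormedAddCommGroup F] [NormedSpace ℝ F]
    [CompleteSpace E] [CompleteSpace F] {f : H → ℝ → E} (hf : ContDiff ℝ 1 (Function.uncurry f))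
    {a b : ℝ} {x : H} (A : (H →L[ℝ] E) →L[ℝ] F) {g : ℝ → F} (hg : ∀ t ∈ Set.uIcc a b,
      HasDerivAt g (A ((fderiv ℝ (Function.uncurry f) (x, t)).comp (.inl ℝ H ℝ))) t) :
    A (fderiv ℝ (fun y => ∫ t in a..b, f y t) x) = g b - g a := by
  have hcont : Continuous fun t : ℝ =>
      (fderiv ℝ (Function.uncurry f) (x, t)).comp (.inl ℝ H ℝ) :=
    ((hf.continuous_fderiv (by simp)).comp (Continuous.prodMk_right x)).clm_comp continuous_const
  rw [(hasFDerivAt_parametric_intervalIntegral hf a b x).fderiv,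
    ← A.intervalIntegral_comp_comm (hcont.intervalIntegrable _ _)]
  exact intervalIntegral.integral_eq_sub_of_hasDerivAt hg
    ((A.continuous.comp hcont).intervalIntegrable _ _)

theorem contDiff_parametric_intervalIntegral {f : H → ℝ → E}
    (hf : ContDiff ℝ ∞ (Function.uncurry f)) (a b : ℝ) :
    ContDiff ℝ ∞ fun x => ∫ t in a..b, f x t := by
  refine contDiff_infty.2 fun n => ?_
  induction n generalizing E with
  | zero =>
    exact contDiff_zero.2
      (intervalIntegral.continuous_parametric_intervalIntegral_of_continuous' hf.continuous _ _)
  | succ n ih =>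
    have h : ContDiff ℝ n fun x =>
        ∫ t in a..b, (fderiv ℝ (Function.uncurry f) (x, t)).comp (.inl ℝ H ℝ) :=
      ih ((hf.fderiv_right (m := ∞) (by simp)).clm_comp contDiff_const)
    exact contDiff_succ_iff_hasFDerivAt.2
      ⟨_, h, hasFDerivAt_parametric_intervalIntegral (hf.of_le (by simp)) a b⟩

end ParametricIntegral

namespace ContinuousAlternatingMap

variable {V W : Type*} [NormedAddCommGroup V] [NormedSpace ℝ V] [NormedAddCommGroup W]
  [NormedSpace ℝ W] {k : ℕ}

/-- Contraction with a vector, as a bilinear map. -/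
noncomputable def contractCLM (V W : Type*) [NormedAddCommGroup V] [NormedSpace ℝ V]
    [NormedAddCommGroup W] [NormedSpace ℝ W] (k : ℕ) :
    V →L[ℝ] (V [⋀^Fin (k + 1)]→L[ℝ] W) →L[ℝ] V [⋀^Fin k]→L[ℝ] W :=
  (curryLeftLI (𝕜 := ℝ) (E := V) (F := W) (n := k)).toContinuousLinearMap.flip

theorem contractCLM_apply (x : V) (f : V [⋀^Fin (k + 1)]→L[ℝ] W) :
    contractCLM V W k x f = f.curryLeft x := rfl

/-- Cartan's formula for a constant vector field, read on the derivative `L` of a form. In the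
alternating sum for the second term the summand of index `0` is `L x`; the others cancel the first
term, the extra slot shifting their signs by one. -/
theorem alternatizeUncurryFin_contract (L : V →L[ℝ] V [⋀^Fin (k + 1)]→L[ℝ] W) (x : V) :
    alternatizeUncurryFin ((contractCLM V W k x).comp L) + (alternatizeUncurryFin L).curryLeft x =
      L x := by
  ext v
  have h (i : Fin (k + 1)) : i.succ.removeNth (Matrix.vecCons x v : Fin (k + 2) → V) =
      Matrix.vecCons x (i.removeNth v) := by
    funext j
    refine Fin.cases ?_ (fun j => ?_) j <;> simp [Fin.removeNth, Matrix.vecCons]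
  have h0 : (0 : Fin (k + 2)).removeNth (Matrix.vecCons x v : Fin (k + 2) → V) = v := rfl
  rw [add_apply, alternatizeUncurryFin_apply, curryLeft_apply_apply, alternatizeUncurryFin_apply,
    Fin.sum_univ_succ (n := k + 1), add_left_comm, ← Finset.sum_add_distrib]
  simp [h, h0, contractCLM_apply, pow_succ]

end ContinuousAlternatingMap

section Poincare

open MeasureTheory ContinuousAlternatingMap

variable {V W : Type u} [NormedAddCommGroup V] [NormedSpace ℝ V] [ProperSpace V]
  [NormedAddCommGroup W] [NormedSpace ℝ W] [CompleteSpace W] {k : ℕ}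

/-- The Poincaré lemma for a ball, with a primitive defined everywhere. -/
theorem exists_extDeriv_eq_of_extDeriv_eq_zero {α : V → V [⋀^Fin (k + 1)]→L[ℝ] W}
    (hα : ContDiff ℝ ∞ α) {c : V} {r : ℝ} (h : ∀ x ∈ Metric.ball c r, extDeriv α x = 0) :
    ∃ β : V → V [⋀^Fin k]→L[ℝ] W, ContDiff ℝ ∞ β ∧ ∀ x ∈ Metric.ball c r, extDeriv β x = α x := by
  let γ (x : V) (t : ℝ) : V := c + t • (x - c)
  -- The integrand of the homotopy operator for the radial contraction to `c`; the factor `t ^ k`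
  -- comes from pulling back the remaining `k` arguments.
  let f (x : V) (t : ℝ) : V [⋀^Fin k]→L[ℝ] W := t ^ k • contractCLM V W k (x - c) (α (γ x t))
  have hγ : ContDiff ℝ ∞ (Function.uncurry γ) :=
    contDiff_const.add (contDiff_snd.smul (contDiff_fst.sub contDiff_const))
  have hf : ContDiff ℝ ∞ (Function.uncurry f) :=
    (contDiff_snd.pow k).smul ((contDiff_const.clm_apply
      (contDiff_fst.sub contDiff_const)).clm_apply (hα.comp hγ))
  refine ⟨_, contDiff_parametric_intervalIntegral hf 0 1, fun x hx => ?_⟩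
  have hd (t : ℝ) : (fderiv ℝ (Function.uncurry f) (x, t)).comp (.inl ℝ V ℝ) =
      t ^ k • ((contractCLM V W k (x - c)).comp (t • fderiv ℝ α (γ x t)) +
        (α (γ x t)).curryLeft) := by
    have h1 := ContDiff.hasFDerivAt_uncurry_left (f := f) (hf.of_le (by simp)) x t
    have h2 : HasFDerivAt (fun y => γ y t) (t • ContinuousLinearMap.id ℝ V) x :=
      (((hasFDerivAt_id x).sub_const c).const_smul t).const_add c
    have h3 := ((contractCLM V W k).hasFDerivAt_of_bilinear ((hasFDerivAt_id x).sub_const c)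
      (HasFDerivAt.comp (g := α) x (hα.differentiable (by simp) (γ x t)).hasFDerivAt
        h2)).const_smul (t ^ k)
    refine (h1.unique h3).trans ?_
    ext v
    simp [contractCLM_apply, ContinuousLinearMap.precompR, ContinuousLinearMap.precompL]
  -- The exterior derivative of the integrand. Cartan's formula and closedness at `γ x t` give the
  -- first summand; alternatizing the contraction of a `(k + 1)`-form returns `k + 1` times the
  -- form, which gives the second. Together they are the derivative of `t ^ (k + 1) • α (γ x t)`,
  -- whose boundary values are `α x` and `0`.
  have hAU (t : ℝ) (ht : γ x t ∈ Metric.ball c r) :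
      alternatizeUncurryFin ((fderiv ℝ (Function.uncurry f) (x, t)).comp (.inl ℝ V ℝ)) =
        t ^ (k + 1) • fderiv ℝ α (γ x t) (x - c) + ((k + 1 : ℕ) * t ^ k : ℝ) • α (γ x t) := by
    have h1 := alternatizeUncurryFin_contract (fderiv ℝ α (γ x t)) (x - c)
    have h2 : alternatizeUncurryFin (fderiv ℝ α (γ x t)) = 0 := h _ ht
    rw [h2, curryLeft_zero, zero_apply, add_zero] at h1
    rw [hd, alternatizeUncurryFin_smul, alternatizeUncurryFin_add, alternatizeUncurryFin_curryLeft,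
      ContinuousLinearMap.comp_smul, alternatizeUncurryFin_smul, h1, smul_add, smul_smul, pow_succ,
      ← Nat.cast_smul_eq_nsmul ℝ, smul_smul,
      mul_comm (t ^ k) ((k + 1 : ℕ) : ℝ)]
  have hmem : ∀ t ∈ Set.uIcc (0 : ℝ) 1, γ x t ∈ Metric.ball c r := by
    intro t ht
    rw [Set.uIcc_of_le zero_le_one] at ht
    exact (convex_ball c r).add_smul_sub_mem
      (Metric.mem_ball_self (Metric.pos_of_mem_ball hx)) hx ht
  refine (map_fderiv_parametric_intervalIntegral (hf.of_le (by simp))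
    (alternatizeUncurryFinCLM ℝ V W) (g := fun t => t ^ (k + 1) • α (γ x t))
    fun t ht => ?_).trans (by simp [γ])
  rw [alternatizeUncurryFinCLM_apply, hAU t (hmem t ht)]
  have h2 : HasDerivAt (γ x) (x - c) t := by
    have h3 := ((hasDerivAt_id t).smul_const (x - c)).const_add c
    rw [one_smul] at h3
    exact h3
  exact (hasDerivAt_pow (k + 1) t).smul
    ((hα.differentiable (by simp) (γ x t)).hasFDerivAt.comp_hasDerivAt t h2)

/-- The local Poincaré lemma. -/
theorem exists_extDeriv_eventuallyEq [FiniteDimensional ℝ V]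
    {α : V → V [⋀^Fin (k + 1)]→L[ℝ] W} {c : V}
    (hα : ∀ᶠ x in 𝓝 c, ContDiffAt ℝ ∞ α x) (h : extDeriv α =ᶠ[𝓝 c] 0) :
    ∃ β : V → V [⋀^Fin k]→L[ℝ] W, ContDiff ℝ ∞ β ∧ extDeriv β =ᶠ[𝓝 c] α := by
  obtain ⟨r, hr, hball⟩ := Metric.nhds_basis_closedBall.mem_iff.1 (hα.and h)
  -- Cutting off makes the form smooth on the whole space. It stays closed only on the ball of
  -- radius `r / 2` where the bump is `1`, which is all that the preceding lemma asks for.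
  let χ : ContDiffBump c := ⟨r / 2, r, half_pos hr, half_lt_self hr⟩
  have hα' : ContDiff ℝ ∞ fun x => χ x • α x := by
    refine contDiff_iff_contDiffAt.2 fun x => ?_
    by_cases hx : x ∈ Metric.closedBall c r
    · exact χ.contDiffAt.smul (hball hx).1
    · refine contDiffAt_const (c := 0) |>.congr_of_eventuallyEq ?_
      filter_upwards [Metric.isClosed_closedBall.isOpen_compl.mem_nhds hx] with y hy
      rw [χ.zero_of_le_dist (le_of_lt (by simpa using hy)), zero_smul]
  have heq : ∀ x ∈ Metric.ball c (r / 2), (fun x => χ x • α x) =ᶠ[𝓝 x] α := fun x hx => by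
    filter_upwards [Metric.isOpen_ball.mem_nhds hx] with y hy
    rw [χ.one_of_mem_closedBall (Metric.ball_subset_closedBall hy), one_smul]
  obtain ⟨β, hβ, hβ'⟩ := exists_extDeriv_eq_of_extDeriv_eq_zero hα' (c := c) (r := r / 2)
    fun x hx => ((heq x hx).extDeriv_eq).trans
      (hball (Metric.ball_subset_closedBall (Metric.ball_subset_ball (half_lt_self hr).le hx))).2
  refine ⟨β, hβ, ?_⟩
  filter_upwards [Metric.ball_mem_nhds c (half_pos hr)] with x hx
  rw [hβ' x hx]
  exact (heq x hx).self_of_nhds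

end Poincare

namespace DeligneGroupoid

variable {d : ℕ} {M : Type*} [TopologicalSpace M] [ChartedSpace (EuclideanSpace ℝ (Fin d)) M]

theorem pullForm_id {k : ℕ} (α : M → FormFiber d k) : pullForm id α = α := by
  funext x
  have h : tangentMapAt d (id : M → M) x = ContinuousLinearMap.id ℝ _ := mfderiv_id
  rw [pullForm, h]
  rfl

theorem smoothFormAt_vectorSpace {k : ℕ} {α : EuclideanSpace ℝ (Fin d) → FormFiber d k}
    {x : EuclideanSpace ℝ (Fin d)} : SmoothFormAt α x ↔ ContDiffAt ℝ ∞ α x := by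
  rw [SmoothFormAt, localForm_vectorSpace, extChartAt_model_space_eq_id]
  rfl

variable [IsManifold (𝓡 d) ∞ M]

/-- The local Poincaré lemma on a manifold. -/
theorem exists_dForm_eventuallyEq {k : ℕ} {α : M → FormFiber d (k + 1)} {x : M}
    (hα : ∀ᶠ y in 𝓝 x, SmoothFormAt α y) (h : ∀ᶠ y in 𝓝 x, dForm α y = 0) :
    ∃ β : M → FormFiber d k, (∀ᶠ y in 𝓝 x, SmoothFormAt β y) ∧ dForm β =ᶠ[𝓝 x] α := by
  set e := extChartAt (𝓡 d) x
  have t1 : Tendsto e.symm (𝓝 (e x)) (𝓝 x) := by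
    have := (continuousAt_extChartAt_symm (I := 𝓡 d) x).tendsto
    rwa [extChartAt_to_inv x] at this
  obtain ⟨β, hβ, hβ'⟩ := exists_extDeriv_eventuallyEq (α := localForm α x) (c := e x) (by
    filter_upwards [t1.eventually hα, eventually_smooth_symm x] with v hv h2
    exact smoothFormAt_vectorSpace.1 (SmoothFormAt.pull hv h2)) (by
    filter_upwards [t1.eventually (hα.and h), eventually_smooth_symm x] with v hv h2
    rw [← dForm_vectorSpace]
    refine (dForm_pull hv.1 h2).trans ?_
    rw [pullForm, hv.2]
    rfl)
  have hβs (v) : SmoothFormAt β v := smoothFormAt_vectorSpace.2 hβ.contDiffAt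
  have he : ∀ᶠ y in 𝓝 x, ContMDiffAt (𝓡 d) (𝓡 d) ∞ e y := by
    filter_upwards [extChartAt_source_mem_nhds (I := 𝓡 d) x] with y hy
    exact contMDiffAt_extChartAt' (by simpa [e] using hy)
  refine ⟨pullForm e β, he.mono fun y hy => SmoothFormAt.pull (hβs _) hy, ?_⟩
  have t2 : Tendsto e (𝓝 x) (𝓝 (e x)) := (continuousAt_extChartAt (I := 𝓡 d) x).tendsto
  filter_upwards [he, t2.eventually hβ', t2.eventually (eventually_smooth_symm x),
    extChartAt_source_mem_nhds (I := 𝓡 d) x] with y hy h1 h2 h3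
  rw [dForm_pull (hβs _) hy]
  have h4 : e.symm ∘ e =ᶠ[𝓝 y] id := by
    filter_upwards [(isOpen_extChartAt_source (I := 𝓡 d) x).mem_nhds h3] with z hz
    exact e.left_inv hz
  calc pullForm e (dForm β) y = pullForm e (pullForm e.symm α) y := by
        rw [pullForm, pullForm, dForm_vectorSpace, h1]
        rfl
    _ = pullForm (e.symm ∘ e) α y :=
        (pullForm_comp_eq α (h2.mdifferentiableAt (by simp)) (hy.mdifferentiableAt (by simp))).symm
    _ = α y := by rw [pullForm_congr_at α h4, pullForm_id]

end DeligneGroupoid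

/-! ### Logarithms, the exponential sequence and the de Rham resolution -/

namespace DeligneGroupoid

section ZeroForms

set_option linter.unusedSectionVars false

variable {d : ℕ} {M : Type*} [TopologicalSpace M] [ChartedSpace (EuclideanSpace ℝ (Fin d)) M]

/-- The function underlying a `0`-form. -/
noncomputable def ofZeroForm (α : M → FormFiber d 0) : M → ℂ := fun x => α x 0

theorem zeroForm_ofZeroForm (α : M → FormFiber d 0) : zeroForm (ofZeroForm α) = α := by
  funext x
  ext v
  exact congrArg (α x) (Subsingleton.elim _ _)

theorem localForm_ofZeroForm (α : M → FormFiber d 0) (x : M) :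
    ofZeroForm (localForm α x) = ofZeroForm α ∘ (extChartAt (𝓡 d) x).symm := by
  funext v
  exact congrArg (α _) (Subsingleton.elim _ _)

variable [IsManifold (𝓡 d) ∞ M]

theorem contMDiffAt_of_comp_symm {w : M → ℂ} {x : M}
    (h : ContDiffAt ℝ ∞ (w ∘ (extChartAt (𝓡 d) x).symm) (extChartAt (𝓡 d) x x)) :
    ContMDiffAt (𝓡 d) 𝓘(ℝ, ℂ) ∞ w x := by
  have h1 := ContMDiffAt.comp (g := w ∘ (extChartAt (𝓡 d) x).symm) x h.contMDiffAt
    (contMDiffAt_extChartAt (I := 𝓡 d) (n := ∞) (x := x))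
  refine h1.congr_of_eventuallyEq ?_
  filter_upwards [extChartAt_source_mem_nhds (I := 𝓡 d) x] with y hy
  simp only [Function.comp_apply, (extChartAt (𝓡 d) x).left_inv hy]

theorem SmoothFormAt.ofZeroForm {α : M → FormFiber d 0} {x : M} (h : SmoothFormAt α x) :
    ContMDiffAt (𝓡 d) 𝓘(ℝ, ℂ) ∞ (ofZeroForm α) x := by
  refine contMDiffAt_of_comp_symm ?_
  rw [← localForm_ofZeroForm]
  exact (ContinuousAlternatingMap.constOfIsEmptyLIE ℝ (EuclideanSpace ℝ (Fin d)) ℂ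
    (Fin 0)).symm.contDiff.contDiffAt.comp _ h

/-- In the chart at `x` the derivative vanishes on a ball, which is connected. -/
theorem eventually_eq_of_dForm_zeroForm_eq_zero {w : M → ℂ} {x : M}
    (hw : ∀ᶠ y in 𝓝 x, ContMDiffAt (𝓡 d) 𝓘(ℝ, ℂ) ∞ w y)
    (h : ∀ᶠ y in 𝓝 x, dForm (zeroForm (d := d) w) y = 0) : ∀ᶠ y in 𝓝 x, w y = w x := by
  set e := extChartAt (𝓡 d) x
  have t1 : Tendsto e.symm (𝓝 (e x)) (𝓝 x) := by
    have := (continuousAt_extChartAt_symm (I := 𝓡 d) x).tendsto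
    rwa [extChartAt_to_inv x] at this
  have h1 : ∀ᶠ v in 𝓝 (e x), DifferentiableAt ℝ (w ∘ e.symm) v ∧ fderiv ℝ (w ∘ e.symm) v = 0 := by
    filter_upwards [localForm_dForm (hw.mono fun y hy => smoothFormAt_zeroForm (d := d) hy),
      t1.eventually (hw.and h), eventually_smooth_symm x] with v h1 h2 h3
    refine ⟨?_, ?_⟩
    · exact (contMDiffAt_iff_contDiffAt.1 (h2.1.comp v h3)).differentiableAt (by simp)
    · have h4 : localForm (dForm (zeroForm (d := d) w)) x v = 0 := by
        rw [localForm, pullForm, h2.2]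
        rfl
      rw [h1, localForm, pullForm_zeroForm] at h4
      have h5 := (extDeriv_constOfIsEmpty (w ∘ e.symm) v).symm.trans h4
      ext u
      exact congrArg (fun f => f fun _ => u) h5
  obtain ⟨r, hr, hball⟩ := Metric.nhds_basis_ball.mem_iff.1 h1
  have t2 : Tendsto e (𝓝 x) (𝓝 (e x)) := (continuousAt_extChartAt (I := 𝓡 d) x).tendsto
  filter_upwards [t2.eventually (Metric.ball_mem_nhds _ hr),
    extChartAt_source_mem_nhds (I := 𝓡 d) x] with y hy hys
  have h2 := Metric.isOpen_ball.is_const_of_fderiv_eq_zero (𝕜 := ℝ) (f := w ∘ e.symm)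
    (convex_ball (e x) r).isPreconnected (fun v hv => (hball hv).1.differentiableWithinAt)
    (fun v hv => (hball hv).2) hy (Metric.mem_ball_self hr)
  simp only [Function.comp_apply, e, extChartAt_to_inv, (extChartAt (𝓡 d) x).left_inv hys] at h2
  exact h2

theorem dlogForm_exp {w : M → ℂ} {x : M} (hw : ContMDiffAt (𝓡 d) 𝓘(ℝ, ℂ) ∞ w x) (c : ℂ) :
    dlogForm (d := d) (fun y => Additive.ofMul (Units.mk0 (Complex.exp (c * w y))
      (Complex.exp_ne_zero _))) x = c • dForm (zeroForm w) x := by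
  rw [dlogForm, dForm_zeroForm, dForm_zeroForm]
  have hd := (contDiffAt_comp_chart hw).differentiableAt (by simp)
  have hey : (extChartAt (𝓡 d) x).symm (extChartAt (𝓡 d) x x) = x := extChartAt_to_inv x
  have h2 : fderiv ℝ ((fun y => Complex.exp (c * w y)) ∘ (extChartAt (𝓡 d) x).symm)
      (extChartAt (𝓡 d) x x) = _ := (hd.hasFDerivAt.const_mul c).cexp.fderiv
  simp only [toMul_ofMul, Units.val_mk0]
  rw [h2]
  ext v
  simp only [Function.comp_apply, hey]
  simp

theorem smoothUnitAt_exp {w : M → ℂ} {x : M} (hw : ContMDiffAt (𝓡 d) 𝓘(ℝ, ℂ) ∞ w x) (c : ℂ) :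
    SmoothUnitAt d (fun y => Additive.ofMul (Units.mk0 (Complex.exp (c * w y))
      (Complex.exp_ne_zero _))) x := by
  have h : ContDiff ℝ ∞ fun z : ℂ => Complex.exp (c * z) :=
    (contDiff_const.mul contDiff_id).cexp
  exact h.contMDiff.contMDiffAt.comp x hw

theorem exists_exp_eventuallyEq {u : M → Additive ℂˣ} {x : M}
    (hu : ∀ᶠ y in 𝓝 x, SmoothUnitAt d u y) {c : ℂ} (hc : c ≠ 0) :
    ∃ w : M → ℂ, (∀ᶠ y in 𝓝 x, ContMDiffAt (𝓡 d) 𝓘(ℝ, ℂ) ∞ w y) ∧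
      ∀ᶠ y in 𝓝 x, Complex.exp (c * w y) = ((u y).toMul : ℂ) := by
  set b : ℂ := ((u x).toMul : ℂ) with hb
  have hb0 : b ≠ 0 := Units.ne_zero _
  have hsl : ∀ᶠ y in 𝓝 x, b⁻¹ * ((u y).toMul : ℂ) ∈ Complex.slitPlane := by
    refine (continuousAt_const.mul hu.self_of_nhds.continuousAt).eventually
      (Complex.isOpen_slitPlane.mem_nhds ?_)
    show b⁻¹ * b ∈ _
    rw [inv_mul_cancel₀ hb0]
    exact Complex.one_mem_slitPlane
  -- Dividing by the value `b` at `x` brings the nearby values close to `1`, where the principal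
  -- logarithm is smooth; `Complex.log b` restores the factor.
  refine ⟨fun y => c⁻¹ * (Complex.log (b⁻¹ * ((u y).toMul : ℂ)) + Complex.log b), ?_, ?_⟩
  · filter_upwards [hu, hsl] with y hy hs
    have h1 : ContDiffAt ℝ ∞ (fun z => c⁻¹ * (Complex.log (b⁻¹ * z) + Complex.log b))
        ((u y).toMul : ℂ) :=
      contDiffAt_const.mul ((ContDiffAt.comp (g := Complex.log) _
        ((Complex.contDiffAt_log hs).restrict_scalars ℝ)
        (contDiffAt_const.mul contDiffAt_id)).add contDiffAt_const)
    exact ContMDiffAt.comp (g := fun z => c⁻¹ * (Complex.log (b⁻¹ * z) + Complex.log b)) y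
      h1.contMDiffAt hy
  · refine Eventually.of_forall fun y => ?_
    show Complex.exp (c * (c⁻¹ * _)) = _
    rw [mul_inv_cancel_left₀ hc, Complex.exp_add, Complex.exp_log hb0,
      Complex.exp_log (mul_ne_zero (inv_ne_zero hb0) (Units.ne_zero _)), mul_comm,
      mul_inv_cancel_left₀ hb0]

theorem SmoothFormAt.const_smul {k : ℕ} {α : M → FormFiber d k} {x : M} (c : ℂ)
    (hα : SmoothFormAt α x) : SmoothFormAt (fun y => c • α y) x :=
  ContDiffAt.const_smul c hα

theorem dForm_const_smul {k : ℕ} {α : M → FormFiber d k} {x : M} (c : ℂ)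
    (hα : SmoothFormAt α x) : dForm (fun y => c • α y) x = c • dForm α x := by
  have h : localForm (fun y => c • α y) x = c • localForm α x := rfl
  have h1 : DifferentiableAt ℝ (localForm α x) (extChartAt (𝓡 d) x x) :=
    hα.differentiableAt (by simp)
  rw [dForm, h, extDeriv, fderiv_const_smul h1,
    ContinuousAlternatingMap.alternatizeUncurryFin_smul]
  rfl

end ZeroForms

/-- The values of `c * w` near `x` are integral multiples of 2πi, so they differ by at least 2π or
not at all; continuity excludes the former. -/
theorem eventually_eq_of_exp_eq_one {X : Type*} [TopologicalSpace X] {w : X → ℂ} {x : X}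
    (hw : ContinuousAt w x) {c : ℂ} (hc : c ≠ 0)
    (h : ∀ᶠ y in 𝓝 x, Complex.exp (c * w y) = 1) : ∀ᶠ y in 𝓝 x, w y = w x := by
  have h1 : ContinuousAt (fun y => ‖c * w y - c * w x‖) x :=
    ((continuousAt_const.mul hw).sub continuousAt_const).norm
  have h2 : ∀ᶠ y in 𝓝 x, ‖c * w y - c * w x‖ < 1 :=
    h1.eventually (gt_mem_nhds (by simp))
  filter_upwards [h, h2] with y hy hy2
  obtain ⟨m, hm⟩ := Complex.exp_eq_one_iff.1 (show Complex.exp (c * w y - c * w x) = 1 by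
    rw [Complex.exp_sub, hy, h.self_of_nhds, div_one])
  rw [hm] at hy2
  have hm0 : m = 0 := by
    by_contra hne
    have h3 : (1 : ℝ) ≤ ‖(m : ℂ)‖ := by
      rw [Complex.norm_intCast]
      exact_mod_cast Int.one_le_abs hne
    have h4 : ‖(2 * Real.pi * Complex.I : ℂ)‖ = 2 * Real.pi := by
      simp [Real.pi_pos.le]
    rw [norm_mul, h4] at hy2
    nlinarith [Real.two_le_pi]
  rw [hm0, Int.cast_zero, zero_mul, sub_eq_zero] at hm
  exact mul_left_cancel₀ hc hm

variable {d : ℕ} {X₀ X₁ : Type u}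
  [TopologicalSpace X₀] [ChartedSpace (EuclideanSpace ℝ (Fin d)) X₀]
  [TopologicalSpace X₁] [ChartedSpace (EuclideanSpace ℝ (Fin d)) X₁]
  {G : SmoothEtaleGroupoid d X₀ X₁}

namespace FunctionSheafData.Operator

open GSheaf

variable {A B C : Type} [AddCommGroup A] [AddCommGroup B] [AddCommGroup C]
  {D : FunctionSheafData G A} {D' : FunctionSheafData G B} {D'' : FunctionSheafData G C}

theorem exists_local_lift (L : Operator D D') {U : EtaleSite G} (b : D'.sheaf.Sections U) {x : X₀}
    (hx : x ∈ U.carrier) {f : X₀ → A} (hf : ∀ᶠ y in 𝓝 x, D.IsSection f y)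
    (h : L.op f =ᶠ[𝓝 x] extendZero U.carrier (toFun b)) :
    ∃ (W : EtaleSite G) (hW : W.carrier ≤ U.carrier), x ∈ W.carrier ∧
      ∃ a : D.sheaf.Sections W, mapSections L.hom W a = D'.sheaf.pull (EtaleSite.incl hW) b := by
  obtain ⟨W, hW, hWo, hxW⟩ := eventually_nhds_iff.1 ((hf.and h).and (U.carrier.isOpen.mem_nhds hx))
  refine ⟨⟨⟨W, hWo⟩⟩, fun y hy => (hW y hy).2, hxW, ofFun f fun y hy => (hW y hy).1.1,
    toFun_injective (funext fun y => ?_)⟩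
  rw [toFun_hom_ofFun, toFun_pull_incl]
  exact (hW y y.2).1.2.trans (extendZero_apply_mem _ _)

theorem eventually_isSection_toFun {U : EtaleSite G} (b : D.sheaf.Sections U) {x : X₀}
    (hx : x ∈ U.carrier) : ∀ᶠ y in 𝓝 x, D.IsSection (extendZero U.carrier (toFun b)) y :=
  by
  filter_upwards [U.carrier.isOpen.mem_nhds hx] with y hy using isSection_toFun b ⟨y, hy⟩

/-- Epimorphisms of sheaves are tested on local sections, so a statement about germs of functions
suffices, and calculus on the manifold applies. `exact_hom` below does the same for exactness. -/
theorem epi_hom (L : Operator D D')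
    (h : ∀ (g : X₀ → B) (x : X₀), (∀ᶠ y in 𝓝 x, D'.IsSection g y) →
      ∃ f : X₀ → A, (∀ᶠ y in 𝓝 x, D.IsSection f y) ∧ L.op f =ᶠ[𝓝 x] g) : Epi L.hom := by
  refine epi_of_local_lift _ fun U b x hx => ?_
  obtain ⟨f, hf, hfg⟩ := h _ x (eventually_isSection_toFun b hx)
  exact L.exists_local_lift b hx hf hfg

theorem mono_hom (L : Operator D D') (h : ∀ (f : X₀ → A) (x : X₀), L.op f x = 0 → f x = 0) :
    Mono L.hom := by
  refine mono_of_injective _ fun U => (injective_iff_map_eq_zero _).2 fun a ha =>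
    toFun_injective (funext fun x => ?_)
  have h1 := h _ _ ((toFun_hom L a x).symm.trans (congrArg (fun a => toFun a x) ha))
  rwa [extendZero_apply] at h1

theorem exact_hom (L : Operator D D') (L' : Operator D' D'') (hLL' : L.hom ≫ L'.hom = 0)
    (h : ∀ (g : X₀ → B) (x : X₀), (∀ᶠ y in 𝓝 x, D'.IsSection g y) →
      (∀ᶠ y in 𝓝 x, L'.op g y = 0) →
      ∃ f : X₀ → A, (∀ᶠ y in 𝓝 x, D.IsSection f y) ∧ L.op f =ᶠ[𝓝 x] g) :
    (ShortComplex.mk L.hom L'.hom hLL').Exact := by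
  refine exact_of_local_lift fun U b hb x hx => ?_
  obtain ⟨f, hf, hfg⟩ := h _ x (eventually_isSection_toFun b hx) (by
    filter_upwards [U.carrier.isOpen.mem_nhds hx] with y hy
    exact (toFun_hom L' b ⟨y, hy⟩).symm.trans
      (congrArg (fun a => toFun (D := D'') a ⟨y, hy⟩) hb))
  exact L.exists_local_lift b hx hf hfg

theorem hom_comp_hom_eq {E : Type} [AddCommGroup E] {D₃ : FunctionSheafData G E}
    (L : Operator D D') (L' : Operator D' D'') (K : Operator D D₃) (K' : Operator D₃ D'')
    (h : ∀ (f : X₀ → A) (x : X₀), (∀ᶠ y in 𝓝 x, D.IsSection f y) →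
      L'.op (L.op f) x = K'.op (K.op f) x) : L.hom ≫ L'.hom = K.hom ≫ K'.hom := by
  refine hom_ext_mapSections fun U a => toFun_injective (funext fun x => ?_)
  have h1 := h _ _ (eventually_isSection_toFun a x.2)
  rw [mapSections_comp, mapSections_comp, toFun_hom_of_eventuallyEq L' _ x
    (Eventually.of_forall fun y hy => toFun_hom L a ⟨y, hy⟩), h1,
    toFun_hom_of_eventuallyEq K' _ x (Eventually.of_forall fun y hy => toFun_hom K a ⟨y, hy⟩)]

end FunctionSheafData.Operator

open FunctionSheafData

section Operators

open GSheaf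

variable [IsManifold (𝓡 d) ∞ X₀] [IsManifold (𝓡 d) ∞ X₁] (G)

/-- The inclusion of the locally constant functions with values in `A`, via a homomorphism to `ℂ`,
into the `0`-forms. -/
noncomputable def valueOperator {A : Type} [AddCommGroup A] (ι : A →+ ℂ) :
    Operator (constData G A) (formData G 0) where
  op f := zeroForm fun x => ι (f x)
  congr h := by simp only [zeroForm, h.self_of_nhds]
  add _ _ := by ext v; simp [zeroForm]
  isSection {f x} hf := by
    refine smoothFormAt_zeroForm (ContMDiffAt.congr_of_eventuallyEq
      (f := fun _ => ι (f x)) contMDiffAt_const ?_)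
    exact hf.self_of_nhds.mono fun y hy => by simp only [hy]
  equivariant σ x f hf := by
    simp only [zeroForm]
    rw [extendZero_apply]
    rfl

/-- Multiplication of forms by a complex number. -/
noncomputable def scaleOperator (c : ℂ) (k : ℕ) : Operator (formData G k) (formData G k) where
  op α x := c • α x
  congr h := by simp only [h.self_of_nhds]
  add _ _ := smul_add _ _ _
  isSection hα := SmoothFormAt.const_smul c hα.self_of_nhds
  equivariant σ x α hα := by
    rw [extendZero_apply]
    rfl

/-- The operator `w ↦ exp (c w)`. -/
noncomputable def expOperator (c : ℂ) : Operator (formData G 0) (unitsData G) where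
  op α x := Additive.ofMul (Units.mk0 (Complex.exp (c * ofZeroForm α x)) (Complex.exp_ne_zero _))
  congr h := by simp only [ofZeroForm, h.self_of_nhds]
  add {α η x} _ _ := by
    have h : ofZeroForm (α + η) x = ofZeroForm α x + ofZeroForm η x := rfl
    refine Additive.toMul.injective (Units.ext ?_)
    simp [h, mul_add, Complex.exp_add]
  isSection hα := smoothUnitAt_exp hα.self_of_nhds.ofZeroForm c
  equivariant σ x α hα := by
    refine Additive.toMul.injective (Units.ext (congrArg (fun z => Complex.exp (c * z)) ?_))
    exact (congrArg (fun β : FormFiber d 0 => β 0) (extendZero_apply _ x)).trans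
      (congrArg (α _) (Subsingleton.elim _ _))

/-- The inclusion of the locally constant functions into the `0`-forms. -/
noncomputable def valueHom {A : Type} [AddCommGroup A] (ι : A →+ ℂ) :
    constSheaf G A ⟶ formSheaf G 0 := (valueOperator G ι).hom

/-- Multiplication by a complex number on the sheaf of forms. -/
noncomputable def scaleHom (c : ℂ) (k : ℕ) : formSheaf G k ⟶ formSheaf G k :=
  (scaleOperator G c k).hom

/-- The morphism `w ↦ exp (c w)` from functions to units. -/
noncomputable def expHom (c : ℂ) : formSheaf G 0 ⟶ unitsSheaf G := (expOperator G c).hom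

theorem scaleHom_comp_scaleHom {b c : ℂ} (h : c * b = 1) (k : ℕ) :
    scaleHom G b k ≫ scaleHom G c k = 𝟙 _ := by
  refine hom_ext_mapSections fun U a => toFun_injective (D := formData G k) (funext fun x => ?_)
  refine (toFun_hom_of_eventuallyEq (scaleOperator G c k) _ x
    (Eventually.of_forall fun y hy => toFun_hom (scaleOperator G b k) a ⟨y, hy⟩)).trans ?_
  refine (smul_smul c b _).trans ?_
  rw [h, one_smul]
  exact extendZero_apply _ _

instance isIso_scaleHom (c : ℂˣ) (k : ℕ) : IsIso (scaleHom G c k) :=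
  ⟨scaleHom G (c⁻¹ : ℂˣ) k, scaleHom_comp_scaleHom G (by simp) k,
    scaleHom_comp_scaleHom G (by simp) k⟩

theorem scaleHom_comp_dHom (c : ℂ) (k : ℕ) :
    scaleHom G c k ≫ dHom G k = dHom G k ≫ scaleHom G c (k + 1) :=
  Operator.hom_comp_hom_eq (scaleOperator G c k) (dOperator G k) (dOperator G k)
    (scaleOperator G c (k + 1)) fun _ _ hα => dForm_const_smul c hα.self_of_nhds

theorem expHom_comp_dlogHom (c : ℂ) :
    expHom G c ≫ dlogHom G = dHom G 0 ≫ scaleHom G c 1 :=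
  Operator.hom_comp_hom_eq (expOperator G c) (dlogOperator G) (dOperator G 0)
    (scaleOperator G c 1) fun α x hα => by
      refine (dlogForm_exp hα.self_of_nhds.ofZeroForm c).trans ?_
      rw [zeroForm_ofZeroForm]
      rfl

theorem mono_valueHom {A : Type} [AddCommGroup A] {ι : A →+ ℂ} (hι : Function.Injective ι) :
    Mono (valueHom G ι) :=
  Operator.mono_hom _ fun f x h => by
    have h1 : ι (f x) = 0 := congrArg (fun α : FormFiber d 0 => α 0) h
    exact (map_eq_zero_iff ι hι).1 h1

theorem epi_expHom {c : ℂ} (hc : c ≠ 0) : Epi (expHom G c) :=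
  Operator.epi_hom _ fun u x hu => by
    obtain ⟨w, hw, hwu⟩ := exists_exp_eventuallyEq (d := d) hu hc
    refine ⟨zeroForm w, hw.mono fun y hy => smoothFormAt_zeroForm hy, hwu.mono fun y hy => ?_⟩
    exact Additive.toMul.injective (Units.ext hy)

theorem valueHom_comp_expHom {A : Type} [AddCommGroup A] {ι : A →+ ℂ} {c : ℂ}
    (h : ∀ a, Complex.exp (c * ι a) = 1) : valueHom G ι ≫ expHom G c = 0 :=
  Operator.hom_comp_hom _ _ fun f x _ => Additive.toMul.injective (Units.ext (h (f x)))

/-- The exponential sequence. -/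
theorem shortExact_exp {A : Type} [AddCommGroup A] {ι : A →+ ℂ} (hι : Function.Injective ι) {c : ℂ}
    (hc : c ≠ 0) (h : ∀ z, Complex.exp (c * z) = 1 ↔ z ∈ ι.range) :
    (ShortComplex.mk (valueHom G ι) (expHom G c)
      (valueHom_comp_expHom G fun a => (h _).2 ⟨a, rfl⟩)).ShortExact where
  exact := Operator.exact_hom (valueOperator G ι) (expOperator G c) _ fun α x hα hα' => by
    have h1 : ∀ᶠ y in 𝓝 x, Complex.exp (c * ofZeroForm α y) = 1 := hα'.mono fun y hy =>
      congrArg (fun u : Additive ℂˣ => (u.toMul : ℂ)) hy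
    obtain ⟨a, ha⟩ := (h _).1 h1.self_of_nhds
    refine ⟨fun _ => a, Eventually.of_forall fun _ => Eventually.of_forall fun _ => rfl, ?_⟩
    have h2 := eventually_eq_of_exp_eq_one
      (SmoothFormAt.ofZeroForm (α := α) hα.self_of_nhds).continuousAt hc h1
    filter_upwards [h2] with y hy
    rw [← zeroForm_ofZeroForm α]
    simp only [zeroForm, hy, ← ha]
    rfl
  mono_f := mono_valueHom G hι
  epi_g := epi_expHom G hc

theorem mono_unitsInclHom : Mono (unitsInclHom G) :=
  Operator.mono_hom (unitsInclOperator G) fun _ _ h => h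

/-- Since u is invertible, d log u = 0 means du = 0, and `u` is locally constant. -/
theorem exact_unitsInclHom_dlogHom :
    (ShortComplex.mk (unitsInclHom G) (dlogHom G) (unitsInclHom_comp_dlogHom G)).Exact :=
  Operator.exact_hom (unitsInclOperator G) (dlogOperator G) _ fun u x hu h => by
    refine ⟨u, ?_, EventuallyEq.rfl⟩
    have h1 : ∀ᶠ y in 𝓝 x, dForm (zeroForm (d := d) fun y => ((u y).toMul : ℂ)) y = 0 :=
      h.mono fun y hy => (smul_eq_zero.1 hy).resolve_left (inv_ne_zero (Units.ne_zero _))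
    have h2 := eventually_eq_of_dForm_zeroForm_eq_zero hu h1
    refine (eventually_eventually_nhds.2 h2).mono fun y hy => ?_
    refine hy.mono fun z hz => Additive.toMul.injective (Units.ext ?_)
    exact hz.trans hy.self_of_nhds.symm

/-- A closed 1-form is locally dβ by the Poincaré lemma, and dβ = d log exp β. -/
theorem exact_dlogHom_dHom :
    (ShortComplex.mk (dlogHom G) (dHom G 1) (dlogHom_comp_dHom G)).Exact :=
  Operator.exact_hom (dlogOperator G) (dOperator G 1) _ fun α x hα h => by
    obtain ⟨β, hβ, hβα⟩ := exists_dForm_eventuallyEq hα h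
    refine ⟨(expOperator G 1).op β, hβ.mono fun y hy => smoothUnitAt_exp hy.ofZeroForm 1, ?_⟩
    filter_upwards [hβ, hβα] with y hy hy2
    refine (dlogForm_exp hy.ofZeroForm 1).trans ?_
    rw [one_smul, zeroForm_ofZeroForm, hy2]

theorem exact_dHom_dHom (k : ℕ) :
    (ShortComplex.mk (dHom G k) (dHom G (k + 1)) (dHom_comp_dHom G k)).Exact :=
  Operator.exact_hom (dOperator G k) (dOperator G (k + 1)) _ fun _ _ hα h =>
    exists_dForm_eventuallyEq hα h

end Operators

end DeligneGroupoid

/-! ### Terms, differentials and exactness of the truncated complexes -/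

namespace DeligneGroupoid

variable {d : ℕ} {X₀ X₁ : Type u}
  [TopologicalSpace X₀] [ChartedSpace (EuclideanSpace ℝ (Fin d)) X₀]
  [TopologicalSpace X₁] [ChartedSpace (EuclideanSpace ℝ (Fin d)) X₁]
  [IsManifold (𝓡 d) ∞ X₀] [IsManifold (𝓡 d) ∞ X₁] (G : SmoothEtaleGroupoid d X₀ X₁)

section Cutoff

set_option linter.unusedSectionVars false

open Limits

variable (K : CochainComplex (GSheaf G) ℕ)

/-- The terms of the truncated complex that are not deleted. -/
noncomputable def cutoffXIso {m i : ℤ} {j k : ℕ} (h : (j : ℤ) = i) (hk : m - k = i) :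
    (cutoff G K m).obj.X i ≅ K.X j :=
  HomologicalComplex.stupidTruncXIso _ (ComplexShape.embeddingUpIntLE m) (i := k) hk ≪≫
    HomologicalComplex.extendXIso _ ComplexShape.embeddingUpNat (i := j) h

/-- Each surviving degree `i` carries two labels: `j` counts upward from `0`, for the extension to
integer degrees, and `k` counts downward from `m`, for the truncation. -/
theorem cutoff_d_eq {m i i' : ℤ} {j k j' k' : ℕ} (h : (j : ℤ) = i) (hk : m - k = i)
    (h' : (j' : ℤ) = i') (hk' : m - k' = i') :
    (cutoff G K m).obj.d i i' =
      (cutoffXIso G K h hk).hom ≫ K.d j j' ≫ (cutoffXIso G K h' hk').inv := by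
  refine (stupidTrunc_d_eq G _ hk hk').trans ?_
  rw [K.extend_d_eq ComplexShape.embeddingUpNat h h']
  simp only [Category.assoc]
  exact (Category.assoc _ _ _).symm

theorem cutoffXIso_inv_comp_d {m i i' : ℤ} {j k j' k' : ℕ} (h : (j : ℤ) = i) (hk : m - k = i)
    (h' : (j' : ℤ) = i') (hk' : m - k' = i') :
    (cutoffXIso G K h hk).inv ≫ (cutoff G K m).obj.d i i' =
      K.d j j' ≫ (cutoffXIso G K h' hk').inv := by
  rw [cutoff_d_eq G K h hk h' hk', Iso.inv_hom_id_assoc]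

theorem isZero_cutoff_X_of_lt {m i : ℤ} (h : m < i) : IsZero ((cutoff G K m).obj.X i) :=
  HomologicalComplex.isZero_stupidTrunc_X _ _ i fun j hj => by
    have : m - j = i := hj
    lia

instance isStrictlyGE_cutoff (m : ℤ) : (cutoff G K m).obj.IsStrictlyGE 0 :=
  inferInstanceAs (CochainComplex.IsStrictlyGE ((K.extend ComplexShape.embeddingUpNat).stupidTrunc
    (ComplexShape.embeddingUpIntLE m)) 0)

variable {G K} in
-- The bound keeps all three degrees `j`, `j + 1`, `j + 2`. In the top degree `m` the outgoing
-- differential has been cut away and exactness of the original complex says nothing.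
theorem exactAt_cutoff {m : ℤ} {j : ℕ} (hm : (j : ℤ) + 2 ≤ m)
    (h : (ShortComplex.mk (K.d j (j + 1)) (K.d (j + 1) (j + 2)) (K.d_comp_d _ _ _)).Exact) :
    (cutoff G K m).obj.ExactAt (j + 1) := by
  rw [HomologicalComplex.exactAt_iff' _ (j : ℤ) (j + 1) (j + 2) (by simp)
    (by rw [CochainComplex.next]; lia)]
  have hk (l : ℤ) (hl : l ≤ m) : m - ((m - l).toNat : ℕ) = l := by lia
  have h0 := hk j (by lia)
  have h1 := hk (j + 1) (by lia)
  have h2 := hk (j + 2) (by lia)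
  refine ShortComplex.exact_of_iso (ShortComplex.isoMk (cutoffXIso G K rfl h0).symm
    (cutoffXIso G K (j := j + 1) (by push_cast; rfl) h1).symm
    (cutoffXIso G K (j := j + 2) (by push_cast; rfl) h2).symm ?_ ?_) h
  · exact cutoffXIso_inv_comp_d G K _ _ _ _
  · exact cutoffXIso_inv_comp_d G K _ _ _ _

end Cutoff

theorem unitsComplex_X_pos {n : ℕ} {i : ℤ} (h0 : 0 < i) (hi : i < n) :
    ∃ k, Nonempty ((unitsComplex G n).obj.X i ≅ formSheaf G k) := by
  obtain ⟨j, rfl⟩ : ∃ j : ℕ, (j : ℤ) + 1 = i := ⟨(i - 1).toNat, by lia⟩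
  exact ⟨j + 1, ⟨cutoffXIso G (unitsDeRham G) (j := j + 1) (k := n - 1 - (j + 1))
    (by push_cast; rfl) (by lia)⟩⟩

theorem unitsDeRham_d (k : ℕ) : (unitsDeRham G).d k (k + 1) = unitsDeRhamD G k :=
  CochainComplex.of_d (unitsDeRhamX G) (unitsDeRhamD G) k

theorem integersDeRham_d (n k : ℕ) : (integersDeRham G n).d k (k + 1) = integersDeRhamD G n k :=
  CochainComplex.of_d (integersDeRhamX G n) (integersDeRhamD G n) k

theorem exact_unitsDeRhamD : ∀ k : ℕ,
    (ShortComplex.mk (unitsDeRhamD G k) (unitsDeRhamD G (k + 1)) (unitsDeRhamD_comp G k)).Exact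
  | 0 => exact_dlogHom_dHom G
  | k + 1 => exact_dHom_dHom G (k + 1)

theorem exactAt_unitsComplex {n : ℕ} {i : ℤ} (h0 : 0 < i) (hi : i < n - 1) :
    (unitsComplex G n).obj.ExactAt i := by
  obtain ⟨j, rfl⟩ : ∃ j : ℕ, (j : ℤ) + 1 = i := ⟨(i - 1).toNat, by lia⟩
  refine exactAt_cutoff (by lia) ?_
  refine ShortComplex.exact_of_iso (ShortComplex.isoMk (S₁ := .mk _ _ (unitsDeRhamD_comp G j))
    (Iso.refl _) (Iso.refl _) (Iso.refl _) ?_ ?_) (exact_unitsDeRhamD G j)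
  · exact (Category.id_comp _).trans ((unitsDeRham_d G j).trans (Category.comp_id _).symm)
  · exact (Category.id_comp _).trans ((unitsDeRham_d G (j + 1)).trans (Category.comp_id _).symm)

/-- For `2 ≤ n` the 1-forms survive the truncation, so the differential out of degree `0` is really
d log. -/
theorem exact_unitsIncl_unitsComplex_d {n : ℕ} (hn : 2 ≤ n) :
    (ShortComplex.mk _ _ (unitsIncl_comp_unitsComplex_d G (n := n) (by lia))).Exact := by
  refine ShortComplex.exact_of_iso (ShortComplex.isoMk
    (S₁ := .mk _ _ (unitsInclHom_comp_dlogHom G)) (Iso.refl _)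
    (unitsComplexXZero G (n := n) (by lia)).symm
    (cutoffXIso G (unitsDeRham G) (m := n - 1) (j := 1) (k := n - 2) rfl (by lia)).symm ?_ ?_)
    (exact_unitsInclHom_dlogHom G)
  · exact Category.id_comp _
  · refine (cutoffXIso_inv_comp_d G (unitsDeRham G) (m := n - 1) (j := 0) (k := n - 1)
      (k' := n - 2) rfl (by lia) rfl
      (by lia)).trans ?_
    rw [unitsDeRham_d G 0]
    rfl

end DeligneGroupoid

/-! ### The exponential morphism from the Deligne complex to the complex of units -/

namespace DeligneGroupoid

variable {d : ℕ} {X₀ X₁ : Type u}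
  [TopologicalSpace X₀] [ChartedSpace (EuclideanSpace ℝ (Fin d)) X₀]
  [TopologicalSpace X₁] [ChartedSpace (EuclideanSpace ℝ (Fin d)) X₁]
  [IsManifold (𝓡 d) ∞ X₀] [IsManifold (𝓡 d) ∞ X₁] (G : SmoothEtaleGroupoid d X₀ X₁)

/-- The morphism from the shifted Deligne complex to the complex of units, term by term: the
exponential in degree `0` and multiplication by a constant, up to sign, in positive degrees. -/
noncomputable def expTerm (n : ℕ) (c : ℂ) : ∀ j : ℕ, integersDeRhamX G n (j + 1) ⟶ unitsDeRhamX G j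
  | 0 => expHom G c
  | j + 1 => scaleHom G ((-1) ^ (j + 1) * c) (j + 1)

theorem scaleHom_neg (c : ℂ) (k : ℕ) : scaleHom G (-c) k = -scaleHom G c k := by
  refine GSheaf.hom_ext_mapSections fun U a =>
    FunctionSheafData.toFun_injective (D := formData G k) (funext fun x => ?_)
  exact neg_smul c (extendZero U.carrier (FunctionSheafData.toFun (D := formData G k) a) x)

theorem dHom_comp_scaleHom_eq_neg {b c : ℂ} (h : b = -c) (k : ℕ) :
    dHom G k ≫ scaleHom G c (k + 1) = -(dHom G k ≫ scaleHom G b (k + 1)) := by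
  rw [h, scaleHom_neg]
  exact (neg_eq_iff_eq_neg.2 (Preadditive.comp_neg (dHom G k) (scaleHom G c (k + 1)))).symm

/-- The shift by one changes the sign of the differential, so the terms must anticommute with the
unshifted differentials. The alternating signs in `expTerm` are chosen for this; the constant `c`
itself comes from d log exp(cw) = c dw. -/
theorem expTerm_comp_d (n : ℕ) (c : ℂ) : ∀ j : ℕ,
    expTerm G n c j ≫ unitsDeRhamD G j =
      -(integersDeRhamD G n (j + 1) ≫ expTerm G n c (j + 1))
  | 0 => (expHom_comp_dlogHom G c).trans (dHom_comp_scaleHom_eq_neg G (by ring) 0)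
  | j + 1 => (scaleHom_comp_dHom G _ (j + 1)).trans (dHom_comp_scaleHom_eq_neg G (by ring) (j + 1))

theorem isIso_expTerm (n : ℕ) {c : ℂ} (hc : c ≠ 0) (j : ℕ) : IsIso (expTerm G n c (j + 1)) :=
  isIso_scaleHom G (Units.mk0 ((-1) ^ (j + 1) * c) (by simp [hc])) (j + 1)

/-- The shifted Deligne complex. -/
noncomputable def shiftedDeligneComplex (n : ℕ) : CochainComplex.Plus (GSheaf G) :=
  ⟨(deligneComplex G n).obj⟦(1 : ℤ)⟧, -1,
    have : (deligneComplex G n).obj.IsStrictlyGE 0 := isStrictlyGE_cutoff G _ _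
    CochainComplex.isStrictlyGE_shift _ 0 1 (-1) (by simp)⟩

section

variable {G} {n : ℕ}

/-- The terms of the shifted Deligne complex. -/
noncomputable def shiftedDeligneXIso {i : ℤ} {j k : ℕ} (h : (j : ℤ) = i + 1)
    (hk : n - k = i + 1) : (shiftedDeligneComplex G n).obj.X i ≅ integersDeRhamX G n j :=
  cutoffXIso G (integersDeRham G n) h hk

/-- The terms of the complex of units. -/
noncomputable def unitsComplexXIso {i : ℤ} {j k : ℕ} (h : (j : ℤ) = i) (hk : (n : ℤ) - 1 - k = i) :
    (unitsComplex G n).obj.X i ≅ unitsDeRhamX G j :=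
  cutoffXIso G (unitsDeRham G) h hk

theorem shiftedDeligneComplex_d {i : ℤ} {j k k' : ℕ} (h : (j : ℤ) = i + 1)
    (hk : n - k = i + 1) (h' : ((j + 1 : ℕ) : ℤ) = i + 1 + 1) (hk' : n - k' = i + 1 + 1) :
    (shiftedDeligneComplex G n).obj.d i (i + 1) =
      -((shiftedDeligneXIso h hk).hom ≫ integersDeRhamD G n j ≫
        (shiftedDeligneXIso (G := G) h' hk').inv) := by
  have h1 := cutoff_d_eq G (integersDeRham G n) h hk h' hk'
  rw [integersDeRham_d] at h1
  refine (CochainComplex.shiftFunctor_obj_d' _ _ _ _).trans ?_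
  rw [Int.negOnePow_one, Units.neg_smul, one_smul]
  exact congrArg Neg.neg h1

theorem unitsComplexXIso_inv_comp_d {i : ℤ} {j k k' : ℕ} (h : (j : ℤ) = i)
    (hk : (n : ℤ) - 1 - k = i) (h' : ((j + 1 : ℕ) : ℤ) = i + 1) (hk' : (n : ℤ) - 1 - k' = i + 1) :
    (unitsComplexXIso h hk).inv ≫ (unitsComplex G n).obj.d i (i + 1) =
      unitsDeRhamD G j ≫ (unitsComplexXIso (G := G) h' hk').inv := by
  have h1 := cutoffXIso_inv_comp_d G (unitsDeRham G) h hk h' hk'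
  rw [unitsDeRham_d] at h1
  exact h1

open Classical in
/-- The terms of `shiftedDeligneToUnits`. -/
noncomputable def shiftedDeligneToUnitsF (c : ℂ) (i : ℤ) :
    (shiftedDeligneComplex G n).obj.X i ⟶ (unitsComplex G n).obj.X i :=
  -- The condition says that `i` lies between `0` and `n - 1`; the labels `j` and `k` are determined
  -- by `i`, so the choice is harmless.
  if h : ∃ j k : ℕ, (j : ℤ) = i ∧ (n : ℤ) - 1 - k = i then
    (shiftedDeligneXIso (j := h.choose + 1) (k := h.choose_spec.choose)
      (by push_cast; rw [h.choose_spec.choose_spec.1])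
      (by linarith [h.choose_spec.choose_spec.2])).hom ≫ expTerm G n c h.choose ≫
      (unitsComplexXIso h.choose_spec.choose_spec.1 h.choose_spec.choose_spec.2).inv
  else 0

theorem shiftedDeligneToUnitsF_eq (c : ℂ) {i : ℤ} {j k : ℕ} (h : (j : ℤ) = i)
    (hk : (n : ℤ) - 1 - k = i) :
    shiftedDeligneToUnitsF (G := G) c i =
      (shiftedDeligneXIso (j := j + 1) (k := k) (by push_cast; rw [h]) (by linarith)).hom ≫
        expTerm G n c j ≫ (unitsComplexXIso h hk).inv := by
  have H : ∃ j k : ℕ, (j : ℤ) = i ∧ (n : ℤ) - 1 - k = i := ⟨j, k, h, hk⟩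
  obtain rfl : H.choose = j := by
    have := H.choose_spec.choose_spec.1
    lia
  obtain rfl : H.choose_spec.choose = k := by
    have := H.choose_spec.choose_spec.2
    lia
  exact dif_pos H

theorem exp_comp_eq_zero {c : ℂ} (hc : ∀ z ∈ twistedIntegers n, Complex.exp (c * z) = 1) :
    integersDeRhamD G n 0 ≫ expTerm G n c 0 = 0 :=
  -- For the inclusion of a subgroup of `ℂ`, `valueHom` is definitionally `inclHom`. The version
  -- with a general homomorphism also covers the constant sheaf of integers.
  valueHom_comp_expHom G (ι := (twistedIntegers n).subtype) fun a => hc a a.2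

theorem shiftedDeligneComplex_d_comp {c : ℂ} (hn : 1 ≤ n)
    (hc : ∀ z ∈ twistedIntegers n, Complex.exp (c * z) = 1) :
    (shiftedDeligneComplex G n).obj.d (-1) 0 ≫ shiftedDeligneToUnitsF c 0 = 0 := by
  have h1 := shiftedDeligneComplex_d (G := G) (n := n) (i := -1) (j := 0) (k := n) (k' := n - 1)
    rfl (by simp) rfl (by lia)
  have h2 := shiftedDeligneToUnitsF_eq (G := G) (n := n) c (i := 0) (j := 0) (k := n - 1) rfl
    (by lia)
  refine (congrArg₂ CategoryStruct.comp h1 h2).trans ?_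
  refine (Preadditive.neg_comp _ _).trans (neg_eq_zero.2 ?_)
  refine (Category.assoc _ _ _).trans ?_
  refine (congrArg (CategoryStruct.comp _) ((Category.assoc _ _ _).trans
    (congrArg (CategoryStruct.comp _) (Iso.inv_hom_id_assoc _ _)))).trans ?_
  refine (congrArg (CategoryStruct.comp _) (Category.assoc _ _ _).symm).trans ?_
  rw [exp_comp_eq_zero hc, Limits.zero_comp, Limits.comp_zero]

/-- The morphism from the shifted Deligne complex to the complex of units. -/
noncomputable def shiftedDeligneToUnits (hn : 1 ≤ n) {c : ℂ}
    (hc : ∀ z ∈ twistedIntegers n, Complex.exp (c * z) = 1) :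
    shiftedDeligneComplex G n ⟶ unitsComplex G n :=
  ObjectProperty.homMk
    { f := shiftedDeligneToUnitsF c
      comm' := by
        rintro i _ rfl
        by_cases h0 : i + 1 < 0
        · have : (unitsComplex G n).obj.IsStrictlyGE 0 := isStrictlyGE_cutoff G _ _
          exact ((unitsComplex G n).obj.isZero_of_isStrictlyGE 0 (i + 1) h0).eq_of_tgt _ _
        by_cases h1 : (n : ℤ) - 1 < i + 1
        · exact (isZero_cutoff_X_of_lt G _ h1).eq_of_tgt _ _
        obtain ⟨k, hk⟩ : ∃ k : ℕ, (n : ℤ) - 1 - k = i + 1 := ⟨(n - 1 - (i + 1)).toNat, by lia⟩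
        -- From degree `-1` to degree `0` commutation means that the exponential kills ℤ(n). In the
        -- remaining degrees it is `expTerm_comp_d`.
        by_cases h2 : i = -1
        · subst h2
          have : (unitsComplex G n).obj.IsStrictlyGE 0 := isStrictlyGE_cutoff G _ _
          have h3 : shiftedDeligneToUnitsF (G := G) (n := n) c (-1) = 0 :=
            ((unitsComplex G n).obj.isZero_of_isStrictlyGE 0 (-1) (by simp)).eq_of_tgt _ _
          rw [h3, Limits.zero_comp]
          exact (shiftedDeligneComplex_d_comp hn hc).symm
        obtain ⟨j, rfl⟩ : ∃ j : ℕ, (j : ℤ) = i := ⟨i.toNat, by lia⟩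
        have e1 := shiftedDeligneToUnitsF_eq (G := G) (n := n) c (i := j) (j := j) (k := k + 1) rfl
          (by push_cast; lia)
        have e2 := shiftedDeligneToUnitsF_eq (G := G) (n := n) c (i := j + 1) (j := j + 1) (k := k)
          (by push_cast; rfl) hk
        have e3 := shiftedDeligneComplex_d (G := G) (n := n) (i := j) (j := j + 1) (k := k + 1)
          (k' := k) (by push_cast; rfl) (by push_cast; lia) (by push_cast; rfl) (by lia)
        have e4 := unitsComplexXIso_inv_comp_d (G := G) (n := n) (i := j) (j := j) (k := k + 1)
          (k' := k) rfl (by push_cast; lia) (by push_cast; rfl) hk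
        rw [e1, e2, Category.assoc, Category.assoc, e4, ← Category.assoc (expTerm G n c j),
          expTerm_comp_d]
        refine Eq.trans ?_ (congrArg (fun f => CategoryStruct.comp f _) e3.symm)
        simp }

end

end DeligneGroupoid

/-! ### The three comparison isomorphisms -/

namespace DeligneGroupoid

/-- The constant such that `exp (c z) = 1` exactly for `z ∈ ℤ(n)`. -/
noncomputable def expConst (n : ℕ) : ℂ := 2 * Real.pi * Complex.I / (2 * Real.pi * Complex.I) ^ n

theorem expConst_ne_zero (n : ℕ) : expConst n ≠ 0 :=
  div_ne_zero Complex.two_pi_I_ne_zero (pow_ne_zero _ Complex.two_pi_I_ne_zero)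

theorem exp_expConst_mul_eq_one_iff (n : ℕ) (z : ℂ) :
    Complex.exp (expConst n * z) = 1 ↔ z ∈ twistedIntegers n := by
  have h : (2 * Real.pi * Complex.I : ℂ) ≠ 0 := Complex.two_pi_I_ne_zero
  rw [Complex.exp_eq_one_iff, twistedIntegers, AddSubgroup.mem_zmultiples_iff]
  refine exists_congr fun m => ?_
  rw [zsmul_eq_mul, expConst]
  generalize (2 * Real.pi * Complex.I : ℂ) = t at h ⊢
  rw [div_mul_eq_mul_div, div_eq_iff (pow_ne_zero _ h), mul_comm t z, mul_right_comm (m : ℂ) t,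
    mul_left_inj' h, eq_comm]

theorem exp_two_pi_I_mul_eq_one_iff (z : ℂ) :
    Complex.exp (2 * Real.pi * Complex.I * z) = 1 ↔ z ∈ (Int.castAddHom ℂ).range := by
  rw [Complex.exp_eq_one_iff]
  refine exists_congr fun m => ?_
  rw [mul_comm _ z, mul_left_inj' Complex.two_pi_I_ne_zero, eq_comm]
  rfl

variable {d : ℕ} {X₀ X₁ : Type u}
  [TopologicalSpace X₀] [ChartedSpace (EuclideanSpace ℝ (Fin d)) X₀]
  [TopologicalSpace X₁] [ChartedSpace (EuclideanSpace ℝ (Fin d)) X₁]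
  [IsManifold (𝓡 d) ∞ X₀] [IsManifold (𝓡 d) ∞ X₁] (G : SmoothEtaleGroupoid d X₀ X₁)

theorem neg_refl_trans_symm_hom_comp {C : Type*} [Category* C] [Preadditive C] {A A' B B' : C}
    (e : A' ≅ A) (f : A ⟶ B) (e' : B' ≅ B) :
    ((-Iso.refl A) ≪≫ e.symm).hom ≫ (-(e.hom ≫ f ≫ e'.inv)) = f ≫ e'.inv := by
  simp

theorem shortExact_shiftedDeligneToUnits {n : ℕ} (hn : 1 ≤ n) {c : ℂ} (hc0 : c ≠ 0)
    (hc : ∀ z, Complex.exp (c * z) = 1 ↔ z ∈ twistedIntegers n) :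
    (ShortComplex.mk _ _
      (shiftedDeligneComplex_d_comp (G := G) hn fun z hz => (hc z).2 hz)).ShortExact := by
  have h := shortExact_exp G (ι := (twistedIntegers n).subtype) Subtype.val_injective hc0
    (fun z => (hc z).trans (by rw [AddSubgroup.range_subtype]))
  have h1 := shiftedDeligneComplex_d (G := G) (n := n) (i := -1) (j := 0) (k := n) (k' := n - 1)
    rfl (by simp) rfl (by lia)
  have h2 := shiftedDeligneToUnitsF_eq (G := G) (n := n) c (i := 0) (j := 0) (k := n - 1) rfl
    (by lia)
  let e₁ := shiftedDeligneXIso (G := G) (n := n) (i := -1) (j := 0) (k := n) rfl (by simp)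
  let e₂ := shiftedDeligneXIso (G := G) (n := n) (i := 0) (j := 1) (k := n - 1) rfl (by lia)
  let e₃ := unitsComplexXIso (G := G) (n := n) (i := 0) (j := 0) (k := n - 1) rfl (by lia)
  refine ShortComplex.shortExact_of_iso (ShortComplex.isoMk
    (S₁ := ShortComplex.mk (valueHom G (twistedIntegers n).subtype) (expHom G c) _)
    -- The minus sign absorbs the sign that the shift puts on the differential, which is otherwise
    -- the inclusion of ℤ(n).
    ((-Iso.refl _) ≪≫ e₁.symm) e₂.symm e₃.symm ?_ ?_) h
  · refine (congrArg (CategoryStruct.comp _) h1).trans ?_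
    exact neg_refl_trans_symm_hom_comp e₁ (integersDeRhamD G n 0) e₂
  · refine (congrArg (CategoryStruct.comp _) h2).trans ?_
    exact Iso.inv_hom_id_assoc _ _

/-- The shift accounts for the change from `p` to `p - 1`. The exponential morphism is invertible
outside degrees `-1` and `0`, being multiplication by a nonzero number or a map of zero objects, and
in those two degrees the exponential sequence applies. -/
theorem nonempty_hypercohomology_deligneComplex_iso {n : ℕ} (hn : 1 ≤ n) (p : ℤ) :
    Nonempty ((hypercohomology G p).obj (deligneComplex G n) ≅
      (hypercohomology G (p - 1)).obj (unitsComplex G n)) := by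
  let := HasDerivedCategory.standard (GSheaf G)
  let := HasDerivedCategory.standard AddCommGrpCat.{u}
  have hc := exp_expConst_mul_eq_one_iff n
  obtain ⟨e⟩ := (invariantSections G).nonempty_hyperRightDerived_iso_of_shift
    (K := shiftedDeligneComplex G n) (L := deligneComplex G n) 1 (Iso.refl _) (p - 1) p (by lia)
  have hU : (unitsComplex G n).obj.IsStrictlyGE 0 := isStrictlyGE_cutoff G _ _
  have hI := (invariantSections G).isIso_hyperRightDerived_map_of_cokernel
    (shiftedDeligneToUnits (G := G) hn fun z hz => (hc z).2 hz) (fun i h1 h2 => ?_)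
    ((unitsComplex G n).obj.isZero_of_isStrictlyGE 0 (-1) (by simp))
    (shiftedDeligneComplex_d_comp hn fun z hz => (hc z).2 hz)
    (shortExact_shiftedDeligneToUnits G hn (expConst_ne_zero n) hc) (p - 1)
  · exact ⟨e.symm ≪≫ @asIso _ _ _ _ _ hI⟩
  · have hD : (deligneComplex G n).obj.IsStrictlyGE 0 := isStrictlyGE_cutoff G _ _
    have hz {A B : GSheaf G} (f : A ⟶ B) (hA : Limits.IsZero A) (hB : Limits.IsZero B) : IsIso f :=
      ⟨0, hA.eq_of_src _ _, hB.eq_of_src _ _⟩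
    by_cases h3 : i < 0
    · have : (shiftedDeligneComplex G n).obj.IsStrictlyGE (-1) :=
        CochainComplex.isStrictlyGE_shift _ 0 1 (-1) (by simp)
      exact hz _ ((shiftedDeligneComplex G n).obj.isZero_of_isStrictlyGE (-1) i
        (by lia)) ((unitsComplex G n).obj.isZero_of_isStrictlyGE 0 i h3)
    by_cases h4 : (n : ℤ) - 1 < i
    · exact hz _ (isZero_cutoff_X_of_lt G _ (show (n : ℤ) < i + 1 by lia))
        (isZero_cutoff_X_of_lt G _ h4)
    obtain ⟨k, hk⟩ : ∃ k : ℕ, (n : ℤ) - 1 - k = i := ⟨(n - 1 - i).toNat, by lia⟩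
    obtain ⟨j, hj⟩ : ∃ j : ℕ, ((j + 1 : ℕ) : ℤ) = i := ⟨(i - 1).toNat, by lia⟩
    have := isIso_expTerm G n (expConst_ne_zero n) j
    have h5 : (shiftedDeligneToUnits (G := G) hn fun z hz => (hc z).2 hz).hom.f i = _ :=
      shiftedDeligneToUnitsF_eq (expConst n) hj hk
    rw [h5]
    infer_instance

theorem unitsProj_f_zero {n : ℕ} (hn : 1 ≤ n) : (unitsProj G hn).hom.f 0 =
    (unitsComplexXZero G hn).hom ≫
      (HomologicalComplex.singleObjXSelf (ComplexShape.up ℤ) 0 (unitsSheaf G)).inv := by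
  unfold unitsProj
  apply HomologicalComplex.mkHomToSingle_f
  have : (unitsComplex G n).obj.IsStrictlyGE 0 := isStrictlyGE_cutoff G _ _
  rintro i (hi : i + 1 = 0)
  exact ((unitsComplex G n).obj.isZero_of_isStrictlyGE 0 i (by lia)).eq_of_src _ _

theorem constToUnits_f_zero {n : ℕ} (hn : 1 ≤ n) : (constToUnits G hn).hom.f 0 =
    (HomologicalComplex.singleObjXSelf (ComplexShape.up ℤ) 0 (constSheaf G (Additive ℂˣ))).hom ≫
      unitsInclHom G ≫ (unitsComplexXZero G hn).inv := by
  unfold constToUnits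
  apply HomologicalComplex.mkHomFromSingle_f
  rintro _ rfl
  exact unitsIncl_comp_unitsComplex_d G hn

/-- The terms of positive degree are sheaves of forms, acyclic by properness, and they stop in
degree `n - 1`. -/
theorem isIso_hypercohomology_map_unitsProj [T2Space X₀] [T2Space X₁] [SecondCountableTopology X₀]
    (hG : G.IsProper) {n : ℕ} (hn : 1 ≤ n) {p : ℤ} (hp : n ≤ p) :
    IsIso ((hypercohomology G p).map (unitsProj G hn)) := by
  let := HasDerivedCategory.standard (GSheaf G)
  let := HasDerivedCategory.standard AddCommGrpCat.{u}
  have hU : (unitsComplex G n).obj.IsStrictlyGE 0 := isStrictlyGE_cutoff G _ _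
  have hz (i : ℤ) (hi : n ≤ i) : Limits.IsZero ((unitsComplex G n).obj.X i) :=
    isZero_cutoff_X_of_lt G _ (by lia)
  refine (invariantSections G).isIso_hyperRightDerived_map_toSingle (A := unitsSheaf G)
    (unitsProj G hn) ?_ n hn hz (fun i hi => ?_) p hp
  · rw [unitsProj_f_zero]
    exact (unitsComplexXZero G hn ≪≫
      (HomologicalComplex.singleObjXSelf (ComplexShape.up ℤ) 0 (unitsSheaf G)).symm).isIso_hom
  · by_cases h : i < n
    · obtain ⟨k, ⟨e⟩⟩ := unitsComplex_X_pos G hi h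
      exact ((formSheafAction G k).isRightAcyclic hG).of_iso e.symm
    · exact Functor.IsRightAcyclic.of_isZero _ (hz i (by lia))

/-- In the exponential sequence with kernel ℤ the middle term is the sheaf of 0-forms, which is
acyclic; `0 < p` puts both neighbours of the connecting map in positive degree. -/
theorem nonempty_sheafCohomology_unitsSheaf_iso [T2Space X₀] [T2Space X₁]
    [SecondCountableTopology X₀] (hG : G.IsProper) {p : ℤ} (hp : 0 < p) :
    Nonempty (sheafCohomology G (unitsSheaf G) p ≅ sheafCohomology G (constSheaf G ℤ) (p + 1)) := by
  let := HasDerivedCategory.standard (GSheaf G)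
  let := HasDerivedCategory.standard AddCommGrpCat.{u}
  have h := shortExact_exp G (ι := Int.castAddHom ℂ) Int.cast_injective
    Complex.two_pi_I_ne_zero exp_two_pi_I_mul_eq_one_iff
  have hA := (formSheafAction G 0).isRightAcyclic hG
  exact (invariantSections G).nonempty_hyperRightDerived_iso _ _ _
    (Functor.shortExact_single h 0) p (hA p hp) (hA (p + 1) (by lia))

theorem isIso_hypercohomology_map_constToUnits {n : ℕ} (hn : 1 ≤ n) {p : ℤ} (hp : p < n - 1) :
    IsIso ((hypercohomology G p).map (constToUnits G hn)) := by
  let := HasDerivedCategory.standard (GSheaf G)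
  let := HasDerivedCategory.standard AddCommGrpCat.{u}
  have hU : (unitsComplex G n).obj.IsStrictlyGE 0 := isStrictlyGE_cutoff G _ _
  have hm : Mono ((constToUnits G hn).hom.f 0) := by
    have h1 := mono_unitsInclHom G
    have h2 : Mono (unitsInclHom G ≫ (unitsComplexXZero G hn).inv) := mono_comp _ _
    rw [constToUnits_f_zero]
    exact @mono_comp _ _ _ _ _ _ (@IsIso.mono_of_iso _ _ _ _ _ (Iso.isIso_hom _)) _ h2
  -- The complex is a resolution below degree `m = n - 1`. The condition in degree `0` is only asked
  -- for when `0 < n - 1`, that is when the 1-forms are present; for `n = 1` only negative degrees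
  -- are concerned and injectivity suffices.
  refine (invariantSections G).isIso_hyperRightDerived_map_fromSingle
    (A := constSheaf G (Additive ℂˣ)) (constToUnits G hn) hm (n - 1) (fun h => ?_)
    (fun i hi hi' => exactAt_unitsComplex G hi hi') p hp
  refine (CochainComplex.quasiIsoAt_zero_iff _ ?_ ?_ ?_).2 ⟨?_, hm⟩
  · exact HomologicalComplex.single_obj_d (ComplexShape.up ℤ) _ _ _ _
  · exact HomologicalComplex.single_obj_d (ComplexShape.up ℤ) _ _ _ _
  · exact (CochainComplex.isZero_of_isStrictlyGE (unitsComplex G n).obj 0 (-1) (by simp)).eq_of_src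
      _ _
  · refine ShortComplex.exact_of_iso (ShortComplex.isoMk
      (HomologicalComplex.singleObjXSelf (ComplexShape.up ℤ) 0 _).symm (Iso.refl _) (Iso.refl _)
      ?_ ?_) (exact_unitsIncl_unitsComplex_d G (n := n) (by lia))
    · refine (congrArg (CategoryStruct.comp _) (constToUnits_f_zero G hn)).trans ?_
      exact (Iso.inv_hom_id_assoc _ _).trans (Category.comp_id _).symm
    · exact (Category.id_comp _).trans (Category.comp_id _).symm

end DeligneGroupoid

theorem mainTheorem9 (d : ℕ) {X₀ X₁ : Type u}
    [TopologicalSpace X₀] [ChartedSpace (EuclideanSpace ℝ (Fin d)) X₀] [IsManifold (𝓡 d) ∞ X₀]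
    [T2Space X₀] [SecondCountableTopology X₀]
    [TopologicalSpace X₁] [ChartedSpace (EuclideanSpace ℝ (Fin d)) X₁] [IsManifold (𝓡 d) ∞ X₁]
    [T2Space X₁] [SecondCountableTopology X₁]
    (G : DeligneGroupoid.SmoothEtaleGroupoid d X₀ X₁) (n : ℕ) (hn : 1 ≤ n) :
    (∀ p : ℤ, Nonempty
      ((DeligneGroupoid.hypercohomology G p).obj (DeligneGroupoid.deligneComplex G n) ≅
        (DeligneGroupoid.hypercohomology G (p - 1)).obj (DeligneGroupoid.unitsComplex G n))) ∧
    (G.IsProper → ∀ p : ℤ, (n : ℤ) < p →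
      IsIso ((DeligneGroupoid.hypercohomology G (p - 1)).map (DeligneGroupoid.unitsProj G hn) :
        (DeligneGroupoid.hypercohomology G (p - 1)).obj (DeligneGroupoid.unitsComplex G n) ⟶
          DeligneGroupoid.sheafCohomology G (DeligneGroupoid.unitsSheaf G) (p - 1)) ∧
      Nonempty (DeligneGroupoid.sheafCohomology G (DeligneGroupoid.unitsSheaf G) (p - 1) ≅
        DeligneGroupoid.sheafCohomology G (DeligneGroupoid.constSheaf G ℤ) p)) ∧
    (∀ p : ℤ, p < (n : ℤ) →
      IsIso ((DeligneGroupoid.hypercohomology G (p - 1)).map (DeligneGroupoid.constToUnits G hn) :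
        DeligneGroupoid.sheafCohomology G
            (DeligneGroupoid.constSheaf G (Additive ℂˣ)) (p - 1) ⟶
          (DeligneGroupoid.hypercohomology G (p - 1)).obj
            (DeligneGroupoid.unitsComplex G n))) := by
  refine ⟨fun p => DeligneGroupoid.nonempty_hypercohomology_deligneComplex_iso G hn p,
    fun hG p hp => ⟨?_, ?_⟩, fun p hp => ?_⟩
  · exact DeligneGroupoid.isIso_hypercohomology_map_unitsProj G hG hn (by lia)
  -- From `p > n ≥ 1` the degree `p - 1` is positive.
  · obtain ⟨e⟩ := DeligneGroupoid.nonempty_sheafCohomology_unitsSheaf_iso G hG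
      (p := p - 1) (by lia)
    exact ⟨e ≪≫ eqToIso (by rw [sub_add_cancel])⟩
  · exact DeligneGroupoid.isIso_hypercohomology_map_constToUnits G hn (by lia)
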